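/- **Notation.** Words are finite strings of digits $0,1$; sequences are elements of $\{0,1\}^{\mathbb N}$, compared lexicographically ($\prec,\preccurlyeq$); $\sigma$ is the left shift. For a word $w$ let $w^\infty$ be the periodic sequence with period block $w$, let $w^+$ (resp. $w^-$) be $w$ with its last digit $0$ changed to $1$ (resp. its last digit $1$ changed to $0$), and let $\mathbb L(w)$ be the lexicographically largest cyclic permutation of $w$. A word is *Lyndon* if it is aperiodic (not a power $u^k$ with $k\ge2$) and lexicographically smallest among its cyclic permutations. *Farey words* are the words occurring in the ordered lists $F_0=(0,1)$, $F_1=(0,01,1)$, $F_2=(0,001,01,011,1),\dots$, where $F_{n+1}$ arises from $F_n$ by inserting between any two neighbours $u,v$ the word $uv$; $F^*$ is the set of Farey words of length at least $2$. For $s\in F^*$ and a word $r$, the word $s\bullet r$ is obtained from $r$ by replacing each maximal run $0^k$ by $s^-\mathbb L(s)^{k-1}$ and each maximal run $1^k$ by $\mathbb L(s)^+s^{k-1}$. Let $\Lambda$ be the set of all words $s_1\bullet(s_2\bullet(\cdots\bullet s_k))$ with $k\ge1$ and $s_i\in F^*$. Let $\beta\in(1,2]$. An expansion of $x$ in base $\beta$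 is a sequence $(d_i)_{i\ge1}$ with $\sum_{i\ge 1} d_i\beta^{-i}=x$. Let $b(x,\beta)$ be the lexicographically largest expansion of $x$ (the greedy expansion), and let $\alpha(\beta)=\alpha_1\alpha_2\cdots$ be the lexicographically largest expansion of $1$ not ending in $0^\infty$. A *$\beta$-Lyndon word* is a Lyndon word $w$ such that $w^\infty=b(t,\beta)$ for some $t\in[0,1)$. For a Lyndon word $v$ let $v^*$ be the smallest $\beta$-Lyndon word with $(v^*)^\infty\succcurlyeq v^\infty$. For $S\in\Lambda$ the *basic interval* $I^S=[\beta_\ell^S,\beta_*^S]$ is given by $\alpha(\beta_\ell^S)=\mathbb L(S)^\infty$ and $\alpha(\beta_*^S)=\mathbb L(S)^+S^-\mathbb L(S)^\infty$. With $T_\beta(x)=\beta x \bmod 1$ and $K_\beta(t)=\{x\in[0,1): T_\beta^n(x)\ge t\ \forall n\ge0\}$, put $$\mathscr E_\beta=\{t\in[0,1): K_\beta(t')\ne K_\beta(t)\ \forall t'>t\},\qquad \mathscr B_\beta=\{t\ge0:\dim_H K_\beta(t')<\dim_H K_\beta(t)\ \forall t'>t\}.$$ **The collection $\mathcal I$.**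 Let $\beta\in(\beta_\ell^S,\beta_*^S)$ with $S\in\Lambda$. Let $a=\alpha(\beta)$ if $\alpha(\beta)$ is not purely periodic, and let $a=b(1,\beta)$ if it is. Put $j_1=|S|$. Given $j_k$, stop if $\sigma^{j_k}(a)=0^\infty$ or if $\sigma^{j_k+n}(a)\succ\sigma^{j_k}(a)$ for all $n\ge1$. Otherwise let $n_k=\min\{n\ge1:\sigma^{j_k+n}(a)\preccurlyeq\sigma^{j_k}(a)\}$, $v_k=a_{j_k+1}\cdots a_{j_k+n_k}$, and $I_k=[\underline t_k,\overline t_k)$, where $\underline t_k,\overline t_k\in[0,1)$ are given by $$b(\underline t_k,\beta)=v_k^-(\alpha_1\cdots\alpha_{j_k}^-)^\infty,\qquad b(\overline t_k,\beta)=(v_k^*)^\infty ;$$ only if $v_k$ is a $\beta$-Lyndon word of length at least $2$ and $\sigma^{j_k}(\alpha(\beta))=v_k^\infty$, take the closed interval $I_k=[\underline t_k,\overline t_k]$ instead. Then continue with $j_{k+1}=j_k+n_k$. Let $\mathcal I$ be the (finite or infinite, possibly empty) collection of all intervals $I_k$ obtained. A *non-transitivity window* is an element of $\mathcal I$ that is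 maximal with respect to inclusion. **Theorem 9.6.** Let $S\in\Lambda$ and $\beta\in(\beta_\ell^S,\beta_*^S)$. If $I_k$ is a non-transitivity window, then $\dim_H(\mathscr E_\beta\cap I_k)>0$. In particular, if $\mathcal I$ is nonempty, then $\dim_H(\mathscr E_\beta\setminus\mathscr B_\beta)>0$. -/

import Mathlib

namespace BetaBifurcation

noncomputable section

/-! Words are lists of digits, sequences are functions `ℕ → Bool` (`false` is the digit `0`, `true`
is the digit `1`); the first digit of a sequence has index `0`. Sequences are compared
lexicographically through `toLex`, words of equal length through the order of `List Bool`. -/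

/-- The shifted sequence `σ^n (a)`. -/
def shift (n : ℕ) (a : ℕ → Bool) : ℕ → Bool := fun i => a (n + i)

/-- The sequence `0^∞`. -/
def zeroSeq : ℕ → Bool := fun _ => false

/-- The periodic sequence `w^∞`, for a nonempty word `w`. -/
def per (w : List Bool) : ℕ → Bool := fun i => w.getD (i % w.length) false

/-- The concatenation of a word and a sequence. -/
def cat (w : List Bool) (a : ℕ → Bool) : ℕ → Bool :=
  fun i => if i < w.length then w.getD i false else a (i - w.length)

/-- The word `a_{j+1} … a_{j+n}` (in the usual indexing from `1`). -/
def subword (a : ℕ → Bool) (j n : ℕ) : List Bool := (List.range n).map fun i => a (j + i)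

/-- `w⁺`: the last digit is replaced by `1`. Only used for words that end in `0`. -/
def plus (w : List Bool) : List Bool := w.dropLast ++ [true]

/-- `w⁻`: the last digit is replaced by `0`. Only used for words that end in `1`. -/
def minus (w : List Bool) : List Bool := w.dropLast ++ [false]

/-- The lexicographically largest cyclic permutation of `w`. -/
def maxRot (w : List Bool) : List Bool :=
  ((List.range w.length).map fun i => w.rotate i).foldr max w

/-- Lyndon words: aperiodic (not a proper power; this excludes the empty word) and smallest among
all cyclic permutations. -/
def IsLyndon (w : List Bool) : Prop :=
  (∀ (u : List Bool) (k : ℕ), 2 ≤ k → w ≠ (List.replicate k u).flatten) ∧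
    ∀ i : ℕ, w ≤ w.rotate i

/-! ### Farey words, substitutions, the set `Λ` -/

/-- Insert between any two neighbours of a list of words their concatenation. -/
def fareyInsert : List (List Bool) → List (List Bool)
  | u :: v :: l => u :: (u ++ v) :: fareyInsert (v :: l)
  | l => l

/-- The ordered sets `F_0 = (0, 1)`, `F_1 = (0, 01, 1)`, `F_2 = (0, 001, 01, 011, 1)`, … -/
def fareyList : ℕ → List (List Bool)
  | 0 => [[false], [true]]
  | n + 1 => fareyInsert (fareyList n)

/-- Farey words of length at least two. -/
def IsFarey (w : List Bool) : Prop := (∃ n, w ∈ fareyList n) ∧ 2 ≤ w.length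

/-- The block that the substitution by `s` writes for the digit `c` when the previous digit
is `p`. -/
def substBlock (s : List Bool) (p c : Bool) : List Bool :=
  match p, c with
  | true, false => minus s
  | false, false => maxRot s
  | false, true => plus (maxRot s)
  | true, true => s

/-- The substitution by `s`, applied to a word that is preceded by the digit `p`. -/
def substFrom (s : List Bool) : Bool → List Bool → List Bool
  | _, [] => []
  | p, c :: r => substBlock s p c ++ substFrom s c r

/-- `s • r = Φ_s (r)`: a run `0^k` becomes `s⁻ 𝕃(s)^(k-1)`, a run `1^k` becomes `𝕃(s)⁺ s^(k-1)`,
where `𝕃(s)` is the largest cyclic permutation of `s`. -/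
def subst (s : List Bool) : List Bool → List Bool
  | [] => []
  | c :: r => substFrom s (!c) (c :: r)

/-- The set `Λ` of all words `s₁ • s₂ • ⋯ • s_k` with `k ≥ 1` and Farey words `s_i` of length at
least two. -/
inductive IsLambda : List Bool → Prop
  | farey {s : List Bool} : IsFarey s → IsLambda s
  | subst {s r : List Bool} : IsFarey s → IsLambda r → IsLambda (subst s r)

/-! ### Expansions in base `β` -/

/-- The value `∑_{i ≥ 1} d_i β^{-i}`. -/
def val (β : ℝ) (d : ℕ → Bool) : ℝ := ∑' i : ℕ, ((d i).toNat : ℝ) / β ^ (i + 1)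

/-- `d` is the lexicographically largest expansion of `x` in base `β`. -/
def IsGreedy (β x : ℝ) (d : ℕ → Bool) : Prop :=
  val β d = x ∧ ∀ e : ℕ → Bool, val β e = x → toLex e ≤ toLex d

/-- `d` has infinitely many digits `1`, i.e. it does not end in `0^∞`. -/
def NotEndingInZeros (d : ℕ → Bool) : Prop := ∀ n : ℕ, ∃ i, n ≤ i ∧ d i = true

/-- `d` is the lexicographically largest expansion of `1` in base `β` not ending in `0^∞`. -/
def IsQuasiGreedyOne (β : ℝ) (d : ℕ → Bool) : Prop :=
  val β d = 1 ∧ NotEndingInZeros d ∧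
    ∀ e : ℕ → Bool, val β e = 1 → NotEndingInZeros e → toLex e ≤ toLex d

/-- The greedy expansion `b(x, β)`. -/
def greedy (β x : ℝ) : ℕ → Bool := Classical.epsilon (IsGreedy β x)

/-- The quasi-greedy expansion `α(β)` of `1`. -/
def alpha (β : ℝ) : ℕ → Bool := Classical.epsilon (IsQuasiGreedyOne β)

/-- `w` is a `β`-Lyndon word: a Lyndon word such that `w^∞ = b(t, β)` for some `t ∈ [0, 1)`. -/
def IsBetaLyndon (β : ℝ) (w : List Bool) : Prop :=
  IsLyndon w ∧ ∃ t ∈ Set.Ico (0 : ℝ) 1, greedy β t = per w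

/-- `w` is the smallest `β`-Lyndon word with `w^∞ ≽ v^∞`. -/
def IsBetaLyndonHull (β : ℝ) (v w : List Bool) : Prop :=
  (IsBetaLyndon β w ∧ toLex (per v) ≤ toLex (per w)) ∧
    ∀ u : List Bool, IsBetaLyndon β u → toLex (per v) ≤ toLex (per u) →
      toLex (per w) ≤ toLex (per u)

/-- The word `v^*`. -/
def betaLyndonHull (β : ℝ) (v : List Bool) : List Bool := Classical.epsilon (IsBetaLyndonHull β v)

/-- The point `t ∈ [0, 1)` whose greedy expansion in base `β` is the sequence `a`. -/
def pointOf (β : ℝ) (a : ℕ → Bool) : ℝ :=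
  Classical.epsilon fun t : ℝ => t ∈ Set.Ico (0 : ℝ) 1 ∧ greedy β t = a

/-- `[bl, br]` is the basic interval generated by `S`. -/
def IsBasicInterval (S : List Bool) (bl br : ℝ) : Prop :=
  bl ∈ Set.Ioc (1 : ℝ) 2 ∧ br ∈ Set.Ioc (1 : ℝ) 2 ∧
    alpha bl = per (maxRot S) ∧
    alpha br = cat (plus (maxRot S)) (cat (minus S) (per (maxRot S)))

/-! ### The collection of intervals -/

open Classical in
/-- The sequence on which the construction runs: `α(β)` if it is not periodic, and the greedy
expansion of `1` if `α(β)` is (purely) periodic. -/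
def baseSeq (β : ℝ) : ℕ → Bool :=
  if ∃ m : ℕ, 1 ≤ m ∧ shift m (alpha β) = alpha β then greedy β 1 else alpha β

/-- At position `j` the construction does not stop, and `n` is the length of the next word:
`n = min {n ≥ 1 : σ^(j+n) a ≼ σ^j a}`; the construction also stops when `σ^j a = 0^∞`. -/
def IsNextLength (a : ℕ → Bool) (j n : ℕ) : Prop :=
  shift j a ≠ zeroSeq ∧
    IsLeast {n : ℕ | 1 ≤ n ∧ toLex (shift (j + n) a) ≤ toLex (shift j a)} n

/-- The positions `j_1 = |S|`, `j_{k+1} = j_k + n_k` reached by the construction. -/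
inductive IsPosition (a : ℕ → Bool) (S : List Bool) : ℕ → Prop
  | first : IsPosition a S S.length
  | next {j n : ℕ} : IsPosition a S j → IsNextLength a j n → IsPosition a S (j + n)

/-- The left endpoint: the point with greedy expansion `v⁻ (α_1 … α_j⁻)^∞`. -/
def lowerEnd (β : ℝ) (j : ℕ) (v : List Bool) : ℝ :=
  pointOf β (cat (minus v) (per (minus (subword (alpha β) 0 j))))

/-- The right endpoint: the point with greedy expansion `(v^*)^∞`. -/
def upperEnd (β : ℝ) (v : List Bool) : ℝ := pointOf β (per (betaLyndonHull β v))

open Classical in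
/-- The interval attached to the position `j` and the word `v`: half-open, except that it is closed
if `v` is a `β`-Lyndon word of length at least two and `σ^j (α(β)) = v^∞`. -/
def interval (β : ℝ) (j : ℕ) (v : List Bool) : Set ℝ :=
  if IsBetaLyndon β v ∧ 2 ≤ v.length ∧ shift j (alpha β) = per v
  then Set.Icc (lowerEnd β j v) (upperEnd β v)
  else Set.Ico (lowerEnd β j v) (upperEnd β v)

/-- The collection `𝓘` of all the intervals `I_k` produced by the construction. -/
def intervals (β : ℝ) (S : List Bool) : Set (Set ℝ) :=
  {I | ∃ j n : ℕ, IsPosition (baseSeq β) S j ∧ IsNextLength (baseSeq β) j n ∧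
    I = interval β j (subword (baseSeq β) j n)}

/-- Non-transitivity windows: the maximal elements of `𝓘` with respect to inclusion. -/
def IsWindow (β : ℝ) (S : List Bool) (I : Set ℝ) : Prop :=
  Maximal (fun J : Set ℝ => J ∈ intervals β S) I

/-! ### Survivor sets and bifurcation sets -/

/-- The map `x ↦ β x mod 1`. -/
def betaMap (β x : ℝ) : ℝ := Int.fract (β * x)

/-- `K_β(t) = {x ∈ [0, 1) : T_β^n (x) ≥ t for all n ≥ 0}`. -/
def survivor (β t : ℝ) : Set ℝ :=
  {x | x ∈ Set.Ico (0 : ℝ) 1 ∧ ∀ n : ℕ, t ≤ (betaMap β)^[n] x}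

/-- The bifurcation set `ℰ_β`. -/
def bifurcationSet (β : ℝ) : Set ℝ :=
  {t | t ∈ Set.Ico (0 : ℝ) 1 ∧ ∀ t' : ℝ, t < t' → survivor β t' ≠ survivor β t}

/-- The dimension bifurcation set `ℬ_β`. -/
def dimBifurcationSet (β : ℝ) : Set ℝ :=
  {t | 0 ≤ t ∧ ∀ t' : ℝ, t < t' → dimH (survivor β t') < dimH (survivor β t)}

end

end BetaBifurcation

namespace BetaBifurcation

local notation:50 a:51 " ≺ " b:51 => toLex a < toLex b
local notation:50 a:51 " ≼ " b:51 => toLex a ≤ toLex b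

section

/-! ### Lexicographic order on sequences -/

/-! Everything is done with digit sequences. By Parry's criterion, points of `[0,1)` correspond, in
an order-preserving way, to the sequences all of whose shifts are below `α(β)` (`Admissible`). Such
a sequence `d` gives a point of `ℰ_β` as soon as `d ≼ σ^i d` for all `i`.

Let `a` be the base sequence, `j` a position, `v` the word at `j`. Then `v` is Lyndon and ends in
`1`, and so does the prefix of `a` of length `j`; write this prefix as `A₀1`, and put `A = A₀0`, `V
= v⁻`. The left endpoint of the interval is the point with expansion `V A^∞`. With `D = A₀1VA`,
consider the sequences `V A^(N+1) B₁ B₂ …`, where each `B_i` is `D` or `DA`. They lie between `V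
A^∞` and `v^∞`, hence in the interval. They are admissible because every lowered factor of `a` lies
below the prefix of `a` of the same length. The free choice of the blocks `B_i` gives positive
dimension: the set maps onto a set containing `[0,1]` by a Hölder map (`dimH_range_flat_pos`).

It remains to see that such a sequence is minimal among its shifts. This is true for large `N` if `V
A^∞ ≺ q A^∞` for every proper suffix `q` of `A` or of `V` (`BlockData`,
`BlockData.eventually_le_shift`). For suffixes of `V` this comes from the Lyndon property of `v`. A
suffix of `A` that begins in the first `|S|` digits is handled by `σ^|S| a ≺ S^∞`. One that begins
later lies in an earlier word `v'`, and here maximality of the window enters: if the left endpoint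
of the earlier interval were smaller, the window would be strictly contained in that interval
(`BaseData.interval_subset`), so `V A^∞ ≼ V' A'^∞`, which is what the comparison needs
(`BaseData.blockData`).

For the second claim take `j = |S|`, where there is no earlier word and `A = 𝕃(S)`. If `d` starts in
this way and `d'` is slightly larger but still below `v^∞`, then a sequence surviving for `d` but
not for `d'` has a shift below `v^∞`. From there on it is cut by a two-state automaton into blocks
`A`, `A₀1` (length `|S|`) and `V`, `v` (length `|v|`). The values of such sequences have at most the
dimension of those of free concatenations of `S` and a certain word `w` with `|w| ≤ |v|`, and these
concatenations survive for `d'`. So the dimension of the survivor set does not drop from `d` to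
`d'`, and the whole family avoids `ℬ_β` (`BaseData.dimH_survivor_le`, `BaseData.dimH_sdiff_pos`). -/

theorem slt_iff {a b : ℕ → Bool} :
    a ≺ b ↔ ∃ k, (∀ i < k, a i = b i) ∧ a k = false ∧ b k = true := by
  have h : a ≺ b ↔ ∃ k, (∀ i < k, a i = b i) ∧ a k < b k := Iff.rfl
  rw [h]
  simp only [Bool.lt_iff]

theorem not_slt {a b : ℕ → Bool} : ¬ a ≺ b ↔ b ≼ a := not_lt

theorem not_sle {a b : ℕ → Bool} : ¬ a ≼ b ↔ b ≺ a := not_le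

theorem sle_of_eq {a b : ℕ → Bool} (h : a = b) : a ≼ b := h ▸ le_refl (toLex a)

theorem sle_antisymm {a b : ℕ → Bool} (h1 : a ≼ b) (h2 : b ≼ a) : a = b :=
  toLex.injective (le_antisymm h1 h2)

theorem not_lt_zeroSeq {a : ℕ → Bool} : ¬ a ≺ zeroSeq := by
  rw [slt_iff]
  rintro ⟨k, -, -, h⟩
  simp [zeroSeq] at h

theorem not_ones_lt {a : ℕ → Bool} : ¬ (fun _ => true) ≺ a := by
  rw [slt_iff]
  rintro ⟨k, -, h, -⟩
  simp at h

@[simp] theorem cat_nil (a : ℕ → Bool) : cat [] a = a := by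
  funext i; simp [cat]

theorem cat_cons_zero (c : Bool) (w : List Bool) (a : ℕ → Bool) : cat (c :: w) a 0 = c := by
  simp [cat]

theorem cat_append (u w : List Bool) (a : ℕ → Bool) : cat (u ++ w) a = cat u (cat w a) := by
  funext i
  simp only [cat, List.length_append]
  by_cases h1 : i < u.length
  · rw [if_pos (by omega), if_pos h1, List.getD_append _ _ _ _ h1]
  · rw [if_neg h1]
    by_cases h2 : i - u.length < w.length
    · rw [if_pos (by omega), if_pos h2, List.getD_append_right _ _ _ _ (by omega)]
    · rw [if_neg (by omega), if_neg h2]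
      congr 1; omega

theorem cat_apply_lt {w : List Bool} {a : ℕ → Bool} {i : ℕ} (h : i < w.length) :
    cat w a i = w.getD i false := by simp [cat, h]

theorem cat_apply_add (w : List Bool) (a : ℕ → Bool) (i : ℕ) : cat w a (w.length + i) = a i := by
  simp [cat]

@[simp] theorem shift_zero (a : ℕ → Bool) : shift 0 a = a := by
  funext i; simp [shift]

theorem shift_apply (n : ℕ) (a : ℕ → Bool) (i : ℕ) : shift n a i = a (n + i) := rfl

@[simp] theorem shift_shift (i j : ℕ) (a : ℕ → Bool) : shift i (shift j a) = shift (j + i) a := by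
  funext l; simp [shift, add_assoc]

theorem shift_cat_length (w : List Bool) (a : ℕ → Bool) : shift w.length (cat w a) = a := by
  funext i; simp [shift, cat_apply_add]

theorem shift_cat_add (w : List Bool) (a : ℕ → Bool) (i : ℕ) :
    shift (w.length + i) (cat w a) = shift i a := by
  rw [← shift_shift, shift_cat_length]

theorem shift_cat {w : List Bool} {i : ℕ} (h : i ≤ w.length) (a : ℕ → Bool) :
    shift i (cat w a) = cat (w.drop i) a := by
  have := shift_cat_length (w.take i) (cat (w.drop i) a)
  rwa [← cat_append, List.take_append_drop, List.length_take, min_eq_left h] at this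

@[simp] theorem length_subword (a : ℕ → Bool) (j n : ℕ) : (subword a j n).length = n := by
  simp [subword]

theorem getD_subword {a : ℕ → Bool} {j n i : ℕ} (h : i < n) :
    (subword a j n).getD i false = a (j + i) := by
  simp [subword, h]

theorem cat_subword (a : ℕ → Bool) (j n : ℕ) :
    cat (subword a j n) (shift (j + n) a) = shift j a := by
  funext i
  by_cases h : i < n
  · rw [cat_apply_lt (by simpa using h), getD_subword h, shift_apply]
  · simp only [cat, length_subword, h, if_false, shift]
    congr 1; omega

theorem subword_eq_of_agree {a b : ℕ → Bool} {j n : ℕ} (h : ∀ i < n, a (j + i) = b (j + i)) :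
    subword a j n = subword b j n := by
  unfold subword
  apply List.map_congr_left
  intro i hi
  exact h i (List.mem_range.1 hi)

theorem subword_add (a : ℕ → Bool) (j n l : ℕ) :
    subword a j (n + l) = subword a j n ++ subword a (j + n) l := by
  unfold subword
  rw [List.range_add, List.map_append, List.map_map]
  congr 1
  apply List.map_congr_left
  intro i _
  simp [add_assoc]

theorem subword_one (a : ℕ → Bool) (j : ℕ) : subword a j 1 = [a j] := by
  simp [subword]

theorem subword_cat_length (w : List Bool) (a : ℕ → Bool) : subword (cat w a) 0 w.length = w := by
  apply List.ext_getElem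
  · simp
  · intro i h1 h2
    simp [subword, cat, h2]

theorem subword_cat {w : List Bool} {n : ℕ} (h : n ≤ w.length) (a : ℕ → Bool) :
    subword (cat w a) 0 n = w.take n := by
  have := subword_cat_length (w.take n) (cat (w.drop n) a)
  rwa [← cat_append, List.take_append_drop, List.length_take, min_eq_left h] at this

theorem cat_lt_cat (w : List Bool) {a b : ℕ → Bool} : cat w a ≺ cat w b ↔ a ≺ b := by
  rw [slt_iff, slt_iff]
  constructor
  · rintro ⟨k, h, h0, h1⟩
    have hk : w.length ≤ k := by
      by_contra hk
      push Not at hk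
      rw [cat_apply_lt hk] at h0 h1
      rw [h0] at h1
      cases h1
    obtain ⟨l, rfl⟩ := Nat.exists_eq_add_of_le hk
    refine ⟨l, fun i hi => ?_, by simpa [cat_apply_add] using h0, by simpa [cat_apply_add] using h1⟩
    simpa [cat_apply_add] using h (w.length + i) (by omega)
  · rintro ⟨k, h, h0, h1⟩
    refine ⟨w.length + k, fun i hi => ?_, by simpa [cat_apply_add], by simpa [cat_apply_add]⟩
    by_cases hi' : i < w.length
    · rw [cat_apply_lt hi', cat_apply_lt hi']
    · obtain ⟨l, rfl⟩ := Nat.exists_eq_add_of_le (not_lt.1 hi')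
      rw [cat_apply_add, cat_apply_add]
      exact h l (by omega)

theorem cat_le_cat (w : List Bool) {a b : ℕ → Bool} : cat w a ≼ cat w b ↔ a ≼ b := by
  rw [← not_slt, ← not_slt, cat_lt_cat]

theorem per_eq {w : List Bool} (hw : w ≠ []) : per w = cat w (per w) := by
  have h0 : 0 < w.length := List.length_pos_iff.2 hw
  funext i
  by_cases h : i < w.length
  · rw [cat_apply_lt h, per, Nat.mod_eq_of_lt h]
  · obtain ⟨l, rfl⟩ := Nat.exists_eq_add_of_le (not_lt.1 h)
    rw [cat_apply_add, per, per, Nat.add_mod_left]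

theorem shift_per {w : List Bool} (hw : w ≠ []) : shift w.length (per w) = per w := by
  conv_lhs => rw [per_eq hw]
  exact shift_cat_length _ _

theorem shift_per_mod (w : List Bool) (i : ℕ) : shift i (per w) = shift (i % w.length) (per w) := by
  funext l; simp [shift, per, Nat.add_mod]

theorem cat_replicate_per (w : List Bool) (hw : w ≠ []) (N : ℕ) :
    cat (List.replicate N w).flatten (per w) = per w := by
  induction N with
  | zero => simp
  | succ N ih => rw [List.replicate_succ, List.flatten_cons, cat_append, ih, ← per_eq hw]

/-- A sequence between two sequences with a common prefix has that prefix. -/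
theorem eq_cat_of_between {w : List Bool} {a b y : ℕ → Bool} (h1 : cat w a ≼ y)
    (h2 : y ≼ cat w b) : y = cat w (shift w.length y) := by
  by_contra hne
  have hex : ∃ i, i < w.length ∧ y i ≠ w.getD i false := by
    by_contra hcon
    push Not at hcon
    apply hne
    funext i
    by_cases h : i < w.length
    · rw [cat_apply_lt h, hcon i h]
    · obtain ⟨l, rfl⟩ := Nat.exists_eq_add_of_le (not_lt.1 h)
      rw [cat_apply_add, shift_apply]
  classical
  have hk := Nat.find_spec hex
  have hmin := fun i (hi : i < Nat.find hex) => Nat.find_min hex hi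
  set k := Nat.find hex
  have hag : ∀ i < k, y i = w.getD i false := fun i hi => by
    by_contra h
    exact hmin i hi ⟨by omega, h⟩
  cases hy : y k with
  | true =>
    apply not_slt.2 h2
    rw [slt_iff]
    refine ⟨k, fun i hi => ?_, ?_, hy⟩
    · rw [cat_apply_lt (by omega), hag i hi]
    · rw [cat_apply_lt hk.1]
      have := hk.2; rw [hy] at this
      simpa using this.symm
  | false =>
    apply not_slt.2 h1
    rw [slt_iff]
    refine ⟨k, fun i hi => ?_, hy, ?_⟩
    · rw [cat_apply_lt (by omega), hag i hi]
    · rw [cat_apply_lt hk.1]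
      have := hk.2; rw [hy] at this
      simpa using this.symm

theorem cons_apply_zero_of_le {b y : ℕ → Bool} (h : y ≼ b) (hb : b 0 = false) : y 0 = false := by
  by_contra hy
  apply not_slt.2 h
  rw [slt_iff]
  exact ⟨0, by simp, hb, by simpa using hy⟩

/-- There is no word strictly between `w0` and `w1`. -/
theorem adjacent {w : List Bool} {a b y : ℕ → Bool} (h1 : cat (w ++ [false]) a ≼ y)
    (h2 : y ≼ cat (w ++ [true]) b) :
    y = cat (w ++ [false]) (shift (w.length + 1) y) ∨
      y = cat (w ++ [true]) (shift (w.length + 1) y) := by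
  rw [cat_append] at h1 h2
  have hy := eq_cat_of_between h1 h2
  have key : shift w.length y = cat [y w.length] (shift (w.length + 1) y) := by
    rw [← subword_one, cat_subword]
  rw [key] at hy
  cases hc : y w.length
  · left; rw [cat_append, ← hc, ← hy]
  · right; rw [cat_append, ← hc, ← hy]

/-- `a < b` with the first difference before position `R`, hence for all extensions. -/
theorem slt_of_agree {a b a' b' : ℕ → Bool} {R : ℕ} (h : a ≺ b) (hR : ∃ k < R, a k ≠ b k)
    (ha : ∀ i < R, a' i = a i) (hb : ∀ i < R, b' i = b i) : a' ≺ b' := by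
  rw [slt_iff] at h ⊢
  obtain ⟨k, h, h0, h1⟩ := h
  obtain ⟨l, hl, hne⟩ := hR
  have hkl : k ≤ l := by
    by_contra hc
    exact hne (h l (by omega))
  refine ⟨k, fun i hi => ?_, ?_, ?_⟩
  · rw [ha i (by omega), hb i (by omega), h i hi]
  · rw [ha k (by omega), h0]
  · rw [hb k (by omega), h1]

/-! ### Comparison of words that differ inside both of them -/

/-- Any sequence that begins with `u` is smaller than any sequence that begins with `w`. -/
def WordLT (u w : List Bool) : Prop := ∀ z z' : ℕ → Bool, cat u z ≺ cat w z'

theorem WordLT.trans {u v w : List Bool} (h1 : WordLT u v) (h2 : WordLT v w) : WordLT u w :=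
  fun z z' => (h1 z z).trans (h2 z z')

theorem WordLT.append {u w : List Bool} (h : WordLT u w) (x y : List Bool) :
    WordLT (u ++ x) (w ++ y) := fun z z' => by
  rw [cat_append, cat_append]; exact h _ _

theorem WordLT.append_left {u w : List Bool} (h : WordLT u w) (x : List Bool) :
    WordLT (u ++ x) w := by simpa using h.append x []

theorem WordLT.append_right {u w : List Bool} (h : WordLT u w) (x : List Bool) :
    WordLT u (w ++ x) := by simpa using h.append [] x

theorem WordLT.cons {u w : List Bool} (x : List Bool) (h : WordLT u w) :
    WordLT (x ++ u) (x ++ w) := fun z z' => by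
  rw [cat_append, cat_append, cat_lt_cat]; exact h _ _

theorem WordLT.of_cons {x u w : List Bool} (h : WordLT (x ++ u) (x ++ w)) : WordLT u w :=
  fun z z' => by
    have := h z z'
    rwa [cat_append, cat_append, cat_lt_cat] at this

theorem wordLT_false_true : WordLT [false] [true] := fun z z' => by
  rw [slt_iff]
  exact ⟨0, by simp, cat_cons_zero _ _ _, cat_cons_zero _ _ _⟩

theorem wordLT_snoc (x : List Bool) : WordLT (x ++ [false]) (x ++ [true]) :=
  WordLT.cons x wordLT_false_true

theorem not_wordLT_nil_left {w : List Bool} : ¬ WordLT [] w := fun h =>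
  not_ones_lt (by simpa using h (fun _ => true) zeroSeq)

theorem not_wordLT_nil_right {w : List Bool} : ¬ WordLT w [] := fun h =>
  not_lt_zeroSeq (by simpa using h zeroSeq zeroSeq)

theorem not_wordLT_self {w : List Bool} : ¬ WordLT w w := fun h => lt_irrefl _ (h zeroSeq zeroSeq)

theorem not_wordLT_cons_true_false {u w : List Bool} : ¬ WordLT (true :: u) (false :: w) := fun h =>
  absurd (h zeroSeq zeroSeq) (not_slt.2 (le_of_lt (slt_iff.2
    ⟨0, by simp, cat_cons_zero _ _ _, cat_cons_zero _ _ _⟩)))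

theorem word_trichotomy : ∀ {u w : List Bool}, u.length = w.length →
    WordLT u w ∨ u = w ∨ WordLT w u
  | [], [], _ => Or.inr (Or.inl rfl)
  | c :: u, d :: w, h => by
    have hcd : WordLT [false] [true] := wordLT_false_true
    cases c <;> cases d
    · rcases word_trichotomy (u := u) (w := w) (by simpa using h) with h | h | h
      · exact Or.inl (h.cons [false])
      · exact Or.inr (Or.inl (by rw [h]))
      · exact Or.inr (Or.inr (h.cons [false]))
    · exact Or.inl (hcd.append u w)
    · exact Or.inr (Or.inr (hcd.append w u))
    · rcases word_trichotomy (u := u) (w := w) (by simpa using h) with h | h | h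
      · exact Or.inl (h.cons [true])
      · exact Or.inr (Or.inl (by rw [h]))
      · exact Or.inr (Or.inr (h.cons [true]))

/-- Words of equal length: comparison of two extensions compares the words. -/
theorem eq_or_wordLT {u w : List Bool} (h : u.length = w.length) {z z' : ℕ → Bool}
    (hle : cat u z ≼ cat w z') : u = w ∨ WordLT u w := by
  rcases word_trichotomy h with h | h | h
  · exact Or.inr h
  · exact Or.inl h
  · exact absurd (h z' z) (not_lt.2 hle)

/-! ### Infinite concatenations -/

/-- The infinite concatenation of the words `f 0, f 1, …`. -/
def flat (f : ℕ → List Bool) (i : ℕ) : Bool := ((List.range (i + 1)).flatMap f).getD i false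

theorem flatMap_range_succ (f : ℕ → List Bool) (n : ℕ) :
    (List.range (n + 1)).flatMap f = f 0 ++ (List.range n).flatMap (fun k => f (k + 1)) := by
  rw [List.range_succ_eq_map, List.flatMap_cons, List.flatMap_map]

theorem flatMap_range_succ_right (f : ℕ → List Bool) (n : ℕ) :
    (List.range (n + 1)).flatMap f = (List.range n).flatMap f ++ f n := by
  rw [List.range_succ, List.flatMap_append]
  simp

theorem le_length_flatMap {f : ℕ → List Bool} (hf : ∀ k, f k ≠ []) (n : ℕ) :
    n ≤ ((List.range n).flatMap f).length := by
  induction n with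
  | zero => simp
  | succ n ih =>
    rw [flatMap_range_succ_right, List.length_append]
    have := List.length_pos_iff.2 (hf n)
    omega

theorem flat_stable {f : ℕ → List Bool} (hf : ∀ k, f k ≠ []) {i n : ℕ} (h : i < n) :
    ((List.range n).flatMap f).getD i false = flat f i := by
  obtain ⟨l, rfl⟩ := Nat.exists_eq_add_of_le (Nat.succ_le_of_lt h)
  unfold flat
  clear h
  induction l with
  | zero => rfl
  | succ l ih =>
    rw [← ih, ← add_assoc, flatMap_range_succ_right]
    apply List.getD_append
    have := le_length_flatMap hf (i.succ + l)
    omega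

theorem flat_eq {f : ℕ → List Bool} (hf : ∀ k, f k ≠ []) :
    flat f = cat (f 0) (flat fun k => f (k + 1)) := by
  funext i
  have h0 := List.length_pos_iff.2 (hf 0)
  rw [flat, flatMap_range_succ]
  by_cases h : i < (f 0).length
  · rw [cat_apply_lt h, List.getD_append _ _ _ _ h]
  · obtain ⟨l, rfl⟩ := Nat.exists_eq_add_of_le (not_lt.1 h)
    rw [cat_apply_add, List.getD_append_right _ _ _ _ (by omega),
      flat_stable (fun k => hf (k + 1)) (by omega)]
    congr 1; omega

theorem flat_eq_cat {f : ℕ → List Bool} (hf : ∀ k, f k ≠ []) (n : ℕ) :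
    flat f = cat ((List.range n).flatMap f) (flat fun k => f (k + n)) := by
  induction n with
  | zero => simp
  | succ n ih =>
    rw [flatMap_range_succ_right, cat_append, ih, flat_eq (fun k => hf (k + n))]
    simp only [zero_add, add_right_comm, add_assoc]

theorem eq_flat {f : ℕ → List Bool} (hf : ∀ k, f k ≠ []) {y : ℕ → ℕ → Bool}
    (hy : ∀ k, y k = cat (f k) (y (k + 1))) : y 0 = flat f := by
  have h : ∀ n, y 0 = cat ((List.range n).flatMap f) (y n) := by
    intro n
    induction n with
    | zero => simp
    | succ n ih => rw [flatMap_range_succ_right, cat_append, ih, hy n]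
  funext i
  have hl := le_length_flatMap hf (i + 1)
  rw [h (i + 1), cat_apply_lt (by omega), flat_stable hf (by omega)]

/-- Peeling off blocks one at a time gives the bound for every finite product followed by `p`. A
violation for the infinite product would show within finitely many digits, hence already for a
finite product. -/
theorem flat_le {f : ℕ → List Bool} (hf : ∀ k, f k ≠ []) {p : ℕ → Bool}
    (h : ∀ k, cat (f k) p ≼ p) : flat f ≼ p := by
  have hn : ∀ n, cat ((List.range n).flatMap f) p ≼ p := by
    intro n
    induction n with
    | zero => simp
    | succ n ih =>
      rw [flatMap_range_succ_right, cat_append]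
      exact le_trans ((cat_le_cat _).2 (h n)) ih
  rw [← not_slt]
  intro hlt
  obtain ⟨k, hag, h0, h1⟩ := slt_iff.1 hlt
  have hl := le_length_flatMap hf (k + 1)
  apply not_slt.2 (hn (k + 1))
  apply slt_of_agree (R := k + 1) hlt ⟨k, by omega, by simp [h0, h1]⟩ (fun _ _ => rfl)
  intro i hi
  rw [cat_apply_lt (by omega), flat_eq_cat hf (k + 1), cat_apply_lt (by omega)]

theorem le_flat {f : ℕ → List Bool} (hf : ∀ k, f k ≠ []) {p : ℕ → Bool}
    (h : ∀ k, p ≼ cat (f k) p) : p ≼ flat f := by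
  have hn : ∀ n, p ≼ cat ((List.range n).flatMap f) p := by
    intro n
    induction n with
    | zero => simp
    | succ n ih =>
      rw [flatMap_range_succ_right, cat_append]
      exact le_trans ih ((cat_le_cat _).2 (h n))
  rw [← not_slt]
  intro hlt
  obtain ⟨k, hag, h0, h1⟩ := slt_iff.1 hlt
  have hl := le_length_flatMap hf (k + 1)
  apply not_slt.2 (hn (k + 1))
  apply slt_of_agree (R := k + 1) hlt ⟨k, by omega, by simp [h0, h1]⟩ _ (fun _ _ => rfl)
  intro i hi
  rw [cat_apply_lt (by omega), flat_eq_cat hf (k + 1), cat_apply_lt (by omega)]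

theorem per_eq_flat {w : List Bool} (hw : w ≠ []) : per w = flat fun _ => w :=
  eq_flat (y := fun _ => per w) (fun _ => hw) (fun _ => per_eq hw)

theorem per_le {w : List Bool} (hw : w ≠ []) {p : ℕ → Bool} (h : cat w p ≼ p) : per w ≼ p := by
  rw [per_eq_flat hw]; exact flat_le (fun _ => hw) (fun _ => h)

theorem le_per {w : List Bool} (hw : w ≠ []) {p : ℕ → Bool} (h : p ≼ cat w p) : p ≼ per w := by
  rw [per_eq_flat hw]; exact le_flat (fun _ => hw) (fun _ => h)

theorem eq_per {w : List Bool} (hw : w ≠ []) {p : ℕ → Bool} (h : p = cat w p) : p = per w :=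
  sle_antisymm (le_per hw (sle_of_eq h)) (per_le hw (sle_of_eq h.symm))

theorem shift_flat {f : ℕ → List Bool} (hf : ∀ k, f k ≠ []) (i : ℕ) :
    ∃ k l, l < (f k).length ∧ shift i (flat f) = cat ((f k).drop l) (flat fun e => f (e + (k + 1))) := by
  induction i using Nat.strong_induction_on generalizing f with
  | _ i ih =>
    by_cases h : i < (f 0).length
    · refine ⟨0, i, h, ?_⟩
      rw [flat_eq hf, shift_cat h.le]
    · have h0 := List.length_pos_iff.2 (hf 0)
      obtain ⟨l, rfl⟩ := Nat.exists_eq_add_of_le (not_lt.1 h)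
      obtain ⟨k, e, he, hs⟩ := ih l (by omega) (f := fun k => f (k + 1)) (fun k => hf _)
      refine ⟨k + 1, e, he, ?_⟩
      rw [flat_eq hf, shift_cat_add, hs]
      simp only [add_assoc]

end

section

/-! ### Lyndon words -/

/-- `w` is smaller than each of its proper suffixes, with the first difference inside the suffix. -/
def StrongLyndon (w : List Bool) : Prop :=
  ∀ x y : List Bool, w = x ++ y → x ≠ [] → y ≠ [] → WordLT w y

theorem strongLyndon_singleton (c : Bool) : StrongLyndon [c] := by
  intro x y h hx hy
  have := congrArg List.length h
  have h1 := List.length_pos_iff.2 hx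
  have h2 := List.length_pos_iff.2 hy
  simp at this
  omega

/-- A proper suffix of `uv` is `v`, a suffix of `v` (above `v`, which is above `uv`), or `cv` with
`c` a proper suffix of `u`, and `u < c` is decided inside both words. -/
theorem StrongLyndon.append {u v : List Bool} (hu : StrongLyndon u) (hv : StrongLyndon v)
    (h : WordLT (u ++ v) v) : StrongLyndon (u ++ v) := by
  intro x y hxy hx hy
  rcases List.append_eq_append_iff.1 hxy with ⟨a, rfl, hv'⟩ | ⟨c, hu', rfl⟩
  · by_cases ha : a = []
    · subst ha
      simp only [List.nil_append] at hv'
      exact hv' ▸ h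
    · exact h.trans (hv a y hv' ha hy)
  · by_cases hc : c = []
    · simpa [hc] using h
    · exact (hu x c hu' hx hc).append v v

theorem StrongLyndon.exists_eq {w : List Bool} (h : StrongLyndon w) (h2 : 2 ≤ w.length) :
    ∃ x, w = false :: (x ++ [true]) := by
  obtain ⟨y, c, rfl⟩ := List.eq_nil_or_concat'  w |>.resolve_left (by rintro rfl; simp at h2)
  cases y with
  | nil => simp at h2
  | cons d y =>
    have := h (d :: y) [c] rfl (by simp) (by simp)
    have hd : d = false := by
      cases d
      · rfl
      · exfalso
        cases c
        · exact not_wordLT_cons_true_false this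
        · have := WordLT.of_cons (x := [true]) (w := []) this
          exact not_wordLT_nil_right this
    have hc : c = true := by
      cases c
      · exfalso
        subst hd
        have := WordLT.of_cons (x := [false]) (w := []) this
        exact not_wordLT_nil_right this
      · rfl
    exact ⟨y, by simp [hd, hc]⟩

/-! ### The order of words of equal length -/

theorem WordLT.lt {u w : List Bool} : u.length = w.length → WordLT u w → u < w := by
  induction u generalizing w with
  | nil => intro _ h; exact absurd h not_wordLT_nil_left
  | cons c u ih =>
    intro hl h
    cases w with
    | nil => simp at hl
    | cons d w =>
      rw [List.cons_lt_cons_iff]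
      by_cases hcd : c = d
      · subst hcd
        exact Or.inr ⟨rfl, ih (by simpa using hl) (WordLT.of_cons (x := [c]) h)⟩
      · left
        cases c <;> cases d
        · simp at hcd
        · simp
        · exact absurd h not_wordLT_cons_true_false
        · simp at hcd

theorem eq_or_wordLT_of_le {u w : List Bool} (hl : u.length = w.length) (h : u ≤ w) :
    u = w ∨ WordLT u w := by
  rcases word_trichotomy hl with h' | h' | h'
  · exact Or.inr h'
  · exact Or.inl h'
  · exact absurd (h'.lt hl.symm) (not_lt.2 h)

/-- A proper power has a proper suffix that is also a prefix, so no difference occurs inside the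
suffix. A rotation begins with a proper suffix, and that suffix already decides the comparison. -/
theorem StrongLyndon.isLyndon {w : List Bool} (h : StrongLyndon w) (hw : w ≠ []) : IsLyndon w := by
  refine ⟨?_, ?_⟩
  · intro u k hk huk
    obtain ⟨k, rfl⟩ := Nat.exists_eq_add_of_le hk
    have hu : u ≠ [] := by
      rintro rfl
      apply hw
      rw [huk]
      simp
    have e1 : w = u ++ (List.replicate (k + 1) u).flatten := by
      rw [huk, show 2 + k = (k + 1) + 1 by omega, List.replicate_succ, List.flatten_cons]
    have hlt := h _ _ e1 hu (by simp [List.replicate_succ, hu])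
    have e2 : w = (List.replicate (k + 1) u).flatten ++ u := by
      rw [huk, show 2 + k = (k + 1) + 1 by omega, List.replicate_succ' (n := k + 1),
        List.flatten_append]
      simp
    rw [e2] at hlt
    have := WordLT.of_cons (x := (List.replicate (k + 1) u).flatten) (w := []) (by simpa using hlt)
    exact not_wordLT_nil_right this
  · intro i
    rcases lt_or_ge 0 (i % w.length) with h0 | h0
    · have hlt : i % w.length < w.length := Nat.mod_lt _ (List.length_pos_iff.2 hw)
      rw [← List.rotate_mod, List.rotate_eq_drop_append_take hlt.le]
      apply le_of_lt
      apply WordLT.lt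
      · simp; omega
      · apply WordLT.append_right
        apply h _ _ (List.take_append_drop _ _).symm
        · simp [hw]; omega
        · simp; omega
    · rw [← List.rotate_mod, Nat.le_zero.1 h0, List.rotate_zero]

theorem IsLyndon.ne_nil {w : List Bool} (h : IsLyndon w) : w ≠ [] := by
  rintro rfl
  exact h.1 [] 2 le_rfl (by simp)

theorem per_append_comm (x y : List Bool) (h : x ++ y ≠ []) :
    per (x ++ y) = cat x (per (y ++ x)) := by
  have h' : y ++ x ≠ [] := by
    intro hc; apply h; simp only [List.append_eq_nil_iff] at hc ⊢; exact hc.symm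
  symm
  apply eq_per h
  conv_lhs => rw [per_eq h', cat_append]
  rw [cat_append]

theorem shift_per_append (x y : List Bool) (h : x ++ y ≠ []) :
    shift x.length (per (x ++ y)) = per (y ++ x) := by
  rw [per_append_comm x y h, shift_cat_length]

theorem per_le_per_of_wordLT {u w : List Bool} (hu : u ≠ []) (hw : w ≠ []) (h : WordLT u w) :
    per u ≺ per w := by
  rw [per_eq hu, per_eq hw]; exact h _ _

theorem shift_per_eq {w : List Bool} (hw : w ≠ []) {i : ℕ} (hi : i < w.length) :
    shift i (per w) = per (w.drop i ++ w.take i) := by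
  have := shift_per_append (w.take i) (w.drop i) (by simpa using hw)
  rwa [List.take_append_drop, List.length_take, min_eq_left hi.le] at this

theorem IsLyndon.per_le_shift {w : List Bool} (h : IsLyndon w) (i : ℕ) :
    per w ≼ shift i (per w) := by
  have hw := h.ne_nil
  rw [shift_per_mod]
  have hi := Nat.mod_lt i (List.length_pos_iff.2 hw)
  rw [shift_per_eq hw hi]
  have h2 := h.2 (i % w.length)
  rw [List.rotate_eq_drop_append_take hi.le] at h2
  rcases eq_or_wordLT_of_le (by simp; omega) h2 with h3 | h3
  · rw [← h3]
  · refine (per_le_per_of_wordLT hw ?_ h3).le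
    intro hc
    rw [hc] at h3
    exact not_wordLT_nil_right h3

theorem StrongLyndon.per_lt_cat {w x y : List Bool} (h : StrongLyndon w) (hxy : w = x ++ y)
    (hx : x ≠ []) (hy : y ≠ []) (z : ℕ → Bool) : per w ≺ cat y z := by
  rw [per_eq (w := w) (by rw [hxy]; simp [hx])]
  exact h x y hxy hx hy _ _

/-- The Lyndon prefix with raised last digit. -/
theorem StrongLyndon.raise {p q : List Bool} (h : StrongLyndon (p ++ false :: q)) : StrongLyndon (p ++ [true]) := by
  intro x y hxy hx hy
  obtain ⟨y', c, rfl⟩ := (List.eq_nil_or_concat' y).resolve_left hy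
  rw [← List.append_assoc] at hxy
  obtain ⟨rfl, hc⟩ := List.append_inj' hxy rfl
  simp only [List.cons.injEq, and_true] at hc
  subst hc
  have h1 := h x (y' ++ false :: q) (by simp) hx (by simp)
  have h2 : (x ++ y' ++ [true]).length ≥ (y' ++ [true]).length := by simp
  have hl : ((x ++ y').take (y' ++ [false]).length).length = (y' ++ [false]).length := by
    have := List.length_pos_iff.2 hx
    simp; omega
  have h3 := h1 zeroSeq zeroSeq
  have e1 : cat (x ++ y' ++ false :: q) zeroSeq =
      cat ((x ++ y').take (y' ++ [false]).length)
        (cat ((x ++ y').drop (y' ++ [false]).length) (cat (false :: q) zeroSeq)) := by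
    rw [← cat_append, ← cat_append, List.take_append_drop]
  have e2 : cat (y' ++ false :: q) zeroSeq = cat (y' ++ [false]) (cat q zeroSeq) := by
    rw [← cat_append]; simp
  rw [e1, e2] at h3
  -- The original word lies below its suffix at `x`, so its prefix of length `|y'| + 1` is at most
  -- `y'0`, and thus below the raised suffix `y'1`.
  have h4 : WordLT ((x ++ y').take (y' ++ [false]).length) (y' ++ [true]) := by
    rcases eq_or_wordLT hl h3.le with h | h
    · rw [h]; exact wordLT_snoc y'
    · exact h.trans (wordLT_snoc y')
  have := h4.append_left ((x ++ y').drop (y' ++ [false]).length ++ [true])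
  rwa [← List.append_assoc, List.take_append_drop] at this

/-! ### The largest cyclic permutation -/

theorem foldr_max_mem (l : List (List Bool)) (w : List Bool) :
    l.foldr max w = w ∨ l.foldr max w ∈ l := by
  induction l with
  | nil => simp
  | cons u l ih =>
    rw [List.foldr_cons]
    rcases max_choice u (l.foldr max w) with h | h
    · right; rw [h]; simp
    · rw [h]
      rcases ih with h' | h'
      · exact Or.inl h'
      · exact Or.inr (List.mem_cons_of_mem _ h')

theorem le_foldr_max {l : List (List Bool)} {w u : List Bool} (h : u ∈ l) :
    u ≤ l.foldr max w := by
  induction l with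
  | nil => simp at h
  | cons v l ih =>
    rw [List.foldr_cons]
    rcases List.mem_cons.1 h with rfl | h
    · exact le_max_left _ _
    · exact (ih h).trans (le_max_right _ _)

theorem maxRot_eq (w : List Bool) : ∃ x y, w = x ++ y ∧ maxRot w = y ++ x := by
  rcases foldr_max_mem ((List.range w.length).map fun i => w.rotate i) w with h | h
  · exact ⟨[], w, rfl, by simpa [maxRot] using h⟩
  · obtain ⟨i, hi, hw⟩ := List.mem_map.1 h
    refine ⟨w.take i, w.drop i, (List.take_append_drop _ _).symm, ?_⟩
    rw [← List.rotate_eq_drop_append_take (List.mem_range.1 hi).le, hw, maxRot]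

@[simp] theorem length_maxRot (w : List Bool) : (maxRot w).length = w.length := by
  obtain ⟨x, y, h, h'⟩ := maxRot_eq w
  rw [h', h]; simp [add_comm]

theorem rot_le_maxRot (x y : List Bool) :
    y ++ x = maxRot (x ++ y) ∨ WordLT (y ++ x) (maxRot (x ++ y)) := by
  apply eq_or_wordLT_of_le
  · simp [add_comm]
  · by_cases hy : y = []
    · subst hy
      by_cases hx : x = []
      · subst hx; simp [maxRot]
      · apply le_foldr_max
        refine List.mem_map.2 ⟨0, ?_, ?_⟩
        · simpa using List.length_pos_iff.2 hx
        · simp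
    · apply le_foldr_max
      refine List.mem_map.2 ⟨x.length, ?_, ?_⟩
      · simpa using List.length_pos_iff.2 hy
      · simp [List.rotate_eq_drop_append_take]

theorem shift_per_le_maxRot {w : List Bool} (hw : w ≠ []) (i : ℕ) :
    shift i (per w) ≼ per (maxRot w) := by
  rw [shift_per_mod]
  have hi := Nat.mod_lt i (List.length_pos_iff.2 hw)
  rw [shift_per_eq hw hi]
  have hne : maxRot w ≠ [] := by
    intro h; apply hw
    rw [← List.length_eq_zero_iff] at h ⊢
    simpa using h
  have h1 := rot_le_maxRot (w.take (i % w.length)) (w.drop (i % w.length))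
  rw [List.take_append_drop] at h1
  rcases h1 with h1 | h1
  · rw [h1]
  · refine (per_le_per_of_wordLT ?_ hne h1).le
    intro hc
    rw [hc] at h1
    exact not_wordLT_nil_left h1

theorem exists_shift_eq_per_maxRot {w : List Bool} (hw : w ≠ []) :
    ∃ i, per (maxRot w) = shift i (per w) := by
  obtain ⟨x, y, h, h'⟩ := maxRot_eq w
  refine ⟨x.length, ?_⟩
  rw [h', h, shift_per_append x y (h ▸ hw)]

/-- Every cyclic permutation of the largest cyclic permutation of a Lyndon word `w` is at least
`w`. -/
theorem StrongLyndon.le_rot {w x y : List Bool} (h : StrongLyndon w) (hxy : maxRot w = x ++ y) :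
    w = y ++ x ∨ WordLT w (y ++ x) := by
  obtain ⟨p, q, hw, hm⟩ := maxRot_eq w
  rw [hm] at hxy
  have key : ∀ a b, w = a ++ b → w = b ++ a ∨ WordLT w (b ++ a) := by
    intro a b hab
    by_cases ha : a = []
    · left; rw [hab, ha]; simp
    by_cases hb : b = []
    · left; rw [hab, hb]; simp
    exact Or.inr ((h a b hab ha hb).append_right a)
  rcases List.append_eq_append_iff.1 hxy with ⟨a, rfl, rfl⟩ | ⟨c, rfl, rfl⟩
  · have := key a (y ++ q) (by rw [hw, List.append_assoc])
    simpa using this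
  · have := key (p ++ x) c (by rw [hw, List.append_assoc])
    simpa using this

/-- Some rotation starts with `1`, so the largest one does. If it ended in `1`, moving this digit to
the front would give `1L^∞ ≼ L^∞` for `L = 𝕃(w)`, hence `L^∞ = 1^∞`, although `w` contains a `0`. -/
theorem maxRot_snoc {w : List Bool} (h : StrongLyndon w) (h2 : 2 ≤ w.length) :
    ∃ A, maxRot w = true :: (A ++ [false]) := by
  obtain ⟨x, hx⟩ := h.exists_eq h2
  have hne : maxRot w ≠ [] := by
    intro hc
    have := congrArg List.length hc
    simp at this
    simp [this] at h2
  have h1 := rot_le_maxRot (false :: x) [true]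
  rw [show (false :: x) ++ [true] = w by simp [hx]] at h1
  have ht : ∃ B, maxRot w = true :: B := by
    cases hB : maxRot w with
    | nil => exact absurd hB hne
    | cons c B =>
      cases c
      · exfalso
        rw [hB] at h1
        rcases h1 with h1 | h1
        · simp at h1
        · exact not_wordLT_cons_true_false h1
      · exact ⟨B, rfl⟩
  obtain ⟨B, hB⟩ := ht
  have hBl : B.length + 1 = w.length := by
    rw [← length_maxRot w, hB]; simp
  obtain ⟨A, c, hA⟩ := (List.eq_nil_or_concat' B).resolve_left (by
    rintro rfl; simp at hBl; omega)
  refine ⟨A, ?_⟩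
  rw [hB, hA]
  cases c
  · rfl
  · exfalso
    have e : maxRot w = (true :: A) ++ [true] := by rw [hB, hA]; simp
    have hpn : per (maxRot w) = cat (true :: A) (per ([true] ++ (true :: A))) := by
      rw [e]; exact per_append_comm _ _ (by simp)
    obtain ⟨i, hi⟩ := exists_shift_eq_per_maxRot (w := w) (by rintro rfl; simp at h2)
    have h3 : per ([true] ++ (true :: A)) ≼ per (maxRot w) := by
      have : per ([true] ++ (true :: A)) = shift (i + (true :: A).length) (per w) := by
        rw [← shift_shift, ← hi, hpn, shift_cat_length]
      rw [this]
      exact shift_per_le_maxRot (by rintro rfl; simp at h2) _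
    have h4 : per ([true] ++ (true :: A)) = cat [true] (per (maxRot w)) := by
      rw [e]; exact per_append_comm _ _ (by simp)
    rw [h4] at h3
    have h5 := per_le (w := [true]) (by simp) h3
    have h6 : ∀ k, per (maxRot w) k = true := by
      intro k
      by_contra hk
      have : (per [true]) = fun _ => true := by
        funext l; simp [per, Nat.mod_one]
      rw [this] at h5
      rcases lt_or_eq_of_le h5 with h7 | h7
      · exact not_ones_lt h7
      · have := toLex.injective h7
        rw [← this] at hk
        exact hk rfl
    have hsub := shift_per (w := w) (by rintro rfl; simp at h2)
    have hz : per w 0 = false := by rw [hx]; simp [per]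
    -- At this index the shifted sequence shows the first digit of `w` again, which is `0`.
    have := h6 (w.length * (i + 1) - i)
    rw [hi, shift_apply, per] at this
    have e2 : i + (w.length * (i + 1) - i) = w.length * (i + 1) := by
      have : i + 1 ≤ w.length * (i + 1) := Nat.le_mul_of_pos_left _ (by omega)
      omega
    rw [e2, Nat.mul_mod_right] at this
    rw [per, Nat.zero_mod] at hz
    rw [hz] at this
    cases this

/-! ### Farey words and substitutions -/

/-- The relation `uv < v` between neighbours makes `uv` Lyndon and passes to the new neighbours `u,
uv` and `uv, v`. The statement on the heads is needed to join the chain of the remaining list. -/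
theorem fareyInsert_lyndon (l : List (List Bool)) (h : ∀ w ∈ l, StrongLyndon w)
    (hc : l.IsChain fun u v => WordLT (u ++ v) v) :
    (∀ w ∈ fareyInsert l, StrongLyndon w) ∧
      (fareyInsert l).IsChain (fun u v => WordLT (u ++ v) v) ∧ (fareyInsert l).head? = l.head? := by
  induction l using fareyInsert.induct with
  | case1 u v l ih =>
    rw [List.isChain_cons_cons] at hc
    obtain ⟨h1, h2, h3⟩ := ih (fun w hw => h w (List.mem_cons_of_mem _ hw)) hc.2
    have hu := h u (by simp)
    have hv := h v (by simp)
    rw [fareyInsert]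
    refine ⟨?_, ?_, rfl⟩
    · intro w hw
      rcases List.mem_cons.1 hw with rfl | hw
      · exact hu
      rcases List.mem_cons.1 hw with rfl | hw
      · exact hu.append hv hc.1
      · exact h1 w hw
    · rw [List.isChain_cons_cons]
      refine ⟨hc.1.cons u, ?_⟩
      rw [List.isChain_cons]
      refine ⟨?_, h2⟩
      intro y hy
      rw [h3] at hy
      simp at hy
      subst hy
      have := hc.1.append_left v
      rwa [List.append_assoc] at this ⊢
  | case2 l hl =>
    have : fareyInsert l = l := by
      unfold fareyInsert
      split
      · exact absurd rfl (hl _ _ _)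
      · rfl
    rw [this]
    exact ⟨h, hc, rfl⟩

theorem IsFarey.strongLyndon {w : List Bool} (h : IsFarey w) : StrongLyndon w := by
  obtain ⟨⟨n, hn⟩, -⟩ := h
  have : ∀ n, (∀ w ∈ fareyList n, StrongLyndon w) ∧
      (fareyList n).IsChain (fun u v => WordLT (u ++ v) v) := by
    intro n
    induction n with
    | zero =>
      refine ⟨?_, ?_⟩
      · intro w hw
        simp only [fareyList, List.mem_cons, List.not_mem_nil, or_false] at hw
        rcases hw with rfl | rfl <;> exact strongLyndon_singleton _
      · simpa [fareyList] using wordLT_false_true.append_left [true]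
    | succ n ih =>
      obtain ⟨h1, h2, -⟩ := fareyInsert_lyndon _ ih.1 ih.2
      exact ⟨h1, h2⟩
  exact (this n).1 w hn

end

/-! ### Substitution by a Lyndon word preserves the Lyndon property -/

section

theorem minus_snoc (x : List Bool) (c : Bool) : minus (x ++ [c]) = x ++ [false] := by
  simp [minus]

theorem plus_snoc (x : List Bool) (c : Bool) : plus (x ++ [c]) = x ++ [true] := by
  simp [plus]

/-- No word of this length lies strictly between `q0` and `q1`. This turns upper bounds by unlowered
words into upper bounds by lowered ones. -/
theorem eq_or_wordLT_of_snoc {u q : List Bool} (hl : u.length = q.length + 1)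
    (h : WordLT u (q ++ [true])) : u = q ++ [false] ∨ WordLT u (q ++ [false]) := by
  obtain ⟨u', c, rfl⟩ := (List.eq_nil_or_concat' u).resolve_left (by rintro rfl; simp at hl)
  have hl' : u'.length = q.length := by simpa using hl
  rcases word_trichotomy hl' with h1 | h1 | h1
  · exact Or.inr (h1.append _ _)
  · subst h1
    cases c
    · exact Or.inl rfl
    · exact absurd h not_wordLT_self
  · exact absurd (h.trans (h1.append [true] [c])) not_wordLT_self

theorem WordLT.of_append_left {u t w : List Bool} (hl : u.length = w.length)
    (h : WordLT (u ++ t) w) : WordLT u w := by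
  rcases word_trichotomy hl with h1 | h1 | h1
  · exact h1
  · subst h1
    exact absurd (WordLT.of_cons (w := []) (by simpa using h)) not_wordLT_nil_right
  · exact absurd (h.trans (h1.append_right t)) not_wordLT_self

/-- Locates the block in which a suffix of the image begins; `p'` is the digit before that block,
which determines its form. -/
theorem substFrom_split {s : List Bool} {p : Bool} {r x y : List Bool}
    (h : substFrom s p r = x ++ y) (hy : y ≠ []) :
    ∃ r₁ c r₂ b₁ b₂ p', r = r₁ ++ c :: r₂ ∧ substBlock s p' c = b₁ ++ b₂ ∧ b₂ ≠ [] ∧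
      x = substFrom s p r₁ ++ b₁ ∧ y = b₂ ++ substFrom s c r₂ ∧
      ((r₁ = [] ∧ p' = p) ∨ ∃ r₁', r₁ = r₁' ++ [p']) := by
  induction r generalizing p x with
  | nil =>
    exfalso
    simp only [substFrom] at h
    have := congrArg List.length h
    have h2 := List.length_pos_iff.2 hy
    simp at this; omega
  | cons c r ih =>
    rw [substFrom] at h
    have base : ∀ b₁ b₂, b₂ ≠ [] → substBlock s p c = b₁ ++ b₂ → x = b₁ →
        y = b₂ ++ substFrom s c r → ∃ r₁ d r₂ b₁ b₂ p', c :: r = r₁ ++ d :: r₂ ∧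
        substBlock s p' d = b₁ ++ b₂ ∧ b₂ ≠ [] ∧ x = substFrom s p r₁ ++ b₁ ∧
        y = b₂ ++ substFrom s d r₂ ∧ ((r₁ = [] ∧ p' = p) ∨ ∃ r₁', r₁ = r₁' ++ [p']) := by
      intro b₁ b₂ hb h1 h2 h3
      exact ⟨[], c, r, b₁, b₂, p, rfl, h1, hb, by simpa [substFrom] using h2, h3, Or.inl ⟨rfl, rfl⟩⟩
    have step : ∀ a, x = substBlock s p c ++ a → substFrom s c r = a ++ y →
        ∃ r₁ d r₂ b₁ b₂ p', c :: r = r₁ ++ d :: r₂ ∧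
        substBlock s p' d = b₁ ++ b₂ ∧ b₂ ≠ [] ∧ x = substFrom s p r₁ ++ b₁ ∧
        y = b₂ ++ substFrom s d r₂ ∧ ((r₁ = [] ∧ p' = p) ∨ ∃ r₁', r₁ = r₁' ++ [p']) := by
      intro a hx ha
      obtain ⟨r₁, d, r₂, b₁, b₂, p', h1, h2, h3, h4, h5, h6⟩ := ih ha
      refine ⟨c :: r₁, d, r₂, b₁, b₂, p', by rw [h1]; rfl, h2, h3, ?_, h5, Or.inr ?_⟩
      · rw [hx, h4, substFrom, List.append_assoc]
      · rcases h6 with ⟨h6, h7⟩ | ⟨r', h6⟩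
        · exact ⟨[], by rw [h6, h7]; rfl⟩
        · exact ⟨c :: r', by rw [h6]; rfl⟩
    rcases List.append_eq_append_iff.1 h with ⟨a, hx, ha⟩ | ⟨b₂, hx, hb⟩
    · exact step a hx ha
    · by_cases hb2 : b₂ = []
      · subst hb2
        exact step [] (by simpa using hx.symm) (by simpa using hb.symm)
      · exact base x b₂ hb2 hx rfl hb

section Substitution

variable {s : List Bool}

theorem StrongLyndon.exists_snoc (hs : StrongLyndon s) (h2 : 2 ≤ s.length) :
    ∃ t, s = t ++ [true] := by
  obtain ⟨x, hx⟩ := hs.exists_eq h2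
  exact ⟨false :: x, by simp [hx]⟩

theorem StrongLyndon.minus_lt (hs : StrongLyndon s) (h2 : 2 ≤ s.length) : WordLT (minus s) s := by
  obtain ⟨t, rfl⟩ := hs.exists_snoc h2
  rw [minus_snoc]
  exact wordLT_snoc t

theorem StrongLyndon.maxRot_lt_plus (hs : StrongLyndon s) (h2 : 2 ≤ s.length) :
    WordLT (maxRot s) (plus (maxRot s)) := by
  obtain ⟨A, hA⟩ := maxRot_snoc hs h2
  rw [hA, ← List.cons_append, plus_snoc]
  exact wordLT_snoc _

theorem StrongLyndon.lt_maxRot (hs : StrongLyndon s) (h2 : 2 ≤ s.length) :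
    WordLT s (maxRot s) := by
  obtain ⟨A, hA⟩ := maxRot_snoc hs h2
  obtain ⟨x, hx⟩ := hs.exists_eq h2
  rw [hA, hx]
  exact wordLT_false_true.append _ _

/-- After a common prefix the preceding digits coincide, and at the first difference the two blocks
are `s⁻ < s` or `𝕃(s) < 𝕃(s)⁺`. -/
theorem substFrom_lt (hs : StrongLyndon s) (h2 : 2 ≤ s.length) {r r' : List Bool} (p : Bool)
    (h : WordLT r r') : WordLT (substFrom s p r) (substFrom s p r') := by
  induction r generalizing p r' with
  | nil => exact absurd h not_wordLT_nil_left
  | cons c r ih =>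
    cases r' with
    | nil => exact absurd h not_wordLT_nil_right
    | cons d r' =>
      rw [substFrom, substFrom]
      by_cases hcd : c = d
      · subst hcd
        exact WordLT.cons _ (ih c (WordLT.of_cons (x := [c]) h))
      · cases c <;> cases d
        · simp at hcd
        · cases p
          · exact (hs.maxRot_lt_plus h2).append _ _
          · exact (hs.minus_lt h2).append _ _
        · exact absurd h not_wordLT_cons_true_false
        · simp at hcd

theorem length_substBlock (h2 : 2 ≤ s.length) (p c : Bool) :
    (substBlock s p c).length = s.length := by
  cases p <;> cases c <;> simp [substBlock, minus, plus] <;> omega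

theorem le_length_substFrom (h2 : 2 ≤ s.length) (p : Bool) (r : List Bool) :
    r.length ≤ (substFrom s p r).length := by
  induction r generalizing p with
  | nil => simp
  | cons c r ih =>
    rw [substFrom, List.length_append, length_substBlock h2]
    have := ih c
    simp; omega

/-- The image begins with `s⁻`. A suffix that starts at a block boundary after a digit `1` is the
image of a proper suffix of `r`, with the same convention on the preceding digit, and monotonicity
applies. Every other suffix already exceeds `s⁻`, because the rotations of `s` are at least `s`. -/
theorem StrongLyndon.subst (hs : StrongLyndon s) (h2 : 2 ≤ s.length) {r : List Bool}
    (hr : StrongLyndon r) (hr2 : 2 ≤ r.length) : StrongLyndon (subst s r) := by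
  obtain ⟨r', hr'⟩ := hr.exists_eq hr2
  have hW : BetaBifurcation.subst s r = substFrom s true r := by rw [hr']; rfl
  have hW' : substFrom s true r = minus s ++ substFrom s false (r' ++ [true]) := by
    rw [hr']; rfl
  obtain ⟨s₀, hs₀⟩ := hs.exists_snoc h2
  obtain ⟨A₀, hA₀⟩ : ∃ A₀, maxRot s = A₀ ++ [false] := by
    obtain ⟨A, hA⟩ := maxRot_snoc hs h2
    exact ⟨true :: A, by rw [hA]; rfl⟩
  have hms := hs.minus_lt h2
  intro x y hxy hx hy
  rw [hW] at hxy ⊢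
  obtain ⟨r₁, c, r₂, b₁, b₂, p', e1, e2, hb2, e4, e5, e6⟩ := substFrom_split hxy hy
  suffices hsuf : (b₁ = [] ∧ p' = true) ∨ WordLT (minus s) y by
    rcases hsuf with ⟨hb1, rfl⟩ | hsuf
    · have hr1 : r₁ ≠ [] := by
        rintro rfl
        apply hx
        rw [e4, hb1]; rfl
      have := substFrom_lt hs h2 true (hr _ _ e1 hr1 (by simp))
      rw [substFrom, e2, hb1, List.nil_append, ← e5] at this
      exact this
    · rw [hW']
      exact hsuf.append_left _
  by_cases hb1 : b₁ = []
  · cases p'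
    · right
      have : y = substBlock s false c ++ substFrom s c r₂ := by rw [e2, hb1, e5]; rfl
      rw [this]
      apply WordLT.append_right
      cases c
      · exact hms.trans (hs.lt_maxRot h2)
      · exact hms.trans ((hs.lt_maxRot h2).trans (hs.maxRot_lt_plus h2))
    · exact Or.inl ⟨hb1, rfl⟩
  right
  -- Since `r` ends in `1`, a block of a digit `0` is followed by another block, which is `𝕃(s)` or
  -- `𝕃(s)⁺`; these differ only in the last digit.
  have next : c = false → ∃ (d : Bool) (z : List Bool), y = b₂ ++ (A₀ ++ [d]) ++ z := by
    rintro rfl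
    cases r₂ with
    | nil =>
      exfalso
      rw [hr', ← List.cons_append] at e1
      have := (List.append_inj' e1 rfl).2
      simp at this
    | cons d r₂ =>
      refine ⟨d, substFrom s d r₂, ?_⟩
      rw [e5, substFrom]
      cases d <;> simp [substBlock, hA₀, plus]
  obtain ⟨b, e, rfl⟩ := (List.eq_nil_or_concat' b₂).resolve_left hb2
  cases p' <;> cases c
  · -- inside the block `maxRot s`
    obtain ⟨d, z, hyz⟩ := next rfl
    change maxRot s = _ at e2
    rw [hA₀, ← List.append_assoc] at e2
    obtain ⟨hAb, he⟩ := List.append_inj' e2 rfl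
    have h3 : minus s = minus s := rfl
    rw [hyz, hAb]
    have h4 := hs.le_rot (x := b₁) (y := b ++ [e]) (by rw [hA₀, e2]; simp)
    have h5 : WordLT (minus s) (b ++ [e] ++ b₁) := by
      rcases h4 with h4 | h4
      · rw [← h4]; exact hms
      · exact hms.trans h4
    have := h5.append_right (b ++ [d] ++ z)
    simpa using this
  · change plus (maxRot s) = _ at e2
    rw [hA₀, plus_snoc, ← List.append_assoc] at e2
    obtain ⟨hAb, he⟩ := List.append_inj' e2 rfl
    have he' : true = e := by simpa using he
    subst he'
    have h4 := hs.le_rot (x := b₁) (y := b ++ [false]) (by rw [hA₀, hAb]; simp)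
    have h5 : WordLT (minus s) (b ++ [false] ++ b₁) := by
      rcases h4 with h4 | h4
      · rw [← h4]; exact hms
      · exact hms.trans h4
    rw [e5]
    exact (h5.trans ((wordLT_snoc b).append_left b₁)).append_right _
  · -- inside the block `minus s`
    obtain ⟨d, z, hyz⟩ := next rfl
    change minus s = _ at e2
    rw [hs₀, minus_snoc, ← List.append_assoc] at e2
    obtain ⟨hsb, he⟩ := List.append_inj' e2 rfl
    have he' : false = e := by simpa using he
    subst he'
    have hs1 : s = b₁ ++ (b ++ [true]) := by rw [hs₀, hsb]; simp
    have h3 := hs _ _ hs1 hb1 (by simp)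
    have hlen : b.length + 1 < s.length := by
      have := congrArg List.length hs1
      have := List.length_pos_iff.2 hb1
      simp at *; omega
    obtain ⟨u, t, hut, hul⟩ : ∃ u t, s = u ++ t ∧ u.length = b.length + 1 :=
      ⟨s.take (b.length + 1), s.drop (b.length + 1), (List.take_append_drop _ _).symm, by
        simp; omega⟩
    obtain ⟨t₀, e, rfl⟩ := (List.eq_nil_or_concat' t).resolve_left (by
      rintro rfl
      rw [hut] at hlen; simp at hlen; omega)
    have hms' : minus s = u ++ (t₀ ++ [false]) := by
      rw [hut, ← List.append_assoc, minus_snoc, List.append_assoc]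
    have he : e = true := by
      rw [hs₀, ← List.append_assoc] at hut
      simpa using (List.append_inj' hut rfl).2.symm
    subst he
    rw [hyz, hms']
    rw [hut] at h3
    -- Either the lowered suffix of `s` is also a prefix `u` of `s`, and then the rest of `s⁻` has
    -- to be compared with the following `𝕃(s)` or `𝕃(s)⁺`, or it is already larger than `u`.
    rcases eq_or_wordLT_of_snoc hul (h3.of_append_left (by simpa using hul)) with h4 | h4
    · rw [h4, List.append_assoc (b ++ [false]) _ z]
      apply WordLT.cons
      apply WordLT.append_right
      have h5 : WordLT (t₀ ++ [false]) (maxRot s) := by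
        have h6 := rot_le_maxRot u (t₀ ++ [true])
        rw [← hut] at h6
        have h7 := (wordLT_snoc t₀).append_right u
        rcases h6 with h6 | h6
        · rw [← h6]; exact h7
        · exact h7.trans h6
      rw [hA₀] at h5
      cases d
      · exact h5
      · exact h5.trans (wordLT_snoc _)
    · rw [List.append_assoc]
      exact h4.append _ _
  · change s = _ at e2
    rw [e5]
    exact (hms.trans (hs _ _ e2 hb1 hb2)).append_right _

theorem IsLambda.strongLyndon {S : List Bool} (h : IsLambda S) :
    StrongLyndon S ∧ 2 ≤ S.length := by
  induction h with
  | farey h => exact ⟨h.strongLyndon, h.2⟩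
  | subst hs hr ih =>
    refine ⟨StrongLyndon.subst hs.strongLyndon hs.2 ih.1 ih.2, ?_⟩
    obtain ⟨ih1, ih2⟩ := ih
    obtain ⟨r', rfl⟩ := ih1.exists_eq ih2
    exact ih2.trans (le_length_substFrom hs.2 true (false :: (r' ++ [true])))

end Substitution

end

section

/-! ### Values of sequences -/

variable {β : ℝ}

theorem val_term_nonneg (hβ : 1 < β) (d : ℕ → Bool) (i : ℕ) :
    0 ≤ ((d i).toNat : ℝ) / β ^ (i + 1) := by positivity

theorem val_term_le (hβ : 1 < β) (d : ℕ → Bool) (i : ℕ) :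
    ((d i).toNat : ℝ) / β ^ (i + 1) ≤ β⁻¹ ^ (i + 1) := by
  rw [inv_pow, ← one_div]
  have : ((d i).toNat : ℝ) ≤ 1 := by cases d i <;> simp
  gcongr

theorem summable_inv_pow_succ (hβ : 1 < β) : Summable fun i : ℕ => β⁻¹ ^ (i + 1) :=
  (summable_nat_add_iff 1).2
    (summable_geometric_of_lt_one (by positivity) (inv_lt_one_of_one_lt₀ hβ))

theorem summable_val (hβ : 1 < β) (d : ℕ → Bool) :
    Summable fun i : ℕ => ((d i).toNat : ℝ) / β ^ (i + 1) :=
  Summable.of_nonneg_of_le (val_term_nonneg hβ d) (val_term_le hβ d) (summable_inv_pow_succ hβ)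

theorem val_nonneg (hβ : 1 < β) (d : ℕ → Bool) : 0 ≤ val β d := tsum_nonneg (val_term_nonneg hβ d)

/-- A bound for all values. -/
noncomputable def valBound (β : ℝ) : ℝ := ∑' i : ℕ, β⁻¹ ^ (i + 1)

theorem valBound_nonneg (hβ : 1 < β) : 0 ≤ valBound β := tsum_nonneg fun i => by positivity

theorem val_le_valBound (hβ : 1 < β) (d : ℕ → Bool) : val β d ≤ valBound β :=
  (summable_val hβ d).tsum_le_tsum (val_term_le hβ d) (summable_inv_pow_succ hβ)

theorem val_pos (hβ : 1 < β) {d : ℕ → Bool} {i : ℕ} (h : d i = true) : 0 < val β d :=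
  (summable_val hβ d).tsum_pos (val_term_nonneg hβ d) i (by rw [h]; simp; positivity)

theorem exists_digit_of_val_pos {d : ℕ → Bool} (h : 0 < val β d) : ∃ i, d i = true := by
  by_contra hc
  push Not at hc
  have : ∀ i, d i = false := fun i => by simpa using hc i
  simp [val, this] at h

theorem val_zeroSeq : val β zeroSeq = 0 := by simp [val, zeroSeq]

theorem val_eq (hβ : 1 < β) (d : ℕ → Bool) :
    val β d = ((d 0).toNat + val β (shift 1 d)) / β := by
  have h0 : β ≠ 0 := by positivity
  unfold val
  rw [(summable_val hβ d).tsum_eq_zero_add, add_div, ← tsum_div_const]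
  congr 1
  · simp
  · congr 1
    funext i
    rw [shift_apply, add_comm 1 i, pow_succ β (i + 1), div_div]

theorem val_sub (hβ : 1 < β) {d e : ℕ → Bool} {k : ℕ} (h : ∀ i < k, d i = e i) :
    val β d - val β e = (val β (shift k d) - val β (shift k e)) / β ^ k := by
  have h0 : β ≠ 0 := by positivity
  induction k with
  | zero => simp
  | succ k ih =>
    rw [ih (fun i hi => h i (by omega)), val_eq hβ (shift k d), val_eq hβ (shift k e)]
    simp only [shift_shift, shift_apply, add_zero, h k (by omega)]
    field_simp
    ring

theorem val_sub_of_first (hβ : 1 < β) {d e : ℕ → Bool} {k : ℕ} (h : ∀ i < k, d i = e i)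
    (h0 : d k = false) (h1 : e k = true) : val β e - val β d =
      (1 + val β (shift (k + 1) e) - val β (shift (k + 1) d)) / β ^ (k + 1) := by
  have hne : β ≠ 0 := by positivity
  rw [val_sub hβ (fun i hi => (h i hi).symm), val_eq hβ (shift k d), val_eq hβ (shift k e)]
  simp only [shift_shift, shift_apply, add_zero, h0, h1]
  field_simp
  simp
  ring

theorem val_cat_sub (hβ : 1 < β) (w : List Bool) (d e : ℕ → Bool) :
    val β (cat w d) - val β (cat w e) = (val β d - val β e) / β ^ w.length := by
  rw [val_sub hβ (k := w.length), shift_cat_length, shift_cat_length]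
  intro i hi
  rw [cat_apply_lt hi, cat_apply_lt hi]

/-- Value and remainder satisfy the same expanding recursion, so after `n` steps their difference is
a bounded quantity divided by `β^n`. Applied to both the greedy and the quasi-greedy algorithm. -/
theorem val_shift_of_rec (hβ : 1 < β) {d : ℕ → Bool} {r : ℕ → ℝ} (h0 : ∀ i, 0 ≤ r i)
    (h1 : ∀ i, r i ≤ 1) (hr : ∀ i, r (i + 1) = β * r i - (d i).toNat) (i : ℕ) :
    val β (shift i d) = r i := by
  have hne : β ≠ 0 := by positivity
  have hn : ∀ n i, val β (shift i d) - r i = (val β (shift (i + n) d) - r (i + n)) / β ^ n := by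
    intro n
    induction n with
    | zero => simp
    | succ n ih =>
      intro i
      rw [ih, val_eq hβ (shift (i + n) d)]
      simp only [shift_shift, shift_apply, add_zero]
      rw [← add_assoc, hr (i + n)]
      field_simp
      ring
  have hb : ∀ n, |val β (shift i d) - r i| ≤ (valBound β + 1) * β⁻¹ ^ n := by
    intro n
    rw [hn n i, abs_div, abs_of_pos (show 0 < β ^ n by positivity), inv_pow, div_eq_mul_inv]
    gcongr
    rw [abs_le]
    have a1 := val_nonneg hβ (shift (i + n) d)
    have a2 := val_le_valBound hβ (shift (i + n) d)
    have a3 := h0 (i + n)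
    have a4 := h1 (i + n)
    constructor <;> linarith
  have hlim : Filter.Tendsto (fun n : ℕ => (valBound β + 1) * β⁻¹ ^ n) Filter.atTop (nhds 0) := by
    simpa using (tendsto_pow_atTop_nhds_zero_of_lt_one (by positivity)
      (inv_lt_one_of_one_lt₀ hβ)).const_mul (valBound β + 1)
  have := ge_of_tendsto' hlim hb
  exact sub_eq_zero.1 (abs_nonpos_iff.1 this)

theorem val_lt_val_of_lt {γ : ℝ} (hβ : 1 < β) (hγ : β < γ) {d : ℕ → Bool} {i : ℕ}
    (h : d i = true) : val γ d < val β d := by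
  have h0 : 0 < β := by linarith
  refine Summable.tsum_lt_tsum (i := i) (fun i => ?_) ?_ (summable_val (hβ.trans hγ) d)
    (summable_val hβ d)
  · have : 0 ≤ ((d i).toNat : ℝ) := by positivity
    gcongr
  · rw [h]
    have : β ^ (i + 1) < γ ^ (i + 1) := pow_lt_pow_left₀ hγ h0.le (by omega)
    simpa using inv_strictAnti₀ (by positivity) this

/-! ### Greedy and quasi-greedy algorithms -/

open Classical in
/-- One step of the greedy algorithm. -/
noncomputable def greedyStep (β r : ℝ) : ℝ := if 1 ≤ β * r then β * r - 1 else β * r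

open Classical in
/-- The digits produced by the greedy algorithm. -/
noncomputable def greedyDigits (β x : ℝ) (i : ℕ) : Bool := decide (1 ≤ β * (greedyStep β)^[i] x)

theorem greedyStep_iterate_mem (hβ : 1 < β) (hβ2 : β ≤ 2) {x : ℝ} (h0 : 0 ≤ x) (h1 : x ≤ 1)
    (i : ℕ) : 0 ≤ (greedyStep β)^[i] x ∧ (greedyStep β)^[i] x ≤ 1 := by
  induction i with
  | zero => exact ⟨h0, h1⟩
  | succ i ih =>
    rw [Function.iterate_succ_apply']
    set r := (greedyStep β)^[i] x
    unfold greedyStep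
    split_ifs with h
    · constructor
      · linarith
      · nlinarith
    · exact ⟨mul_nonneg (by linarith) ih.1, by linarith⟩

theorem val_shift_greedyDigits (hβ : 1 < β) (hβ2 : β ≤ 2) {x : ℝ} (h0 : 0 ≤ x) (h1 : x ≤ 1)
    (i : ℕ) : val β (shift i (greedyDigits β x)) = (greedyStep β)^[i] x := by
  apply val_shift_of_rec hβ
  · exact fun i => (greedyStep_iterate_mem hβ hβ2 h0 h1 i).1
  · exact fun i => (greedyStep_iterate_mem hβ hβ2 h0 h1 i).2
  · intro i
    rw [Function.iterate_succ_apply', greedyDigits]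
    set r := (greedyStep β)^[i] x
    unfold greedyStep
    split_ifs with h
    · simp [h]
    · simp [h]

theorem shift_greedyDigits (x : ℝ) (i : ℕ) :
    shift i (greedyDigits β x) = greedyDigits β ((greedyStep β)^[i] x) := by
  funext l
  simp only [shift_apply, greedyDigits, ← Function.iterate_add_apply]
  rw [add_comm]

theorem isGreedy_greedyDigits (hβ : 1 < β) (hβ2 : β ≤ 2) {x : ℝ} (h0 : 0 ≤ x) (h1 : x ≤ 1) :
    IsGreedy β x (greedyDigits β x) := by
  refine ⟨by simpa using val_shift_greedyDigits hβ hβ2 h0 h1 0, ?_⟩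
  intro e he
  rw [← not_slt]
  intro hlt
  obtain ⟨k, hag, hk0, hk1⟩ := slt_iff.1 hlt
  have h := val_sub_of_first hβ hag hk0 hk1
  have hx : val β (greedyDigits β x) = x := by
    simpa using val_shift_greedyDigits hβ hβ2 h0 h1 0
  rw [he, hx, sub_self, eq_comm, div_eq_zero_iff] at h
  have hp : β ^ (k + 1) ≠ 0 := by positivity
  have h2 := h.resolve_right hp
  rw [val_shift_greedyDigits hβ hβ2 h0 h1, Function.iterate_succ_apply'] at h2
  have h3 := val_nonneg hβ (shift (k + 1) e)
  simp only [greedyDigits, decide_eq_false_iff_not, not_le] at hk0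
  rw [greedyStep, if_neg (not_le.2 hk0)] at h2
  linarith

theorem IsGreedy.unique {x : ℝ} {d e : ℕ → Bool} (hd : IsGreedy β x d) (he : IsGreedy β x e) :
    d = e := sle_antisymm (he.2 d hd.1) (hd.2 e he.1)

theorem IsGreedy.greedy_eq {x : ℝ} {d : ℕ → Bool} (h : IsGreedy β x d) : greedy β x = d :=
  (Classical.epsilon_spec (p := IsGreedy β x) ⟨d, h⟩).unique h

theorem greedy_eq_greedyDigits (hβ : 1 < β) (hβ2 : β ≤ 2) {x : ℝ} (h0 : 0 ≤ x) (h1 : x ≤ 1) :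
    greedy β x = greedyDigits β x := (isGreedy_greedyDigits hβ hβ2 h0 h1).greedy_eq

open Classical in
/-- One step of the quasi-greedy algorithm. -/
noncomputable def quasiStep (β r : ℝ) : ℝ := if 1 < β * r then β * r - 1 else β * r

open Classical in
/-- The digits of `1` produced by the quasi-greedy algorithm. -/
noncomputable def quasiDigits (β : ℝ) (i : ℕ) : Bool := decide (1 < β * (quasiStep β)^[i] 1)

theorem quasiStep_iterate_mem (hβ : 1 < β) (hβ2 : β ≤ 2) (i : ℕ) :
    0 < (quasiStep β)^[i] 1 ∧ (quasiStep β)^[i] 1 ≤ 1 := by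
  induction i with
  | zero => simp
  | succ i ih =>
    rw [Function.iterate_succ_apply']
    set r := (quasiStep β)^[i] 1
    unfold quasiStep
    split_ifs with h
    · constructor
      · linarith
      · nlinarith
    · exact ⟨mul_pos (by linarith) ih.1, by linarith⟩

theorem val_shift_quasiDigits (hβ : 1 < β) (hβ2 : β ≤ 2) (i : ℕ) :
    val β (shift i (quasiDigits β)) = (quasiStep β)^[i] 1 := by
  apply val_shift_of_rec hβ
  · exact fun i => (quasiStep_iterate_mem hβ hβ2 i).1.le
  · exact fun i => (quasiStep_iterate_mem hβ hβ2 i).2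
  · intro i
    rw [Function.iterate_succ_apply', quasiDigits]
    set r := (quasiStep β)^[i] 1
    unfold quasiStep
    split_ifs with h
    · simp [h]
    · simp [h]

theorem isQuasiGreedyOne_quasiDigits (hβ : 1 < β) (hβ2 : β ≤ 2) :
    IsQuasiGreedyOne β (quasiDigits β) := by
  have hx : val β (quasiDigits β) = 1 := by simpa using val_shift_quasiDigits hβ hβ2 0
  refine ⟨hx, ?_, ?_⟩
  · intro n
    have h := (quasiStep_iterate_mem hβ hβ2 n).1
    rw [← val_shift_quasiDigits hβ hβ2] at h
    obtain ⟨i, hi⟩ := exists_digit_of_val_pos h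
    exact ⟨n + i, by omega, hi⟩
  intro e he hez
  rw [← not_slt]
  intro hlt
  obtain ⟨k, hag, hk0, hk1⟩ := slt_iff.1 hlt
  have h := val_sub_of_first hβ hag hk0 hk1
  rw [he, hx, sub_self, eq_comm, div_eq_zero_iff] at h
  have hp : β ^ (k + 1) ≠ 0 := by positivity
  have h2 := h.resolve_right hp
  rw [val_shift_quasiDigits hβ hβ2, Function.iterate_succ_apply'] at h2
  have h3 : 0 < val β (shift (k + 1) e) := by
    obtain ⟨i, hi, hi'⟩ := hez (k + 1)
    obtain ⟨l, rfl⟩ := Nat.exists_eq_add_of_le hi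
    exact val_pos hβ (i := l) hi'
  simp only [quasiDigits, decide_eq_false_iff_not, not_lt] at hk0
  rw [quasiStep, if_neg (not_lt.2 hk0)] at h2
  linarith

theorem alpha_eq (hβ : 1 < β) (hβ2 : β ≤ 2) : alpha β = quasiDigits β := by
  have h1 := isQuasiGreedyOne_quasiDigits hβ hβ2
  have h2 : IsQuasiGreedyOne β (alpha β) := Classical.epsilon_spec ⟨_, h1⟩
  exact sle_antisymm (h1.2.2 _ h2.1 h2.2.1) (h2.2.2 _ h1.1 h1.2.1)

theorem val_alpha (hβ : 1 < β) (hβ2 : β ≤ 2) : val β (alpha β) = 1 := by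
  rw [alpha_eq hβ hβ2]; exact (isQuasiGreedyOne_quasiDigits hβ hβ2).1

theorem val_shift_alpha (hβ : 1 < β) (hβ2 : β ≤ 2) (i : ℕ) :
    0 < val β (shift i (alpha β)) ∧ val β (shift i (alpha β)) ≤ 1 := by
  rw [alpha_eq hβ hβ2, val_shift_quasiDigits hβ hβ2]
  exact quasiStep_iterate_mem hβ hβ2 i

theorem shift_alpha_eq (hβ : 1 < β) (hβ2 : β ≤ 2) {i : ℕ} (h : val β (shift i (alpha β)) = 1) :
    shift i (alpha β) = alpha β := by
  rw [alpha_eq hβ hβ2] at h ⊢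
  rw [val_shift_quasiDigits hβ hβ2] at h
  funext l
  rw [shift_apply, quasiDigits, quasiDigits, add_comm, Function.iterate_add_apply, h]

/-- A sequence with value less than `1` is smaller than `α(β)`. -/
theorem lt_alpha_of_val_lt_one (hβ : 1 < β) (hβ2 : β ≤ 2) {d : ℕ → Bool} (h : val β d < 1) :
    d ≺ alpha β := by
  rw [← not_sle]
  intro hle
  rcases lt_or_eq_of_le hle with hlt | heq
  · obtain ⟨k, hag, hk0, hk1⟩ := slt_iff.1 hlt
    have h1 := val_sub_of_first hβ hag hk0 hk1
    rw [val_alpha hβ hβ2] at h1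
    have h2 := (val_shift_alpha hβ hβ2 (k + 1)).2
    have h3 := val_nonneg hβ (shift (k + 1) d)
    have : 0 ≤ (1 + val β (shift (k + 1) d) - val β (shift (k + 1) (alpha β))) / β ^ (k + 1) :=
      div_nonneg (by linarith) (by positivity)
    linarith
  · rw [← toLex.injective heq, val_alpha hβ hβ2] at h
    exact lt_irrefl _ h

theorem shift_alpha_le (hβ : 1 < β) (hβ2 : β ≤ 2) (i : ℕ) : shift i (alpha β) ≼ alpha β := by
  rcases lt_or_eq_of_le (val_shift_alpha hβ hβ2 i).2 with h | h
  · exact (lt_alpha_of_val_lt_one hβ hβ2 h).le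
  · exact sle_of_eq (shift_alpha_eq hβ hβ2 h)

theorem alpha_zero (hβ : 1 < β) (hβ2 : β ≤ 2) : alpha β 0 = true := by
  obtain ⟨i, hi⟩ := exists_digit_of_val_pos (β := β) (d := alpha β) (by rw [val_alpha hβ hβ2]; simp)
  by_contra hc
  refine not_slt.2 (shift_alpha_le hβ hβ2 i) (slt_iff.2 ⟨0, by simp, by simpa using hc, ?_⟩)
  simpa [shift_apply] using hi

/-- A bound `1 + ε` for all shifts improves to `1 + ε/β`: at the first digit below `α(β)` the excess
of the following tail is divided by a positive power of `β`. Start from the trivial bound and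
iterate. -/
theorem val_le_one (hβ : 1 < β) (hβ2 : β ≤ 2) {d : ℕ → Bool} (h : ∀ i, shift i d ≼ alpha β) :
    val β d ≤ 1 := by
  have hn : ∀ n i, val β (shift i d) ≤ 1 + valBound β * β⁻¹ ^ n := by
    intro n
    induction n with
    | zero =>
      intro i
      have := val_le_valBound hβ (shift i d)
      simp; linarith
    | succ n ih =>
      intro i
      have hB : 0 ≤ valBound β * β⁻¹ ^ (n + 1) := mul_nonneg (valBound_nonneg hβ) (by positivity)
      rcases lt_or_eq_of_le (h i) with hlt | heq
      · obtain ⟨k, hag, hk0, hk1⟩ := slt_iff.1 hlt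
        have h1 := val_sub_of_first hβ hag hk0 hk1
        rw [val_alpha hβ hβ2, shift_shift] at h1
        have h2 := (val_shift_alpha hβ hβ2 (k + 1)).1
        have h3 := ih (i + (k + 1))
        have h4 : -(valBound β * β⁻¹ ^ n) / β ^ (k + 1) ≤
            (1 + val β (shift (k + 1) (alpha β)) - val β (shift (i + (k + 1)) d)) / β ^ (k + 1) := by
          gcongr
          linarith
        have h5 : valBound β * β⁻¹ ^ n / β ^ (k + 1) ≤ valBound β * β⁻¹ ^ (n + 1) := by
          rw [pow_succ β⁻¹ n, ← mul_assoc, div_eq_mul_inv]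
          have hbb : β ≤ β ^ (k + 1) := le_self_pow₀ hβ.le (by omega)
          have : (β ^ (k + 1))⁻¹ ≤ β⁻¹ := inv_anti₀ (by positivity) hbb
          have h6 : 0 ≤ valBound β * β⁻¹ ^ n := mul_nonneg (valBound_nonneg hβ) (by positivity)
          exact mul_le_mul_of_nonneg_left this h6
        rw [neg_div] at h4
        linarith
      · rw [toLex.injective heq, val_alpha hβ hβ2]
        linarith
  have hlim : Filter.Tendsto (fun n : ℕ => 1 + valBound β * β⁻¹ ^ n) Filter.atTop (nhds 1) := by
    simpa using ((tendsto_pow_atTop_nhds_zero_of_lt_one (by positivity)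
      (inv_lt_one_of_one_lt₀ hβ)).const_mul (valBound β)).const_add 1
  exact ge_of_tendsto' hlim fun n => by simpa using hn n 0

/-! ### Admissible sequences -/

/-- All shifts of `d` are smaller than `α(β)`. -/
def Admissible (β : ℝ) (d : ℕ → Bool) : Prop := ∀ i, shift i d ≺ alpha β

theorem Admissible.shift {d : ℕ → Bool} (h : Admissible β d) (i : ℕ) :
    Admissible β (shift i d) := fun l => by
  rw [shift_shift]; exact h _

theorem Admissible.val_lt_one (hβ : 1 < β) (hβ2 : β ≤ 2) {d : ℕ → Bool} (h : Admissible β d) :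
    val β d < 1 := by
  have h0 : d ≺ alpha β := by simpa using h 0
  obtain ⟨k, hag, hk0, hk1⟩ := slt_iff.1 h0
  have h1 := val_sub_of_first hβ hag hk0 hk1
  rw [val_alpha hβ hβ2] at h1
  have h2 := (val_shift_alpha hβ hβ2 (k + 1)).1
  have h3 := val_le_one hβ hβ2 (d := BetaBifurcation.shift (k + 1) d) fun i => by
    rw [shift_shift]; exact (h _).le
  have : 0 < (1 + val β (BetaBifurcation.shift (k + 1) (alpha β)) -
      val β (BetaBifurcation.shift (k + 1) d)) / β ^ (k + 1) :=
    div_pos (by linarith) (by positivity)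
  linarith

/-- After the first difference the tail of `d` is worth less than the digit `1` that `e` has gained.
Only the smaller sequence has to be admissible. -/
theorem Admissible.val_lt_val (hβ : 1 < β) (hβ2 : β ≤ 2) {d e : ℕ → Bool} (h : Admissible β d)
    (hlt : d ≺ e) : val β d < val β e := by
  obtain ⟨k, hag, hk0, hk1⟩ := slt_iff.1 hlt
  have h1 := val_sub_of_first hβ hag hk0 hk1
  have h2 := val_nonneg hβ (BetaBifurcation.shift (k + 1) e)
  have h3 := (h.shift (k + 1)).val_lt_one hβ hβ2
  have : 0 < (1 + val β (BetaBifurcation.shift (k + 1) e) -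
      val β (BetaBifurcation.shift (k + 1) d)) / β ^ (k + 1) :=
    div_pos (by linarith) (by positivity)
  linarith

theorem Admissible.val_le_val (hβ : 1 < β) (hβ2 : β ≤ 2) {d e : ℕ → Bool} (h : Admissible β d)
    (hle : d ≼ e) : val β d ≤ val β e := by
  rcases lt_or_eq_of_le hle with hlt | heq
  · exact (h.val_lt_val hβ hβ2 hlt).le
  · rw [toLex.injective heq]

theorem Admissible.le_of_val_le_val (hβ : 1 < β) (hβ2 : β ≤ 2) {d e : ℕ → Bool}
    (he : Admissible β e) (h : val β d ≤ val β e) : d ≼ e := by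
  rw [← not_slt]
  intro hlt
  exact absurd (he.val_lt_val hβ hβ2 hlt) (not_lt.2 h)

theorem Admissible.isGreedy (hβ : 1 < β) (hβ2 : β ≤ 2) {d : ℕ → Bool} (h : Admissible β d) :
    IsGreedy β (val β d) d := by
  refine ⟨rfl, fun e he => ?_⟩
  rw [← not_slt]
  intro hlt
  have := h.val_lt_val hβ hβ2 hlt
  linarith

theorem Admissible.greedy_val (hβ : 1 < β) (hβ2 : β ≤ 2) {d : ℕ → Bool} (h : Admissible β d) :
    greedy β (val β d) = d := (h.isGreedy hβ hβ2).greedy_eq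

theorem Admissible.val_mem (hβ : 1 < β) (hβ2 : β ≤ 2) {d : ℕ → Bool} (h : Admissible β d) :
    val β d ∈ Set.Ico (0 : ℝ) 1 := ⟨val_nonneg hβ d, h.val_lt_one hβ hβ2⟩

theorem greedyStep_iterate_lt (hβ : 1 < β) (hβ2 : β ≤ 2) {x : ℝ} (h1 : x < 1)
    (i : ℕ) : (greedyStep β)^[i] x < 1 := by
  induction i with
  | zero => exact h1
  | succ i ih =>
    rw [Function.iterate_succ_apply']
    set r := (greedyStep β)^[i] x
    unfold greedyStep
    split_ifs with h
    · nlinarith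
    · linarith

/-- With `Admissible.isGreedy` this is Parry's criterion: the remainders of a point below `1` stay
below `1`, and values below `1` lie below `α(β)`. -/
theorem admissible_greedyDigits (hβ : 1 < β) (hβ2 : β ≤ 2) {x : ℝ} (hx : x ∈ Set.Ico (0 : ℝ) 1) :
    Admissible β (greedyDigits β x) := fun i => by
  apply lt_alpha_of_val_lt_one hβ hβ2
  rw [val_shift_greedyDigits hβ hβ2 hx.1 hx.2.le]
  exact greedyStep_iterate_lt hβ hβ2 hx.2 i

theorem exists_admissible (hβ : 1 < β) (hβ2 : β ≤ 2) {x : ℝ} (hx : x ∈ Set.Ico (0 : ℝ) 1) :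
    ∃ d, Admissible β d ∧ val β d = x ∧ greedy β x = d :=
  ⟨greedyDigits β x, admissible_greedyDigits hβ hβ2 hx,
    by simpa using val_shift_greedyDigits hβ hβ2 hx.1 hx.2.le 0,
    greedy_eq_greedyDigits hβ hβ2 hx.1 hx.2.le⟩

theorem Admissible.pointOf_eq (hβ : 1 < β) (hβ2 : β ≤ 2) {d : ℕ → Bool} (h : Admissible β d) :
    pointOf β d = val β d := by
  have hs := Classical.epsilon_spec (p := fun t : ℝ => t ∈ Set.Ico (0 : ℝ) 1 ∧ greedy β t = d)
    ⟨val β d, h.val_mem hβ hβ2, h.greedy_val hβ hβ2⟩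
  obtain ⟨e, -, h2, h3⟩ := exists_admissible hβ hβ2 hs.1
  rw [hs.2] at h3
  rw [pointOf, ← h2, h3]

theorem admissible_of_greedy_eq (hβ : 1 < β) (hβ2 : β ≤ 2) {d : ℕ → Bool}
    (h : ∃ t ∈ Set.Ico (0 : ℝ) 1, greedy β t = d) : Admissible β d := by
  obtain ⟨t, ht, rfl⟩ := h
  obtain ⟨e, h1, -, h3⟩ := exists_admissible hβ hβ2 ht
  rwa [h3]

theorem isBetaLyndon_iff (hβ : 1 < β) (hβ2 : β ≤ 2) {w : List Bool} :
    IsBetaLyndon β w ↔ IsLyndon w ∧ Admissible β (per w) := by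
  refine and_congr_right fun _ => ⟨admissible_of_greedy_eq hβ hβ2, fun h => ?_⟩
  exact ⟨_, h.val_mem hβ hβ2, h.greedy_val hβ hβ2⟩

/-! ### Survivor sets in terms of sequences -/

theorem betaMap_eq_greedyStep (hβ : 1 < β) (hβ2 : β ≤ 2) {x : ℝ} (hx : x ∈ Set.Ico (0 : ℝ) 1) :
    betaMap β x = greedyStep β x := by
  unfold betaMap greedyStep
  have h1 : 0 ≤ β * x := mul_nonneg (by linarith) hx.1
  have h2 : β * x < 2 := by nlinarith [hx.1, hx.2]
  split_ifs with h
  · rw [Int.fract_eq_iff]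
    exact ⟨by linarith, by linarith, 1, by simp⟩
  · rw [Int.fract_eq_self]
    exact ⟨h1, not_le.1 h⟩

theorem betaMap_iterate_val (hβ : 1 < β) (hβ2 : β ≤ 2) {d : ℕ → Bool} (h : Admissible β d)
    (n : ℕ) : (betaMap β)^[n] (val β d) = val β (shift n d) := by
  have hd := h.greedy_val hβ hβ2
  have hm := h.val_mem hβ hβ2
  rw [greedy_eq_greedyDigits hβ hβ2 hm.1 hm.2.le] at hd
  have key : ∀ n, (betaMap β)^[n] (val β d) = (greedyStep β)^[n] (val β d) := by
    intro n
    induction n with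
    | zero => rfl
    | succ n ih =>
      rw [Function.iterate_succ_apply', Function.iterate_succ_apply', ih, betaMap_eq_greedyStep hβ hβ2]
      exact ⟨(greedyStep_iterate_mem hβ hβ2 hm.1 hm.2.le n).1,
        greedyStep_iterate_lt hβ hβ2 hm.2 n⟩
  rw [key, ← val_shift_greedyDigits hβ hβ2 hm.1 hm.2.le, hd]

theorem val_mem_survivor (hβ : 1 < β) (hβ2 : β ≤ 2) {d e : ℕ → Bool} (hd : Admissible β d)
    (he : Admissible β e) (h : ∀ n, e ≼ shift n d) : val β d ∈ survivor β (val β e) :=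
  ⟨hd.val_mem hβ hβ2, fun n => by
    rw [betaMap_iterate_val hβ hβ2 hd]; exact he.val_le_val hβ hβ2 (h n)⟩

theorem exists_of_mem_survivor (hβ : 1 < β) (hβ2 : β ≤ 2) {x : ℝ} {e : ℕ → Bool}
    (hx : x ∈ survivor β (val β e)) :
    ∃ d, Admissible β d ∧ val β d = x ∧ ∀ n, e ≼ shift n d := by
  obtain ⟨d, hd, rfl, -⟩ := exists_admissible hβ hβ2 hx.1
  refine ⟨d, hd, rfl, fun n => ?_⟩
  apply (hd.shift n).le_of_val_le_val hβ hβ2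
  rw [← betaMap_iterate_val hβ hβ2 hd]
  exact hx.2 n

/-- The point itself survives for the threshold `val β d`, and at time `0` it violates every larger
threshold. -/
theorem val_mem_bifurcationSet (hβ : 1 < β) (hβ2 : β ≤ 2) {d : ℕ → Bool} (hd : Admissible β d)
    (h : ∀ n, d ≼ shift n d) : val β d ∈ bifurcationSet β := by
  refine ⟨hd.val_mem hβ hβ2, fun t' ht' heq => ?_⟩
  have h1 : val β d ∈ survivor β t' := by
    rw [heq]; exact val_mem_survivor hβ hβ2 hd hd h
  have := h1.2 0
  simp at this
  linarith

end

section

/-! ### The sequence on which the construction runs -/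

variable {β : ℝ}

/-- If `α(β)` has minimal period `q + 1`, the greedy expansion of `1` is the first period with its
last digit raised, followed by `0^∞`. -/
theorem baseSeq_cases (hβ : 1 < β) (hβ2 : β < 2) :
    (IsGreedy β 1 (baseSeq β) ∧ ∃ q, (∀ i < q, baseSeq β i = alpha β i) ∧ baseSeq β q = true ∧
      alpha β q = false ∧ (∀ i, q < i → baseSeq β i = false) ∧
      shift (q + 1) (alpha β) = alpha β) ∨ baseSeq β = alpha β := by
  classical
  by_cases hper : ∃ m : ℕ, 1 ≤ m ∧ shift m (alpha β) = alpha β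
  · left
    have hp := Nat.find_spec hper
    have hmin := fun i (hi : i < Nat.find hper) => Nat.find_min hper hi
    obtain ⟨q, hq⟩ := Nat.exists_eq_add_of_le' hp.1
    rw [hq] at hp hmin
    -- A last digit `1` followed by a tail of value `1` would give the value `2/β > 1`.
    have hαq : alpha β q = false := by
      by_contra hc
      have hc' : alpha β q = true := by simpa using hc
      have h1 := val_eq hβ (shift q (alpha β))
      rw [shift_shift, hp.2, val_alpha hβ hβ2.le, shift_apply, add_zero, hc'] at h1
      have h2 := (val_shift_alpha hβ hβ2.le q).2
      rw [h1, div_le_one (by linarith)] at h2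
      simp at h2
      linarith
    set c : ℕ → Bool := fun i => if i < q then alpha β i else decide (i = q) with hc
    have hc1 : ∀ i < q, alpha β i = c i := fun i hi => by simp [hc, hi]
    have hc2 : c q = true := by simp [hc]
    have hc3 : ∀ i, q < i → c i = false := fun i hi => by
      simp only [hc]
      rw [if_neg (by omega), decide_eq_false_iff_not]
      omega
    have hc4 : ∀ k, q < k → shift k c = zeroSeq := fun k hk => by
      funext i; exact hc3 _ (by omega)
    have hval : val β c = 1 := by
      have h1 := val_sub_of_first hβ hc1 hαq hc2
      rw [hp.2, val_alpha hβ hβ2.le, hc4 _ (by omega), val_zeroSeq] at h1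
      simp at h1
      linarith
    have hgreedy : IsGreedy β 1 c := by
      refine ⟨hval, fun e he => ?_⟩
      rw [← not_slt]
      intro hlt
      obtain ⟨k, hag, hk0, hk1⟩ := slt_iff.1 hlt
      have hpk : 0 < β ^ (k + 1) := by positivity
      rcases lt_trichotomy k q with hkq | hkq | hkq
      · have h1 := val_sub_of_first (d := alpha β) (e := e) hβ
          (fun i hi => by rw [hc1 i (by omega), hag i hi]) (by rw [hc1 k hkq, hk0]) hk1
        rw [he, val_alpha hβ hβ2.le, sub_self, eq_comm, div_eq_zero_iff] at h1
        have h2 := h1.resolve_right hpk.ne'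
        have h3 := val_nonneg hβ (shift (k + 1) e)
        have h4 := (val_shift_alpha hβ hβ2.le (k + 1)).2
        exact hmin (k + 1) (by omega) ⟨by omega, shift_alpha_eq hβ hβ2.le (by linarith)⟩
      · rw [hkq, hc2] at hk0
        cases hk0
      · have h1 := val_sub_of_first hβ hag hk0 hk1
        rw [he, hval, hc4 _ (by omega), val_zeroSeq, sub_self, eq_comm, div_eq_zero_iff] at h1
        have h2 := h1.resolve_right hpk.ne'
        have h3 := val_nonneg hβ (shift (k + 1) e)
        linarith
    have hb : baseSeq β = c := by rw [baseSeq, if_pos hper, hgreedy.greedy_eq]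
    rw [hb]
    exact ⟨hgreedy, q, fun i hi => (hc1 i hi).symm, hc2, hαq, hc3, hp.2⟩
  · right
    rw [baseSeq, if_neg hper]

theorem val_baseSeq (hβ : 1 < β) (hβ2 : β < 2) : val β (baseSeq β) = 1 := by
  rcases baseSeq_cases hβ hβ2 with h | h
  · exact h.1.1
  · rw [h, val_alpha hβ hβ2.le]

theorem alpha_le_baseSeq (hβ : 1 < β) (hβ2 : β < 2) : alpha β ≼ baseSeq β := by
  rcases baseSeq_cases hβ hβ2 with h | h
  · exact h.1.2 _ (val_alpha hβ hβ2.le)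
  · rw [h]

theorem shift_baseSeq_le (hβ : 1 < β) (hβ2 : β < 2) (i : ℕ) :
    shift i (baseSeq β) ≼ baseSeq β := by
  rcases baseSeq_cases hβ hβ2 with ⟨h, -⟩ | h
  · have hd : baseSeq β = greedyDigits β 1 :=
      h.unique (isGreedy_greedyDigits hβ hβ2.le (by norm_num) le_rfl)
    have hv := val_shift_greedyDigits hβ hβ2.le (x := 1) (by norm_num) le_rfl i
    have hle := (greedyStep_iterate_mem hβ hβ2.le (x := 1) (by norm_num) le_rfl i).2
    rcases lt_or_eq_of_le hle with hlt | heq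
    · refine le_trans (lt_alpha_of_val_lt_one hβ hβ2.le ?_).le (alpha_le_baseSeq hβ hβ2)
      rw [hd, hv]; exact hlt
    · apply sle_of_eq
      rw [hd, shift_greedyDigits, heq]
  · rw [h]; exact shift_alpha_le hβ hβ2.le i

/-- Lowered factors of the base sequence are smaller than its prefixes. -/
theorem suffix_lt_baseSeq (hβ : 1 < β) (hβ2 : β < 2) {e i : ℕ} (he : baseSeq β e = true)
    (hie : i ≤ e) : WordLT (subword (baseSeq β) i (e - i) ++ [false])
      (subword (baseSeq β) 0 (e - i + 1)) := by
  have h1 := shift_baseSeq_le hβ hβ2 i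
  rw [← cat_subword _ i (e - i + 1)] at h1
  have h2 : baseSeq β = cat (subword (baseSeq β) 0 (e - i + 1)) (shift (e - i + 1) (baseSeq β)) := by
    conv_lhs => rw [← shift_zero (baseSeq β), ← cat_subword _ 0 (e - i + 1)]
    simp
  conv at h1 => rhs; rw [h2]
  have h3 : subword (baseSeq β) i (e - i + 1) = subword (baseSeq β) i (e - i) ++ [true] := by
    rw [subword_add, subword_one, Nat.add_sub_cancel' hie, he]
  have h4 := eq_or_wordLT (by simp) h1
  rw [h3] at h4
  rcases h4 with h4 | h4
  · rw [← h4]; exact wordLT_snoc _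
  · exact (wordLT_snoc _).trans h4

/-- Lowered factors of the base sequence, not at its beginning, are smaller than `α(β)`. -/
theorem suffix_lt_alpha (hβ : 1 < β) (hβ2 : β < 2) {e i : ℕ} (he : baseSeq β e = true)
    (hi : 1 ≤ i) (hie : i ≤ e) : WordLT (subword (baseSeq β) i (e - i) ++ [false])
      (subword (alpha β) 0 (e - i + 1)) := by
  have hag : subword (alpha β) 0 (e - i + 1) = subword (baseSeq β) 0 (e - i + 1) := by
    apply subword_eq_of_agree
    intro l hl
    rcases baseSeq_cases hβ hβ2 with ⟨-, q, h1, h2, h3, h4, h5⟩ | h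
    · have : e ≤ q := by
        by_contra hc
        rw [h4 e (by omega)] at he
        cases he
      rw [h1 _ (by omega)]
    · rw [h]
  rw [hag]
  exact suffix_lt_baseSeq hβ hβ2 he hie

theorem slt_of_wordLT_subword {w : List Bool} {a : ℕ → Bool} {n : ℕ} (h : WordLT w (subword a 0 n))
    (z : ℕ → Bool) : cat w z ≺ a := by
  have h2 : a = cat (subword a 0 n) (shift n a) := by
    conv_lhs => rw [← shift_zero a, ← cat_subword _ 0 n]
    simp
  rw [h2]
  exact h _ _

/-- The later digit `1` at `e'` guarantees that `a` and `α(β)` agree up to `e`: in the periodic case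
they first differ at the last `1` of `a`. -/
theorem lowered_prefix_lt (hβ : 1 < β) (hβ2 : β < 2) {e e' : ℕ} (he : baseSeq β e = true)
    (he' : baseSeq β e' = true) (hee : e < e') :
    WordLT (subword (baseSeq β) 0 e ++ [false]) (subword (alpha β) 0 (e + 1)) := by
  have hag : subword (alpha β) 0 (e + 1) = subword (baseSeq β) 0 (e + 1) := by
    apply subword_eq_of_agree
    intro l hl
    rcases baseSeq_cases hβ hβ2 with ⟨-, q, h1, h2, h3, h4, h5⟩ | h
    · have : e' ≤ q := by
        by_contra hc
        rw [h4 e' (by omega)] at he'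
        cases he'
      rw [h1 _ (by omega)]
    · rw [h]
  rw [hag, subword_add, subword_one, zero_add, he]
  exact wordLT_snoc _

/-- If `e'` is the last `1` of `a` in the periodic case, the first lowered prefix is exactly the
period of `α(β)` and decides nothing; the second, shorter one then does. This is why the blocks
`A₀1V` are always followed by `A`. -/
theorem lowered_prefix_append_lt (hβ : 1 < β) (hβ2 : β < 2) {e e' : ℕ}
    (he : baseSeq β e = true) (he' : baseSeq β e' = true) (hee : e < e') (z : ℕ → Bool) :
    cat (subword (baseSeq β) 0 e' ++ [false]) (cat (subword (baseSeq β) 0 e ++ [false]) z) ≺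
      alpha β := by
  have hA := lowered_prefix_lt hβ hβ2 he he' hee
  rcases baseSeq_cases hβ hβ2 with ⟨-, q, h1, h2, h3, h4, h5⟩ | h
  · have heq : e' ≤ q := by
      by_contra hc
      rw [h4 e' (by omega)] at he'
      cases he'
    rcases lt_or_eq_of_le heq with hlt | rfl
    · exact slt_of_wordLT_subword (lowered_prefix_lt hβ hβ2 he' h2 hlt) _
    · have : subword (baseSeq β) 0 e' ++ [false] = subword (alpha β) 0 (e' + 1) := by
        rw [subword_add, subword_one, zero_add, h3,
          subword_eq_of_agree (fun i hi => by rw [zero_add, h1 i hi])]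
      rw [this]
      have h6 : alpha β = cat (subword (alpha β) 0 (e' + 1)) (alpha β) := by
        conv_lhs => rw [← shift_zero (alpha β), ← cat_subword _ 0 (e' + 1), zero_add, h5]
      conv_rhs => rw [h6]
      rw [cat_lt_cat]
      exact slt_of_wordLT_subword hA _
  · rw [h] at he' ⊢
    apply slt_of_wordLT_subword (n := e' + 1)
    rw [subword_add _ 0 e' 1, subword_one, zero_add, he']
    exact wordLT_snoc _

/-! ### The words of the construction -/

theorem IsNextLength.lt_shift {a : ℕ → Bool} {j n : ℕ} (h : IsNextLength a j n) (i : ℕ)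
    (h1 : 1 ≤ i) (h2 : i < n) : shift j a ≺ shift (j + i) a := by
  rw [← not_sle]
  intro hc
  have := h.2.2 (show i ∈ {n : ℕ | 1 ≤ n ∧ shift (j + n) a ≼ shift j a} from ⟨h1, hc⟩)
  omega

/-- All follows from `σ^j a ≺ σ^(j+i) a` for `0 < i < n` and `σ^(j+n) a ≼ σ^j a`: a final digit `0`,
or a proper suffix of `v` that is also a prefix, could be cancelled and would give `σ^(j+n) a` above
some `σ^(j+i) a` with `0 < i < n`. -/
theorem IsNextLength.facts {a : ℕ → Bool} {j n : ℕ} (h : IsNextLength a j n) (hj : a j = false) :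
    2 ≤ n ∧ a (j + (n - 1)) = true ∧ StrongLyndon (subword a j n) ∧
      shift j a ≼ per (subword a j n) ∧ shift (j + n) a ≼ shift j a := by
  have hgt := h.lt_shift
  obtain ⟨hz, ⟨hn1, hle⟩, hmin⟩ := h
  have hne : subword a j n ≠ [] := by
    intro hc
    have := congrArg List.length hc
    simp at this; omega
  have hper : shift j a ≼ per (subword a j n) := by
    apply le_per hne
    conv_lhs => rw [← cat_subword a j n]
    exact (cat_le_cat _).2 hle
  have hcons : ∀ i, a i = false → shift i a = cat [false] (shift (i + 1) a) := by
    intro i hi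
    rw [← hi, ← subword_one, cat_subword]
  have hn2 : 2 ≤ n := by
    by_contra hc
    have hn : n = 1 := by omega
    subst hn
    apply hz
    rw [subword_one, hj] at hper
    have : per [false] = zeroSeq := by funext l; simp [per, zeroSeq, Nat.mod_one]
    rw [this] at hper
    rcases lt_or_eq_of_le hper with h1 | h1
    · exact absurd h1 not_lt_zeroSeq
    · exact toLex.injective h1
  refine ⟨hn2, ?_, ?_, hper, hle⟩
  · by_contra hc
    have hc' : a (j + (n - 1)) = false := by simpa using hc
    have h1 := hgt (n - 1) (by omega) (by omega)
    rw [hcons _ hc', hcons _ hj, cat_lt_cat, show j + (n - 1) + 1 = j + n by omega] at h1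
    have h2 := hgt 1 le_rfl (by omega)
    exact absurd (h2.trans h1) (not_slt.2 hle)
  · intro x y hxy hx hy
    have hlen := congrArg List.length hxy
    simp only [length_subword, List.length_append] at hlen
    have hx0 := List.length_pos_iff.2 hx
    have hy0 := List.length_pos_iff.2 hy
    have e1 : subword a j n = subword a j x.length ++ subword a (j + x.length) y.length := by
      rw [hlen, subword_add]
    have e2 : subword a j n = subword a j y.length ++ subword a (j + y.length) x.length := by
      rw [hlen, add_comm x.length, subword_add]
    obtain ⟨-, hy'⟩ := List.append_inj (e1.symm.trans hxy) (by simp)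
    have h1 := hgt x.length hx0 (by omega)
    have h1' := h1.le
    rw [← cat_subword a j y.length, ← cat_subword a (j + x.length) y.length] at h1 h1'
    rw [← hy', e2]
    rcases eq_or_wordLT (by simp) h1' with h2 | h2
    · exfalso
      rw [← h2, cat_lt_cat, show j + x.length + y.length = j + n by omega] at h1
      have h3 := hgt y.length hy0 (by omega)
      exact absurd (h3.trans h1) (not_slt.2 hle)
    · exact h2.append_left _

/-- Tails decrease along the positions, and every index between `|S|` and `j` lies in exactly one of
the earlier words; the last clause names that word. -/
theorem IsPosition.facts {a : ℕ → Bool} {S : List Bool} (hS : 1 ≤ S.length)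
    (h1 : a (S.length - 1) = true) (h0 : a S.length = false) {j : ℕ} (h : IsPosition a S j) :
    S.length ≤ j ∧ a (j - 1) = true ∧ a j = false ∧ shift j a ≼ shift S.length a ∧
      ∀ g, S.length ≤ g → g < j → ∃ j' n', IsPosition a S j' ∧ IsNextLength a j' n' ∧ j' ≤ g ∧
        g < j' + n' ∧ j' + n' ≤ j ∧ shift j a ≼ shift j' a := by
  induction h with
  | first => exact ⟨le_rfl, h1, h0, le_rfl, fun g h h' => by omega⟩
  | @next j n hj hn ih =>
    obtain ⟨i1, i2, i3, i4, i5⟩ := ih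
    obtain ⟨f1, f2, f3, f4, f5⟩ := hn.facts i3
    refine ⟨by omega, ?_, ?_, f5.trans i4, ?_⟩
    · rwa [show j + n - 1 = j + (n - 1) by omega]
    · have := cons_apply_zero_of_le f5 (by simpa [shift_apply] using i3)
      simpa [shift_apply] using this
    · intro g hg hgj
      rcases lt_or_ge g j with h | h
      · obtain ⟨j', n', a1, a2, a3, a4, a5, a6⟩ := i5 g hg h
        exact ⟨j', n', a1, a2, a3, a4, by omega, f5.trans a6⟩
      · exact ⟨j, n, hj, hn, h, hgj, le_rfl, f5⟩

/-- What the basic interval says about the base sequence. -/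
structure BaseData (β : ℝ) (S : List Bool) : Prop where
  one_lt : 1 < β
  lt_two : β < 2
  lyndon : StrongLyndon S
  two_le : 2 ≤ S.length
  lower : per (maxRot S) ≺ alpha β
  start : baseSeq β = cat (plus (maxRot S)) (shift S.length (baseSeq β))
  upper : shift S.length (baseSeq β) ≺ cat (minus S) (per (maxRot S))

/-- A fixed sequence loses value when the base grows, so having value `1` in a smaller base means
value below `1` in a larger one, hence being below the quasi-greedy expansion there. This gives
`𝕃(S)^∞ ≺ α(β)` and `a ≺ 𝕃(S)⁺S⁻𝕃(S)^∞`. -/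
theorem baseData_of_mem {S : List Bool} (hS : StrongLyndon S) (hS2 : 2 ≤ S.length) {bl br : ℝ}
    (hI : IsBasicInterval S bl br) (hβ : β ∈ Set.Ioo bl br) : BaseData β S := by
  obtain ⟨hl, hr, hal, har⟩ := hI
  have h1 : 1 < β := hl.1.trans hβ.1
  have h2 : β < 2 := hβ.2.trans_le hr.2
  have hlow : per (maxRot S) ≺ alpha β := by
    rw [← hal]
    apply lt_alpha_of_val_lt_one h1 h2.le
    rw [← val_alpha hl.1 hl.2]
    exact val_lt_val_of_lt hl.1 hβ.1 (alpha_zero hl.1 hl.2)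
  have hle := alpha_le_baseSeq h1 h2
  have ha0 : ∃ i, baseSeq β i = true :=
    exists_digit_of_val_pos (β := β) (by rw [val_baseSeq h1 h2]; norm_num)
  have hup : baseSeq β ≺ cat (plus (maxRot S)) (cat (minus S) (per (maxRot S))) := by
    rw [← har]
    apply lt_alpha_of_val_lt_one (h1.trans hβ.2) hr.2
    rw [← val_baseSeq h1 h2]
    obtain ⟨i, hi⟩ := ha0
    exact val_lt_val_of_lt h1 hβ.2 hi
  obtain ⟨A, hA⟩ := maxRot_snoc hS hS2
  rw [← List.cons_append] at hA
  have hlen : (true :: A).length + 1 = S.length := by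
    rw [← length_maxRot S, hA]; simp
  have hne : maxRot S ≠ [] := by rw [hA]; simp
  have hpl : plus (maxRot S) = (true :: A) ++ [true] := by rw [hA, plus_snoc]
  have hb : baseSeq β = cat (plus (maxRot S)) (shift S.length (baseSeq β)) := by
    have h3 := (hlow.trans_le hle).le
    rw [per_eq hne] at h3
    conv at h3 => lhs; rw [hA]
    have h4 := hup.le
    rw [hpl] at h4
    rcases adjacent h3 h4 with h5 | h5
    -- If `a` began with `𝕃(S)`, then `σ^|S| a ≼ a` would force `σ^|S| a ≼ 𝕃(S)^∞`, hence `a ≼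
    -- 𝕃(S)^∞`.
    · exfalso
      rw [hlen, ← hA] at h5
      have h6 : per (maxRot S) ≺ baseSeq β := hlow.trans_le hle
      have h7 := shift_baseSeq_le h1 h2 S.length
      rw [h5, shift_cat (by simp), ← length_maxRot S, List.drop_length, cat_nil] at h7
      have h8 := le_per hne h7
      rw [h5, per_eq hne, cat_lt_cat, ← length_maxRot S] at h6
      exact absurd h6 (not_slt.2 h8)
    · rw [hpl, ← hlen]; exact h5
  refine ⟨h1, h2, hS, hS2, hlow, hb, ?_⟩
  rw [hb, cat_lt_cat] at hup
  exact hup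

end

section

/-! ### Dimension estimates for coded sets -/

open scoped NNReal ENNReal

/-- The estimate makes `V` a function of `U`, and this function is Hölder of exponent `r` on the
range of `U`. -/
theorem dimH_range_le {Ω : Type*} {U V : Ω → ℝ} {C r : ℝ≥0} (hr : 0 < r)
    (h : ∀ ω ω', |V ω - V ω'| ≤ C * |U ω - U ω'| ^ (r : ℝ)) :
    dimH (Set.range V) ≤ dimH (Set.range U) / r := by
  classical
  rcases isEmpty_or_nonempty Ω with hΩ | hΩ
  · simp [Set.range_eq_empty]
  set f : ℝ → ℝ := fun x => V (Function.invFun U x) with hf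
  have hU : ∀ ω, U (Function.invFun U (U ω)) = U ω := fun ω =>
    Function.invFun_eq ⟨ω, rfl⟩
  have hfU : ∀ ω, f (U ω) = V ω := by
    intro ω
    have h1 := h (Function.invFun U (U ω)) ω
    rw [hU, sub_self, abs_zero, Real.zero_rpow (by exact_mod_cast hr.ne'), mul_zero] at h1
    exact sub_eq_zero.1 (abs_nonpos_iff.1 h1)
  have himg : f '' Set.range U = Set.range V := by
    ext x
    simp only [Set.mem_image, Set.mem_range, exists_exists_eq_and, hfU]
  have hH : HolderOnWith C r f (Set.range U) := by
    rintro _ ⟨ω, rfl⟩ _ ⟨ω', rfl⟩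
    rw [hfU, hfU, edist_dist, edist_dist, Real.dist_eq, Real.dist_eq,
      ENNReal.ofReal_rpow_of_nonneg (p := (r : ℝ)) (abs_nonneg (U ω - U ω')) r.coe_nonneg]
    rw [← ENNReal.ofReal_coe_nnreal, ← ENNReal.ofReal_mul C.coe_nonneg]
    exact ENNReal.ofReal_le_ofReal (h ω ω')
  rw [← himg]
  exact hH.dimH_image_le hr

theorem exists_first_diff {ω ω' : ℕ → Bool} (h : ω ≠ ω') :
    ∃ k, (∀ i < k, ω i = ω' i) ∧ ω k ≠ ω' k := by
  classical
  have hex : ∃ k, ω k ≠ ω' k := by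
    by_contra hc
    push Not at hc
    exact h (funext hc)
  refine ⟨Nat.find hex, fun i hi => ?_, Nat.find_spec hex⟩
  by_contra hc
  exact Nat.find_min hex hi hc

variable {β : ℝ}

/-- Separation of the values of two sequences that are coded by distinct binary sequences. -/
theorem flat_gap (hβ : 1 < β) {g : Bool → List Bool} (hg : ∀ b, g b ≠ []) {c : ℝ}
    (hc : ∀ ω ω' : ℕ → Bool, ω 0 = false → ω' 0 = true →
      c ≤ |val β (flat fun k => g (ω k)) - val β (flat fun k => g (ω' k))|)
    {ω ω' : ℕ → Bool} {k : ℕ} (hag : ∀ i < k, ω i = ω' i) (hne : ω k ≠ ω' k) :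
    c / β ^ ((List.range k).flatMap fun i => g (ω i)).length ≤
      |val β (flat fun k => g (ω k)) - val β (flat fun k => g (ω' k))| := by
  rw [flat_eq_cat (f := fun k => g (ω k)) (fun k => hg _) k,
    flat_eq_cat (f := fun k => g (ω' k)) (fun k => hg _) k]
  have : ((List.range k).flatMap fun i => g (ω' i)) = (List.range k).flatMap fun i => g (ω i) := by
    apply List.flatMap_congr
    intro i hi
    rw [hag i (List.mem_range.1 hi)]
  rw [this, val_cat_sub hβ, abs_div, abs_of_pos (show 0 < β ^ _ by positivity)]
  gcongr
  cases h1 : ω k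
  · apply hc (fun i => ω (i + k)) (fun i => ω' (i + k))
    · simpa using h1
    · rw [h1] at hne
      simpa using hne.symm
  · rw [abs_sub_comm]
    apply hc (fun i => ω' (i + k)) (fun i => ω (i + k))
    · rw [h1] at hne
      simpa using hne.symm
    · simpa using h1

theorem length_flatMap_le {g : Bool → List Bool} {M : ℕ} (hM : ∀ b, (g b).length ≤ M)
    (ω : ℕ → Bool) (k : ℕ) : ((List.range k).flatMap fun i => g (ω i)).length ≤ k * M := by
  induction k with
  | zero => simp
  | succ k ih =>
    rw [flatMap_range_succ_right, List.length_append, add_mul]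
    have := hM (ω k)
    omega

/-- A set that is coded by binary sequences, with separated blocks, has positive dimension. -/
theorem dimH_range_flat_pos (hβ : 1 < β) {g : Bool → List Bool} (hg : ∀ b, g b ≠ []) {c : ℝ}
    (hc0 : 0 < c) (hc : ∀ ω ω' : ℕ → Bool, ω 0 = false → ω' 0 = true →
      c ≤ |val β (flat fun k => g (ω k)) - val β (flat fun k => g (ω' k))|) (w : List Bool) :
    0 < dimH (Set.range fun ω : ℕ → Bool => val β (cat w (flat fun k => g (ω k)))) := by
  set M := max (g false).length (g true).length with hM
  have hMb : ∀ b, (g b).length ≤ M := by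
    intro b; cases b
    · exact le_max_left _ _
    · exact le_max_right _ _
  have hM0 : 0 < M := (List.length_pos_iff.2 (hg false)).trans_le (hMb false)
  have hlog : 0 < Real.log β := Real.log_pos hβ
  have hβ0 : 0 < β := by linarith
  -- Chosen so that `β^(-kM)`, the gap scale after `k` blocks of length at most `M`, becomes
  -- `2^(-k)`, the size of a binary cylinder.
  set r : ℝ≥0 := ⟨Real.log 2 / (M * Real.log β), by positivity⟩ with hr
  have hrr : (r : ℝ) = Real.log 2 / (M * Real.log β) := rfl
  have hr0 : 0 < r := by
    rw [← NNReal.coe_pos, hrr]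
    have := Real.log_pos one_lt_two
    positivity
  have hβr : ∀ k : ℕ, ((β ^ (k * M))⁻¹ : ℝ) ^ (r : ℝ) = ((2 : ℝ) ^ k)⁻¹ := by
    intro k
    rw [Real.inv_rpow (by positivity), ← Real.rpow_natCast, ← Real.rpow_mul hβ0.le]
    congr 1
    rw [Real.rpow_def_of_pos hβ0, ← Real.rpow_natCast, Real.rpow_def_of_pos two_pos]
    congr 1
    rw [hrr]
    push_cast
    field_simp
  set B := valBound 2 with hB
  have hB0 : 0 ≤ B := valBound_nonneg one_lt_two
  set c' : ℝ := c / β ^ w.length with hc'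
  have hc'0 : 0 < c' := by positivity
  set C : ℝ≥0 := ⟨B / c' ^ (r : ℝ), by positivity⟩ with hC
  have hCC : (C : ℝ) = B / c' ^ (r : ℝ) := rfl
  have key : dimH (Set.range fun ω : ℕ → Bool => val 2 ω) ≤
      dimH (Set.range fun ω : ℕ → Bool => val β (cat w (flat fun k => g (ω k)))) / r := by
    apply dimH_range_le (C := C) hr0
    intro ω ω'
    by_cases hne : ω = ω'
    · subst hne
      simp
      positivity
    obtain ⟨k, hag, hk⟩ := exists_first_diff hne
    have h1 := flat_gap hβ hg hc hag hk
    have h2 : c' * (β ^ (k * M))⁻¹ ≤ |val β (cat w (flat fun k => g (ω k))) -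
        val β (cat w (flat fun k => g (ω' k)))| := by
      rw [val_cat_sub hβ, abs_div, abs_of_pos (show 0 < β ^ w.length by positivity), hc',
        ← div_eq_mul_inv, div_right_comm]
      gcongr
      refine le_trans ?_ h1
      gcongr
      · exact hβ.le
      · exact length_flatMap_le hMb ω k
    have h3 : |val 2 ω - val 2 ω'| ≤ B * ((2 : ℝ) ^ k)⁻¹ := by
      rw [val_sub one_lt_two hag, abs_div, abs_of_pos (show (0 : ℝ) < 2 ^ k by positivity),
        div_eq_mul_inv]
      gcongr
      have a1 := val_nonneg one_lt_two (shift k ω)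
      have a2 := val_nonneg one_lt_two (shift k ω')
      have a3 := val_le_valBound one_lt_two (shift k ω)
      have a4 := val_le_valBound one_lt_two (shift k ω')
      rw [abs_le]
      constructor <;> linarith
    refine h3.trans ?_
    rw [hCC, ← hβr]
    have h4 : (c' * (β ^ (k * M))⁻¹) ^ (r : ℝ) ≤ |val β (cat w (flat fun k => g (ω k))) -
        val β (cat w (flat fun k => g (ω' k)))| ^ (r : ℝ) := by
      gcongr
    rw [Real.mul_rpow hc'0.le (by positivity)] at h4
    have h5 : 0 < c' ^ (r : ℝ) := by positivity
    rw [div_mul_eq_mul_div, le_div_iff₀ h5, mul_assoc]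
    rw [mul_comm] at h4
    gcongr
  have h1 : (1 : ℝ≥0∞) ≤ dimH (Set.range fun ω : ℕ → Bool => val 2 ω) := by
    have hsub : Set.Icc (0 : ℝ) 1 ⊆ Set.range fun ω : ℕ → Bool => val 2 ω := by
      intro x hx
      exact ⟨greedyDigits 2 x, (isGreedy_greedyDigits one_lt_two le_rfl hx.1 hx.2).1⟩
    have h2 : dimH (Set.Icc (0 : ℝ) 1) = 1 := by
      rw [Real.dimH_of_nonempty_interior (E := ℝ)]
      · simp
      · rw [interior_Icc]; exact ⟨1 / 2, by norm_num, by norm_num⟩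
    rw [← h2]
    exact dimH_mono hsub
  by_contra hcon
  have hz := nonpos_iff_eq_zero.1 (not_lt.1 hcon)
  rw [hz, ENNReal.zero_div] at key
  exact absurd (h1.trans key) (by simp)

/-! ### The family of points -/

/-- All suffixes of `w`, however extended, are smaller than `α(β)`. -/
def SuffixBelow (β : ℝ) (w : List Bool) : Prop :=
  ∀ x q, w = x ++ q → q ≠ [] → ∀ z, cat q z ≺ alpha β

theorem SuffixBelow.append {u w : List Bool} (hu : SuffixBelow β u) (hw : SuffixBelow β w) :
    SuffixBelow β (u ++ w) := by
  intro x q hxq hq z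
  rcases List.append_eq_append_iff.1 hxq with ⟨a, rfl, hw'⟩ | ⟨c, hu', rfl⟩
  · exact hw a q hw' hq z
  · by_cases hc : c = []
    · subst hc
      exact hw [] w rfl (by simpa using hq) z
    · rw [cat_append]
      exact hu x c hu' hc _

theorem SuffixBelow.of_append {u w : List Bool} (h : SuffixBelow β (u ++ w)) : SuffixBelow β w :=
  fun x q hxq hq z => h (u ++ x) q (by rw [hxq, List.append_assoc]) hq z

theorem SuffixBelow.admissible_cat {w : List Bool} (hw : SuffixBelow β w) {z : ℕ → Bool}
    (hz : Admissible β z) : Admissible β (cat w z) := by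
  intro i
  by_cases h : i < w.length
  · rw [shift_cat h.le]
    exact hw (w.take i) (w.drop i) (List.take_append_drop _ _).symm (by simpa using h) z
  · obtain ⟨l, rfl⟩ := Nat.exists_eq_add_of_le (not_lt.1 h)
    rw [shift_cat_add]
    exact hz l

theorem admissible_flat {f : ℕ → List Bool} (hf : ∀ k, f k ≠ []) (h : ∀ k, SuffixBelow β (f k)) :
    Admissible β (flat f) := by
  intro i
  obtain ⟨k, l, hl, hs⟩ := shift_flat hf i
  rw [hs]
  exact h k ((f k).take l) _ (List.take_append_drop _ _).symm (by simpa using hl) _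

theorem SuffixBelow.admissible_per {w : List Bool} (hw : SuffixBelow β w) (h0 : w ≠ []) :
    Admissible β (per w) := by
  rw [per_eq_flat h0]
  exact admissible_flat (fun _ => h0) fun _ => hw

/-- The inequality is decided at a finite index, up to which `A^N x` and `A^∞` agree for large `N`,
whatever `x` is. -/
theorem eventually_cat_lt {P A : List Bool} (hA : A ≠ []) {z : ℕ → Bool}
    (h : cat P (per A) ≺ z) :
    ∀ᶠ N in Filter.atTop, ∀ x, cat P (cat (List.replicate N A).flatten x) ≺ z := by
  obtain ⟨k, hag, h0, h1⟩ := slt_iff.1 h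
  filter_upwards [Filter.eventually_ge_atTop (k + 1)] with N hN x
  have hl : N ≤ (List.replicate N A).flatten.length := by
    rw [List.length_flatten, List.map_replicate, List.sum_replicate]
    exact Nat.le_mul_of_pos_right _ (List.length_pos_iff.2 hA)
  refine slt_of_agree (R := k + 1) h ⟨k, by omega, by simp [h0, h1]⟩ ?_ (fun _ _ => rfl)
  intro i hi
  rw [← cat_replicate_per A hA N, ← cat_append, ← cat_append, cat_apply_lt, cat_apply_lt] <;>
  · simp only [List.length_append]; omega

/-- The data used to construct points of the bifurcation set: `A = A₀0` and `V` are such that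
`V A^∞` is smaller than all sequences `q A^∞` with a proper suffix `q` of `A` or of `V`. -/
structure BlockData (β : ℝ) (A₀ V : List Bool) : Prop where
  below : SuffixBelow β (A₀ ++ [false])
  below' : SuffixBelow β (A₀ ++ [true] ++ V ++ (A₀ ++ [false]))
  lt : WordLT V (A₀ ++ [false])
  suffix : ∀ x q, A₀ ++ [false] = x ++ q → x ≠ [] → q ≠ [] →
    cat V (per (A₀ ++ [false])) ≺ cat q (per (A₀ ++ [false]))
  suffix' : ∀ x q, V = x ++ q → x ≠ [] → q ≠ [] →
    cat V (per (A₀ ++ [false])) ≺ cat q (per (A₀ ++ [false]))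

/-- The two blocks. -/
def block (A₀ V : List Bool) : Bool → List Bool
  | false => A₀ ++ [true] ++ V ++ (A₀ ++ [false])
  | true => A₀ ++ [true] ++ V ++ (A₀ ++ [false]) ++ (A₀ ++ [false])

/-- The coded tails. -/
def tailSeq (A₀ V : List Bool) (ω : ℕ → Bool) : ℕ → Bool := flat fun k => block A₀ V (ω k)

/-- The sequence `V A^(N+1)` followed by the coded tail. -/
def familySeq (A₀ V : List Bool) (N : ℕ) (ω : ℕ → Bool) : ℕ → Bool :=
  cat (V ++ (A₀ ++ [false]))
    (cat (List.replicate N (A₀ ++ [false])).flatten (tailSeq A₀ V ω))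

theorem block_ne_nil (A₀ V : List Bool) (b : Bool) : block A₀ V b ≠ [] := by
  cases b <;> simp [block]

theorem wordLT_block (A₀ V : List Bool) (b : Bool) : WordLT (A₀ ++ [false]) (block A₀ V b) := by
  have h := (wordLT_snoc A₀).append_right (V ++ (A₀ ++ [false]))
  cases b
  · simpa [block] using h
  · simpa [block] using h.append_right (A₀ ++ [false])

theorem drop_length_add (u w : List Bool) (e : ℕ) : (u ++ w).drop (u.length + e) = w.drop e := by
  rw [← List.drop_drop, List.drop_left]

theorem per_le_tailSeq (A₀ V : List Bool) (ω : ℕ → Bool) :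
    per (A₀ ++ [false]) ≼ tailSeq A₀ V ω := by
  apply le_flat fun k => block_ne_nil _ _ _
  intro k
  conv_lhs => rw [per_eq (w := A₀ ++ [false]) (by simp)]
  exact (wordLT_block A₀ V (ω k) _ _).le

/-- Both blocks start with `D`, and what follows is at least `A^∞`, also after the extra `A`. -/
theorem cat_le_tailSeq (A₀ V : List Bool) (ω : ℕ → Bool) :
    cat (block A₀ V false) (per (A₀ ++ [false])) ≼ tailSeq A₀ V ω := by
  rw [tailSeq, flat_eq fun k => block_ne_nil _ _ _]
  have h := per_le_tailSeq A₀ V fun k => ω (k + 1)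
  cases hω : ω 0
  · exact (cat_le_cat _).2 h
  · simp only [block]
    rw [cat_append _ (A₀ ++ [false]) (flat _), cat_le_cat, per_eq (w := A₀ ++ [false]) (by simp),
      cat_le_cat]
    exact h

theorem tailSeq_le (A₀ V : List Bool) (ω : ℕ → Bool) : tailSeq A₀ V ω ≼ per (block A₀ V false) := by
  apply flat_le fun k => block_ne_nil _ _ _
  intro k
  have hp := per_eq (block_ne_nil A₀ V false)
  cases ω k
  · rw [← hp]
  · have e : block A₀ V true = block A₀ V false ++ (A₀ ++ [false]) := rfl
    conv_rhs => rw [hp]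
    rw [e, cat_append, cat_le_cat]
    conv_rhs => rw [hp]
    exact (wordLT_block A₀ V false _ _).le

/-! ### Points of the bifurcation set obtained from block data -/

namespace BlockData

variable {A₀ V : List Bool} (H : BlockData β A₀ V)

include H

theorem ne_nil : V ≠ [] := by
  intro hV
  have h := H.lt
  rw [hV] at h
  exact not_wordLT_nil_left h

theorem suffixBelow_block (b : Bool) : SuffixBelow β (block A₀ V b) := by
  cases b
  · exact H.below'
  · exact H.below'.append H.below

theorem admissible_tailSeq (ω : ℕ → Bool) : Admissible β (tailSeq A₀ V ω) :=
  admissible_flat (fun _ => block_ne_nil _ _ _) fun _ => H.suffixBelow_block _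

theorem suffixBelow_replicate (N : ℕ) :
    SuffixBelow β (List.replicate N (A₀ ++ [false])).flatten := by
  induction N with
  | zero =>
    intro x q h hq
    simp at h
    exact absurd h.2 hq
  | succ N ih =>
    rw [List.replicate_succ, List.flatten_cons]
    exact H.below.append ih

theorem suffixBelow_head : SuffixBelow β (V ++ (A₀ ++ [false])) := by
  have := H.below'
  rw [List.append_assoc (A₀ ++ [true])] at this
  exact this.of_append

theorem admissible_familySeq (N : ℕ) (ω : ℕ → Bool) : Admissible β (familySeq A₀ V N ω) :=
  H.suffixBelow_head.admissible_cat
    ((H.suffixBelow_replicate N).admissible_cat (H.admissible_tailSeq ω))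

omit H in
theorem per_le_replicate (N : ℕ) {y : ℕ → Bool} (h : per (A₀ ++ [false]) ≼ y) :
    per (A₀ ++ [false]) ≼ cat (List.replicate N (A₀ ++ [false])).flatten y := by
  rw [← cat_replicate_per (A₀ ++ [false]) (by simp) N]
  exact (cat_le_cat _).2 h

omit H in
theorem limit_le_familySeq (N : ℕ) (ω : ℕ → Bool) :
    cat V (per (A₀ ++ [false])) ≼ familySeq A₀ V N ω := by
  rw [per_eq (w := A₀ ++ [false]) (by simp), ← cat_append]
  exact (cat_le_cat _).2 (per_le_replicate N (per_le_tailSeq _ _ _))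

theorem dimH_pos (hβ : 1 < β) (hβ2 : β ≤ 2) (N : ℕ) :
    0 < dimH (Set.range fun ω => val β (familySeq A₀ V N ω)) := by
  set D := block A₀ V false with hD
  set A := A₀ ++ [false] with hA
  have hAD : WordLT A D := wordLT_block A₀ V false
  -- `l` bounds from below the tails beginning with the block `D` (the next block starts with `D`
  -- again), `u` bounds from above those beginning with `DA`. The gap between the two codes is the
  -- difference of their values.
  set l := cat D (cat D (per A)) with hl
  set u := cat D (cat A (per D)) with hu
  have hul : u ≺ l := (cat_lt_cat _).2 (hAD _ _)
  have hDn : D ≠ [] := block_ne_nil _ _ _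
  have hSD : SuffixBelow β D := H.suffixBelow_block false
  have hladm : Admissible β l :=
    hSD.admissible_cat (hSD.admissible_cat (H.below.admissible_per (by simp)))
  have huadm : Admissible β u :=
    hSD.admissible_cat (H.below.admissible_cat (hSD.admissible_per hDn))
  have := dimH_range_flat_pos hβ (g := block A₀ V) (block_ne_nil A₀ V) (c := val β l - val β u)
    (sub_pos.2 (huadm.val_lt_val hβ hβ2 hul)) ?_
    (V ++ (A₀ ++ [false]) ++ (List.replicate N (A₀ ++ [false])).flatten)
  · simpa only [familySeq, tailSeq, cat_append] using this
  · intro ω ω' h0 h1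
    have e1 : l ≼ tailSeq A₀ V ω := by
      rw [tailSeq, flat_eq fun k => block_ne_nil _ _ _, h0]
      exact (cat_le_cat _).2 (cat_le_tailSeq _ _ _)
    have e2 : tailSeq A₀ V ω' ≼ u := by
      rw [tailSeq, flat_eq fun k => block_ne_nil _ _ _, h1]
      simp only [block]
      rw [cat_append _ (A₀ ++ [false])]
      exact (cat_le_cat _).2 ((cat_le_cat _).2 (tailSeq_le _ _ _))
    have e3 := hladm.val_le_val hβ hβ2 e1
    have e4 := (H.admissible_tailSeq ω').val_le_val hβ hβ2 e2
    refine le_trans ?_ (le_abs_self _)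
    change _ ≤ val β (tailSeq A₀ V ω) - val β (tailSeq A₀ V ω')
    linarith

/-- Each shift of `d = V A^(N+1) B₁B₂…` starts with a suffix of `A`, `A₀1` or `V` followed by
something at least `A^∞`, or with a full `V` from some block. Since `d` tends to `V A^∞` uniformly
in `ω`, finitely many strict inequalities for `V A^∞` suffice. -/
theorem eventually_le_shift :
    ∀ᶠ N in Filter.atTop, ∀ ω i, familySeq A₀ V N ω ≼ shift i (familySeq A₀ V N ω) := by
  set A := A₀ ++ [false] with hA
  have hAn : A ≠ [] := by simp [hA]
  set D := block A₀ V false with hD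
  -- Inside the blocks, `V` is followed by at most two copies of `A` before the next `D`. So `z₀` is
  -- below every shift that starts at such a `V`, and it exceeds `V A^∞` because `A < D`.
  set z₀ := cat V (cat A (cat A (cat D (per A)))) with hz₀
  have hAD : WordLT A D := wordLT_block A₀ V false
  have hlim : cat (V ++ A) (per A) = cat V (per A) := by rw [cat_append, ← per_eq hAn]
  have hz : cat V (per A) ≺ z₀ := by
    rw [cat_lt_cat]
    conv_lhs => rw [per_eq hAn, per_eq hAn, per_eq hAn]
    rw [cat_lt_cat, cat_lt_cat]
    exact hAD _ _
  have E1 : ∀ l ∈ Finset.range A.length, ∀ᶠ N in Filter.atTop, ∀ x, 0 < l →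
      cat (V ++ A) (cat (List.replicate N A).flatten x) ≺ cat (A.drop l) (per A) := by
    intro l hl
    have hl' := Finset.mem_range.1 hl
    by_cases h0 : 0 < l
    · have := eventually_cat_lt (P := V ++ A) hAn (z := cat (A.drop l) (per A)) (by
        rw [hlim]
        exact H.suffix (A.take l) (A.drop l) (List.take_append_drop _ _).symm
          (by simp [hAn]; omega) (by simpa using hl'))
      filter_upwards [this] with N hN x _ using hN x
    · exact Filter.Eventually.of_forall fun N x h => absurd h h0
  have E2 : ∀ l ∈ Finset.range V.length, ∀ᶠ N in Filter.atTop, ∀ x, 0 < l →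
      cat (V ++ A) (cat (List.replicate N A).flatten x) ≺ cat (V.drop l) (per A) := by
    intro l hl
    have hl' := Finset.mem_range.1 hl
    by_cases h0 : 0 < l
    · have := eventually_cat_lt (P := V ++ A) hAn (z := cat (V.drop l) (per A)) (by
        rw [hlim]
        exact H.suffix' (V.take l) (V.drop l) (List.take_append_drop _ _).symm
          (by simp [H.ne_nil]; omega) (by simpa using hl'))
      filter_upwards [this] with N hN x _ using hN x
    · exact Filter.Eventually.of_forall fun N x h => absurd h h0
  have E3 := eventually_cat_lt (P := V ++ A) hAn (z := z₀) (by rw [hlim]; exact hz)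
  filter_upwards [(Filter.eventually_all_finset _).2 E1, (Filter.eventually_all_finset _).2 E2, E3]
    with N N1 N2 N3 ω i
  set d := familySeq A₀ V N ω with hd
  have M1 : ∀ l < A.length, 0 < l → d ≺ cat (A.drop l) (per A) := fun l hl h0 =>
    N1 l (Finset.mem_range.2 hl) _ h0
  have M2 : ∀ l < V.length, 0 < l → d ≺ cat (V.drop l) (per A) := fun l hl h0 =>
    N2 l (Finset.mem_range.2 hl) _ h0
  have M3 : d ≺ z₀ := N3 _
  have hVA : ∀ z, d ≺ cat A z := fun z => by
    rw [hd, familySeq, cat_append]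
    exact H.lt _ _
  have K1 : ∀ l < A.length, ∀ y, per A ≼ y → d ≼ cat (A.drop l) y := by
    intro l hl y hy
    rcases Nat.eq_zero_or_pos l with rfl | h0
    · exact (hVA y).le
    · exact (M1 l hl h0).le.trans ((cat_le_cat _).2 hy)
  have K2 : ∀ l < V.length, 0 < l → ∀ y, per A ≼ y → d ≼ cat (V.drop l) y :=
    fun l hl h0 y hy => (M2 l hl h0).le.trans ((cat_le_cat _).2 hy)
  have K3 : ∀ l < (A₀ ++ [true]).length, ∀ y, d ≼ cat ((A₀ ++ [true]).drop l) y := by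
    intro l hl y
    have hl' : l ≤ A₀.length := by simp at hl; omega
    have h1 := K1 l (by simp [hA]; omega) (per A) le_rfl
    refine h1.trans (le_of_lt ?_)
    rw [hA, List.drop_append_of_le_length hl', List.drop_append_of_le_length hl']
    exact wordLT_snoc _ _ _
  have K4 : ∀ y, cat D (per A) ≼ y → d ≼ cat V (cat A y) := by
    intro y hy
    refine M3.le.trans ?_
    rw [cat_le_cat, cat_le_cat]
    exact (hAD _ _).le.trans hy
  have K5 : ∀ y, cat D (per A) ≼ y → d ≼ cat V (cat A (cat A y)) := by
    intro y hy
    refine M3.le.trans ?_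
    rw [cat_le_cat, cat_le_cat, cat_le_cat]
    exact hy
  have perD : ∀ y, cat D (per A) ≼ y → per A ≼ y := by
    intro y hy
    refine le_trans ?_ hy
    conv_lhs => rw [per_eq hAn]
    exact (hAD _ _).le
  have perA : ∀ y, per A ≼ y → per A ≼ cat A y := fun y hy => by
    conv_lhs => rw [per_eq hAn]
    exact (cat_le_cat _).2 hy
  have KD : ∀ l < D.length, ∀ y, per A ≼ y → d ≼ cat V (cat A y) → d ≼ cat (D.drop l) y := by
    intro l hl y hy hy2
    have hD' : D = (A₀ ++ [true]) ++ (V ++ A) := by simp [hD, block, hA]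
    rw [hD'] at hl ⊢
    rcases lt_or_ge l (A₀ ++ [true]).length with h1 | h1
    · rw [List.drop_append_of_le_length h1.le, cat_append]
      exact K3 l h1 _
    · obtain ⟨e, rfl⟩ := Nat.exists_eq_add_of_le h1
      rw [drop_length_add]
      rw [List.length_append (bs := V ++ A)] at hl
      replace hl : e < (V ++ A).length := by omega
      rcases lt_or_ge e V.length with h2 | h2
      · rw [List.drop_append_of_le_length h2.le, cat_append]
        rcases Nat.eq_zero_or_pos e with rfl | h0
        · simpa using hy2
        · exact K2 e h2 h0 _ (perA y hy)
      · obtain ⟨f, rfl⟩ := Nat.exists_eq_add_of_le h2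
        rw [drop_length_add]
        rw [List.length_append] at hl
        exact K1 f (by omega) y hy
  have KT : ∀ i, d ≼ shift i (tailSeq A₀ V ω) := by
    intro i
    obtain ⟨k, l, hl, hs⟩ := shift_flat (f := fun k => block A₀ V (ω k))
      (fun _ => block_ne_nil _ _ _) i
    rw [tailSeq, hs]
    have hy := cat_le_tailSeq A₀ V fun e => ω (e + (k + 1))
    change d ≼ cat _ (tailSeq A₀ V fun e => ω (e + (k + 1)))
    generalize tailSeq A₀ V (fun e => ω (e + (k + 1))) = y at hy
    have hp := perD y hy
    cases hω : ω k <;> rw [hω] at hl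
    · exact KD l hl y hp (K4 y hy)
    · have hb : block A₀ V true = D ++ A := rfl
      rw [hb] at hl ⊢
      rcases lt_or_ge l D.length with h1 | h1
      · rw [List.drop_append_of_le_length h1.le, cat_append]
        exact KD l h1 _ (perA y hp) (K5 y hy)
      · obtain ⟨e, rfl⟩ := Nat.exists_eq_add_of_le h1
        rw [drop_length_add]
        rw [List.length_append] at hl
        exact K1 e (by omega) y hp
  have KR : ∀ n i, d ≼ shift i (cat (List.replicate n A).flatten (tailSeq A₀ V ω)) := by
    intro n
    induction n with
    | zero => intro i; simpa using KT i
    | succ n ih =>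
      intro i
      rw [List.replicate_succ, List.flatten_cons, cat_append]
      rcases lt_or_ge i A.length with h1 | h1
      · rw [shift_cat h1.le]
        exact K1 i h1 _ (per_le_replicate n (per_le_tailSeq _ _ _))
      · obtain ⟨e, rfl⟩ := Nat.exists_eq_add_of_le h1
        rw [shift_cat_add]
        exact ih e
  rcases lt_or_ge i V.length with h1 | h1
  · rcases Nat.eq_zero_or_pos i with rfl | h0
    · rw [shift_zero]
    · have := K2 i h1 h0 (cat A (cat (List.replicate N A).flatten (tailSeq A₀ V ω)))
        (perA _ (per_le_replicate N (per_le_tailSeq _ _ _)))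
      rw [← shift_cat h1.le, ← cat_append] at this
      exact this
  · obtain ⟨e, rfl⟩ := Nat.exists_eq_add_of_le h1
    have h2 : shift (V.length + e) d =
        shift e (cat (List.replicate (N + 1) A).flatten (tailSeq A₀ V ω)) := by
      rw [hd, familySeq, cat_append V, shift_cat_add, List.replicate_succ, List.flatten_cons,
        cat_append A]
    rw [h2]
    exact KR (N + 1) e

end BlockData

end

section

/-! ### Block data from the positions of the construction -/

variable {β : ℝ} {S : List Bool}

theorem eq_cat_prefix (a : ℕ → Bool) (n : ℕ) : a = cat (subword a 0 n) (shift n a) := by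
  conv_lhs => rw [← shift_zero a, ← cat_subword _ 0 n]
  simp

theorem snoc_subword_eq_append {a : ℕ → Bool} {s L : ℕ} {c : Bool} {x q : List Bool}
    (h : subword a s L ++ [c] = x ++ q) (hq : q ≠ []) :
    x.length ≤ L ∧ q = subword a (s + x.length) (L - x.length) ++ [c] ∧
      x = subword a s x.length := by
  have hlen := congrArg List.length h
  have hq0 := List.length_pos_iff.2 hq
  simp only [List.length_append, length_subword, List.length_singleton] at hlen
  have hL : x.length ≤ L := by omega
  have e : subword a s L = subword a s x.length ++ subword a (s + x.length) (L - x.length) := by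
    rw [← subword_add, Nat.add_sub_cancel' hL]
  rw [e, List.append_assoc] at h
  obtain ⟨h1, h2⟩ := List.append_inj h (by simp)
  exact ⟨hL, h2.symm, h1.symm⟩

theorem subword_succ (a : ℕ → Bool) (s L : ℕ) : subword a s (L + 1) = subword a s L ++ [a (s + L)] := by
  rw [subword_add, subword_one]

theorem minus_subword {a : ℕ → Bool} {s L : ℕ} (hL : 1 ≤ L) :
    minus (subword a s L) = subword a s (L - 1) ++ [false] := by
  obtain ⟨l, rfl⟩ := Nat.exists_eq_add_of_le' hL
  rw [subword_succ, minus_snoc, Nat.add_sub_cancel]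

theorem subword_eq_snoc {a : ℕ → Bool} {s L : ℕ} (hL : 1 ≤ L) (h : a (s + (L - 1)) = true) :
    subword a s L = subword a s (L - 1) ++ [true] := by
  conv_lhs => rw [← Nat.sub_add_cancel hL, subword_succ, h]

namespace BaseData

variable (H : BaseData β S)

include H

theorem ne_nil : S ≠ [] := by
  rintro rfl
  simpa using H.two_le

theorem subword_start :
    subword (baseSeq β) 0 (S.length - 1) ++ [false] = maxRot S ∧
      subword (baseSeq β) 0 S.length = plus (maxRot S) := by
  obtain ⟨A, hA⟩ := maxRot_snoc H.lyndon H.two_le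
  rw [← List.cons_append] at hA
  have hlen : (plus (maxRot S)).length = S.length := by
    rw [← length_maxRot S, hA, plus_snoc]; simp
  have h1 : subword (baseSeq β) 0 S.length = plus (maxRot S) := by
    conv_lhs => rw [H.start, ← hlen]
    exact subword_cat_length _ _
  refine ⟨?_, h1⟩
  have h2 := h1
  rw [← Nat.sub_add_cancel (show 1 ≤ S.length by have := H.two_le; omega), subword_succ, hA,
    plus_snoc] at h2
  rw [(List.append_inj' h2 rfl).1, hA]

theorem base_zero : baseSeq β 0 = true := by
  obtain ⟨A, hA⟩ := maxRot_snoc H.lyndon H.two_le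
  rw [← List.cons_append] at hA
  rw [H.start, hA, plus_snoc]
  simp [cat]

theorem base_pred : baseSeq β (S.length - 1) = true := by
  obtain ⟨A, hA⟩ := maxRot_snoc H.lyndon H.two_le
  rw [← List.cons_append] at hA
  have h2 := H.subword_start.2
  rw [← Nat.sub_add_cancel (show 1 ≤ S.length by have := H.two_le; omega), subword_succ, hA,
    plus_snoc] at h2
  simpa using (List.append_inj' h2 rfl).2

theorem base_length : baseSeq β S.length = false := by
  obtain ⟨x, hx⟩ := H.lyndon.exists_eq H.two_le
  have h := cons_apply_zero_of_le H.upper.le (by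
    rw [hx, ← List.cons_append, minus_snoc]; simp [cat])
  simpa [shift_apply] using h

theorem minus_lt_per (z : ℕ → Bool) : cat (minus S) z ≺ per S := by
  rw [per_eq H.ne_nil]
  exact H.lyndon.minus_lt H.two_le _ _

theorem shift_base_lt : shift S.length (baseSeq β) ≺ per S := H.upper.trans (H.minus_lt_per _)

theorem per_le_shift (i : ℕ) : per S ≼ shift i (per (maxRot S)) := by
  obtain ⟨k, hk⟩ := exists_shift_eq_per_maxRot H.ne_nil
  rw [hk, shift_shift]
  exact (H.lyndon.isLyndon H.ne_nil).per_le_shift _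

theorem position_facts {j : ℕ} (hj : IsPosition (baseSeq β) S j) :
    S.length ≤ j ∧ baseSeq β (j - 1) = true ∧ baseSeq β j = false ∧
      shift j (baseSeq β) ≼ shift S.length (baseSeq β) ∧
      ∀ g, S.length ≤ g → g < j → ∃ j' n', IsPosition (baseSeq β) S j' ∧
        IsNextLength (baseSeq β) j' n' ∧ j' ≤ g ∧ g < j' + n' ∧ j' + n' ≤ j ∧
        shift j (baseSeq β) ≼ shift j' (baseSeq β) :=
  hj.facts (by have := H.two_le; omega) H.base_pred H.base_length

/-- `A` and `A₀1V` are prefixes of `a` with the last digit lowered. Their proper suffixes are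
lowered factors of `a`. The full `A₀1V` may be a period of `α(β)`, and then the following `A`
decides. -/
theorem suffixBelow {j n : ℕ} (hj : IsPosition (baseSeq β) S j)
    (hn : IsNextLength (baseSeq β) j n) :
    SuffixBelow β (subword (baseSeq β) 0 (j - 1) ++ [false]) ∧
      SuffixBelow β (subword (baseSeq β) 0 (j - 1) ++ [true] ++
        (subword (baseSeq β) j (n - 1) ++ [false]) ++
        (subword (baseSeq β) 0 (j - 1) ++ [false])) := by
  obtain ⟨p1, p2, p3, p4, p5⟩ := H.position_facts hj
  obtain ⟨f1, f2, f3, f4, f5⟩ := hn.facts p3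
  have hm2 := H.two_le
  have hβ := H.one_lt
  have hβ2 := H.lt_two
  have hsa := fun {e i : ℕ} (he : baseSeq β e = true) (hi : 1 ≤ i) (hie : i ≤ e) =>
    suffix_lt_alpha hβ hβ2 he hi hie
  have hpl := fun {e e' : ℕ} (he : baseSeq β e = true) (he' : baseSeq β e' = true) (h : e < e') =>
    lowered_prefix_lt hβ hβ2 he he' h
  have hpa := fun {e e' : ℕ} (he : baseSeq β e = true) (he' : baseSeq β e' = true) (h : e < e') =>
    lowered_prefix_append_lt hβ hβ2 he he' h
  generalize baseSeq β = a at *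
  set A := subword a 0 (j - 1) ++ [false] with hA
  set V := subword a j (n - 1) ++ [false] with hV
  have hAn : A ≠ [] := by simp [hA]
  have f2' : a (j + n - 1) = true := by rwa [show j + n - 1 = j + (n - 1) by omega]
  have hAt : subword a 0 j = subword a 0 (j - 1) ++ [true] := subword_eq_snoc (by omega) (by
    simpa using p2)
  have below : SuffixBelow β A := by
    intro x q hxq hq z
    obtain ⟨h1, h2, h3⟩ := snoc_subword_eq_append hxq hq
    rw [h2, zero_add]
    rcases Nat.eq_zero_or_pos x.length with hx | hx
    · rw [hx]
      exact slt_of_wordLT_subword (hpl p2 f2' (by omega)) z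
    · exact slt_of_wordLT_subword (hsa p2 hx h1) z
  refine ⟨below, ?_⟩
  have hB : subword a 0 (j - 1) ++ [true] ++ V = subword a 0 (j + n - 1) ++ [false] := by
    rw [← hAt, hV, ← List.append_assoc, show j + n - 1 = j + (n - 1) by omega, subword_add, zero_add]
  rw [hB]
  intro x q hxq hq z
  rcases List.append_eq_append_iff.1 hxq with ⟨y, rfl, hw'⟩ | ⟨c, hu', rfl⟩
  · exact below y q hw' hq z
  · by_cases hc : c = []
    · subst hc
      exact below [] A rfl hAn z
    · obtain ⟨h1, h2, h3⟩ := snoc_subword_eq_append hu' hc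
      rw [cat_append, h2, zero_add]
      rcases Nat.eq_zero_or_pos x.length with hx | hx
      · rw [hx]
        exact hpa p2 f2' (by omega) z
      · exact slt_of_wordLT_subword (hsa f2' hx h1) _

/-- The hypothesis `hlow` is what maximality of a window provides; at the first position it is void.
-/
theorem blockData {j n : ℕ} (hj : IsPosition (baseSeq β) S j) (hn : IsNextLength (baseSeq β) j n)
    (hlow : ∀ j' n', IsPosition (baseSeq β) S j' → IsNextLength (baseSeq β) j' n' → j' < j →
      shift j (baseSeq β) ≼ shift j' (baseSeq β) →
      cat (subword (baseSeq β) j (n - 1) ++ [false])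
        (per (subword (baseSeq β) 0 (j - 1) ++ [false])) ≼
      cat (subword (baseSeq β) j' (n' - 1) ++ [false])
        (per (subword (baseSeq β) 0 (j' - 1) ++ [false]))) :
    BlockData β (subword (baseSeq β) 0 (j - 1)) (subword (baseSeq β) j (n - 1) ++ [false]) := by
  obtain ⟨p1, p2, p3, p4, p5⟩ := H.position_facts hj
  obtain ⟨f1, f2, f3, f4, f5⟩ := hn.facts p3
  have hbelow := H.suffixBelow hj hn
  have hgt := hn.lt_shift
  have hm2 := H.two_le
  have hβ := H.one_lt
  have hβ2 := H.lt_two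
  have hsub := H.subword_start
  have hup := H.shift_base_lt
  have hps := H.per_le_shift
  have hpos := fun {j : ℕ} (h : IsPosition (baseSeq β) S j) => H.position_facts h
  have h0 := H.base_zero
  have hle := shift_baseSeq_le hβ hβ2
  have hsl := fun {e i : ℕ} (he : baseSeq β e = true) (hie : i ≤ e) =>
    suffix_lt_baseSeq hβ hβ2 he hie
  generalize baseSeq β = a at *
  set A := subword a 0 (j - 1) ++ [false] with hA
  set V := subword a j (n - 1) ++ [false] with hV
  have hAn : A ≠ [] := by simp [hA]
  have f2' : a (j + n - 1) = true := by rwa [show j + n - 1 = j + (n - 1) by omega]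
  have hv : subword a j n = subword a j (n - 1) ++ [true] := subword_eq_snoc (by omega) f2
  have hAt : subword a 0 j = subword a 0 (j - 1) ++ [true] := subword_eq_snoc (by omega) (by
    simpa using p2)
  have hd : cat V (per A) ≺ shift j a := by
    rw [← cat_subword a j n, hv]
    exact wordLT_snoc _ _ _
  -- prefixes of `a` of length less than `j` are prefixes of `A`
  have hApre : ∀ l, l ≤ j - 1 → ∃ w, A = subword a 0 l ++ w := by
    intro l hl
    refine ⟨subword a l (j - 1 - l) ++ [false], ?_⟩
    rw [hA, ← List.append_assoc]
    congr 1
    conv_lhs => rw [← Nat.add_sub_cancel' hl, subword_add, zero_add]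
  have suffix : ∀ x q, A = x ++ q → x ≠ [] → q ≠ [] → cat V (per A) ≺ cat q (per A) := by
    intro x q hxq hx hq
    obtain ⟨h1, h2, h3⟩ := snoc_subword_eq_append hxq hq
    have hx0 := List.length_pos_iff.2 hx
    rw [zero_add] at h2
    set g := x.length with hg
    -- A suffix that begins among the first `|S|` digits satisfies `q A^∞ ≽ S^∞ ≻ σ^|S| a ≽ σ^j a ≻
    -- V A^∞`. Otherwise it begins in an earlier word `v'` at `j'`.
    rcases lt_or_ge g S.length with hgm | hgm
    · have hq2 : per S ≼ cat q (per A) := by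
        refine (hps g).trans ?_
        rw [per_eq (w := maxRot S) (by rw [← hsub.1]; simp), shift_cat (by simp; omega)]
        rcases eq_or_lt_of_le p1 with hjm | hjm
        · have hAm : maxRot S = A := by rw [← hsub.1, hA, hjm]
          rw [hAm, hxq, hg, List.drop_left]
        · refine le_of_lt ?_
          have e1 : (maxRot S).drop g = subword a g (S.length - 1 - g) ++ [false] := by
            rw [← hsub.1, ← Nat.add_sub_cancel' (show g ≤ S.length - 1 by omega), subword_add,
              List.append_assoc, List.drop_append_of_le_length (by simp),
              List.drop_of_length_le (by simp), List.nil_append, zero_add,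
              Nat.add_sub_cancel' (show g ≤ S.length - 1 by omega)]
          have e2 : ∃ w, q = subword a g (S.length - 1 - g) ++ [true] ++ w := by
            refine ⟨subword a S.length (j - 1 - S.length) ++ [false], ?_⟩
            have e3 : a (S.length - 1) = true := by
              have := (hpos (IsPosition.first (a := a) (S := S))).2.1
              exact this
            have e4 : subword a g (S.length - g) = subword a g (S.length - 1 - g) ++ [true] := by
              rw [subword_eq_snoc (by omega), show S.length - g - 1 = S.length - 1 - g by omega]
              rw [show g + (S.length - g - 1) = S.length - 1 by omega, e3]
            have e5 : subword a g (j - 1 - g) =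
                subword a g (S.length - g) ++ subword a S.length (j - 1 - S.length) := by
              conv_lhs => rw [show j - 1 - g = (S.length - g) + (j - 1 - S.length) by omega,
                subword_add, show g + (S.length - g) = S.length by omega]
            rw [h2, e5, e4, List.append_assoc]
          obtain ⟨w, hw⟩ := e2
          rw [e1, hw]
          exact (wordLT_snoc _).append_right w _ _
      exact (hd.trans_le p4).trans (hup.trans_le hq2)
    · obtain ⟨j', n', c1, c2, c3, c4, c5, c6⟩ := p5 g hgm (by omega)
      obtain ⟨r1, r2, r3, r4, r5⟩ := hpos c1
      obtain ⟨t1, t2, t3, t4, t5⟩ := c2.facts r3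
      have hlow' := hlow j' n' c1 c2 (by omega) c6
      have hv' : subword a j' n' = subword a j' (n' - 1) ++ [true] := subword_eq_snoc (by omega) t2
      have hdj : cat V (per A) ≺ shift j' a := hd.trans_le c6
      -- If `v'` is the last word before `j`, its final digit is lowered in `A`, and `hlow` is
      -- needed. Otherwise `q` contains an unlowered suffix of `v'`.
      rcases eq_or_lt_of_le c5 with hend | hend
      · -- the last word before position `j`
        rcases eq_or_lt_of_le c3 with hjg | hjg
        · have e1 : q = subword a j' (n' - 1) ++ [false] := by
            rw [h2, ← hjg, show j - 1 - j' = n' - 1 by omega]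
          rw [e1]
          refine hlow'.trans_lt ?_
          refine (cat_lt_cat _).2 ?_
          apply per_le_per_of_wordLT (by simp) hAn
          obtain ⟨w, hw⟩ := hApre j' (by omega)
          rw [hw, subword_eq_snoc (s := 0) (L := j') (by omega) (by simpa using r2)]
          exact (wordLT_snoc _).append_right w
        · have e0 : subword a g (j' + n' - g) = subword a g (j - 1 - g) ++ [true] := by
            rw [subword_eq_snoc (by omega)]
            · rw [show j' + n' - g - 1 = j - 1 - g by omega]
            · rw [show g + (j' + n' - g - 1) = j' + (n' - 1) by omega, t2]
          have e1 := t3 (subword a j' (g - j')) (subword a g (j' + n' - g)) (by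
            conv_lhs => rw [show n' = (g - j') + (j' + n' - g) by omega, subword_add,
              show j' + (g - j') = g by omega]) (by simp [← List.length_eq_zero_iff]; omega)
            (by simp [← List.length_eq_zero_iff]; omega)
          have e2 : subword a j' n' =
              subword a j' (j - g) ++ subword a (j' + (j - g)) (n' - (j - g)) := by
            conv_lhs => rw [show n' = (j - g) + (n' - (j - g)) by omega, subword_add]
          rw [e2, e0] at e1
          have e3 := e1.of_append_left (by simp; omega)
          -- In the case of equality `q` is a prefix of `V'`, and the remainder of `V'` is a lowered
          -- factor of `a`, below a prefix of `A`.
          rcases eq_or_wordLT_of_snoc (by simp; omega) e3 with e4 | e4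
          · rw [← h2] at e4
            have e5 : subword a j' (n' - 1) ++ [false] =
                q ++ (subword a (j' + (j - g)) (n' - (j - g) - 1) ++ [false]) := by
              rw [← e4, ← List.append_assoc, ← subword_add]
              congr 2; omega
            refine hlow'.trans_lt ?_
            rw [e5, cat_append]
            refine (cat_lt_cat _).2 ?_
            have e6 := hsl (e := j - 1) (i := j' + (j - g)) p2 (by omega)
            rw [show j - 1 - (j' + (j - g)) = n' - (j - g) - 1 by omega] at e6
            obtain ⟨w, hw⟩ := hApre (n' - (j - g) - 1 + 1) (by omega)
            rw [per_eq hAn]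
            conv_rhs => rw [hw]
            exact e6.append_right w _ _
          · rw [← h2] at e4
            refine hdj.trans ?_
            rw [← cat_subword a j' (j - g)]
            exact e4 _ _
      · have e0 : ∃ w, q = subword a g (j' + n' - g) ++ w := by
          refine ⟨subword a (j' + n') (j - 1 - (j' + n')) ++ [false], ?_⟩
          rw [h2, ← List.append_assoc]
          congr 1
          conv_lhs => rw [show j - 1 - g = (j' + n' - g) + (j - 1 - (j' + n')) by omega, subword_add,
            show g + (j' + n' - g) = j' + n' by omega]
        obtain ⟨w, hw⟩ := e0
        rcases eq_or_lt_of_le c3 with hjg | hjg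
        · refine hlow'.trans_lt ?_
          rw [hw, ← hjg, show j' + n' - j' = n' by omega, hv']
          exact (wordLT_snoc _).append_right w _ _
        · have e1 := t3 (subword a j' (g - j')) (subword a g (j' + n' - g)) (by
            conv_lhs => rw [show n' = (g - j') + (j' + n' - g) by omega, subword_add,
              show j' + (g - j') = g by omega]) (by simp [← List.length_eq_zero_iff]; omega)
            (by simp [← List.length_eq_zero_iff]; omega)
          refine hdj.trans ?_
          rw [← cat_subword a j' n', hw]
          exact e1.append_right w _ _
  have hVA : WordLT V A := by
    have e1 : V = [false] ++ (subword a (j + 1) (n - 2) ++ [false]) := by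
      have e2 : subword a j (n - 1) = [false] ++ subword a (j + 1) (n - 2) := by
        rw [show n - 1 = 1 + (n - 2) by omega, subword_add, subword_one, p3]
      rw [hV, e2, List.append_assoc]
    obtain ⟨w, hw⟩ := hApre 1 (by omega)
    rw [e1, hw, subword_one, h0]
    exact wordLT_false_true.append _ _
  -- shifts of `V A^∞` are at most `A^∞`
  have shifts : ∀ k l, n - l = k → 1 ≤ l → l < n →
      cat (subword a (j + l) (n - 1 - l) ++ [false]) (per A) ≼ per A := by
    intro k
    induction k using Nat.strong_induction_on with
    | _ k ih =>
      intro l hk hl hln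
      have e1 := hsl (e := j + n - 1) (i := j + l) f2' (by omega)
      rw [show j + n - 1 - (j + l) = n - 1 - l by omega] at e1
      rcases lt_trichotomy (n - l) j with h1 | h1 | h1
      · obtain ⟨w, hw⟩ := hApre (n - 1 - l + 1) (by omega)
        conv_rhs => rw [per_eq hAn, hw]
        exact (e1.append_right w _ _).le
      · rw [show n - 1 - l + 1 = j by omega, hAt] at e1
        rcases eq_or_wordLT_of_snoc (by simp; omega) e1 with e2 | e2
        · rw [e2, ← hA, ← per_eq hAn]
        · conv_rhs => rw [per_eq hAn]
          exact (e2 _ _).le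
      · have e2 : subword a (j + l) (n - 1 - l) ++ [false] = subword a (j + l) j ++
            (subword a (j + (l + j)) (n - 1 - (l + j)) ++ [false]) := by
          rw [← List.append_assoc, show j + (l + j) = j + l + j by omega, ← subword_add]
          congr 2; omega
        have e3 := hle (j + l)
        rw [← cat_subword a (j + l) j] at e3
        conv at e3 => rhs; rw [eq_cat_prefix a j]
        rcases eq_or_wordLT (by simp) e3 with e4 | e4
        -- Agreement with the prefix of length `j` would give `σ^(l+2j) a ≼ σ^j a` with `l + j < n`,
        -- contradicting the minimality of `n`.
        · exfalso
          rw [e4, cat_le_cat] at e3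
          have e5 := hgt (l + j) (by omega) (by omega)
          rw [show j + (l + j) = j + l + j by omega] at e5
          exact absurd e5 (not_slt.2 e3)
        · rw [hAt] at e4
          rw [e2, cat_append]
          conv_rhs => rw [per_eq hAn]
          rcases eq_or_wordLT_of_snoc (by simp; omega) e4 with e5 | e5
          · rw [e5, ← hA, cat_le_cat]
            exact ih (n - (l + j)) (by omega) (l + j) rfl (by omega) (by omega)
          · exact (e5 _ _).le
  have suffix' : ∀ x q, V = x ++ q → x ≠ [] → q ≠ [] → cat V (per A) ≺ cat q (per A) := by
    intro x q hxq hx hq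
    obtain ⟨h1, h2, h3⟩ := snoc_subword_eq_append hxq hq
    have hx0 := List.length_pos_iff.2 hx
    set i := x.length with hi
    have hvi : subword a j n = subword a j (n - i) ++ subword a (j + (n - i)) i := by
      conv_lhs => rw [show n = (n - i) + i by omega, subword_add]
    have e0 : subword a (j + i) (n - i) = subword a (j + i) (n - 1 - i) ++ [true] := by
      rw [subword_eq_snoc (by omega)]
      · rw [show n - i - 1 = n - 1 - i by omega]
      · rw [show j + i + (n - i - 1) = j + (n - 1) by omega, f2]
    have e1 := f3 (subword a j i) (subword a (j + i) (n - i)) (by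
      conv_lhs => rw [show n = i + (n - i) by omega, subword_add])
      (by simp [← List.length_eq_zero_iff]; omega) (by simp [← List.length_eq_zero_iff]; omega)
    rw [e0, hvi] at e1
    have e2 := e1.of_append_left (by simp; omega)
    have hVi : V = subword a j (n - i) ++ (subword a (j + (n - i)) (n - 1 - (n - i)) ++ [false]) := by
      rw [hV, ← List.append_assoc, ← subword_add]
      congr 2; omega
    rcases eq_or_wordLT_of_snoc (by simp; omega) e2 with e3 | e3
    · rw [← h2] at e3
      rw [e3] at hVi
      have e4 : cat V (per A) ≼ cat q (per A) := by
        rw [hVi, cat_append, cat_le_cat]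
        exact shifts _ (n - i) rfl (by omega) (by omega)
      rcases lt_or_eq_of_le e4 with e5 | e5
      · exact e5
      exfalso
      -- Equality would make `V A^∞` purely periodic, hence equal to some shift of `A^∞`; this is
      -- impossible by `V < A` and by the inequality for suffixes of `A`.
      have e6 : cat V (per A) = cat q (per A) := toLex.injective e5
      have e7 : shift i (cat V (per A)) = cat V (per A) := by
        conv_lhs => rw [hxq, cat_append, hi, shift_cat_length]
        exact e6.symm
      have e8 : ∀ t, shift (t * i) (cat V (per A)) = cat V (per A) := by
        intro t
        induction t with
        | zero => simp
        | succ t iht => rw [add_mul, one_mul, ← shift_shift, iht, e7]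
      have hVl : V.length ≤ V.length * i := Nat.le_mul_of_pos_right _ hx0
      obtain ⟨l, hl⟩ := Nat.exists_eq_add_of_le hVl
      have e9 := e8 V.length
      rw [hl, shift_cat_add, shift_per_mod] at e9
      have hlt : l % A.length < A.length := Nat.mod_lt _ (List.length_pos_iff.2 hAn)
      rw [per_eq hAn, shift_cat hlt.le, ← per_eq hAn] at e9
      rcases Nat.eq_zero_or_pos (l % A.length) with hz | hz
      · rw [hz, List.drop_zero] at e9
        have := hVA (per A) (per A)
        rw [e9] at this
        exact lt_irrefl _ this
      · have := suffix (A.take (l % A.length)) (A.drop (l % A.length))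
          (List.take_append_drop _ _).symm (by
            rw [← List.length_pos_iff, List.length_take]; omega) (by
            rw [← List.length_pos_iff, List.length_drop]; omega)
        rw [e9] at this
        exact lt_irrefl _ this
    · rw [← h2] at e3
      rw [hVi]
      exact e3.append_left _ _ _
  exact ⟨hbelow.1, hbelow.2, hVA, suffix, suffix'⟩

end BaseData

end

section

/-! ### The hull of a Lyndon word -/

variable {β : ℝ} {S : List Bool}

/-- Only the case where `p` begins with `v` is not immediate; then `v p ≼ v σ^|v| p = p`. Applied
with `p = u^∞` for Lyndon words `u`. -/
theorem per_le_of_cat_le {v : List Bool} (hv : v ≠ []) {y p : ℕ → Bool} (h : cat v y ≼ p)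
    (hp : p ≼ shift v.length p) : per v ≼ p := by
  apply per_le hv
  rw [eq_cat_prefix p v.length] at h
  rcases eq_or_wordLT (by simp) h with h1 | h1
  · conv_rhs => rw [eq_cat_prefix p v.length, ← h1]
    exact (cat_le_cat _).2 hp
  · conv_rhs => rw [eq_cat_prefix p v.length]
    exact (h1 _ _).le

theorem shift_per_cat {w : List Bool} (hw : w ≠ []) (i : ℕ) :
    shift i (per w) = cat (w.drop (i % w.length)) (per w) := by
  rw [shift_per_mod]
  conv_lhs => rw [per_eq hw, shift_cat (Nat.mod_lt _ (List.length_pos_iff.2 hw)).le]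

/-- Replacing a digit `0` of a Lyndon word `v` by `1` and cutting off there, if this is the first
place where `v^∞` differs from `u^∞`. -/
theorem exists_raised {v : List Bool} (hv : StrongLyndon v) {p : ℕ → Bool} {k : ℕ}
    (hk : k < v.length) (hag : ∀ i < k, per v i = p i) (h0 : per v k = false) (h1 : p k = true) :
    StrongLyndon (v.take k ++ [true]) ∧ per v ≺ per (v.take k ++ [true]) ∧
      p = cat (v.take k ++ [true]) (shift (k + 1) p) := by
  have hv0 : v ≠ [] := by rintro rfl; simp at hk
  have e1 : v = v.take k ++ false :: v.drop (k + 1) := by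
    have : v[k] = false := by
      rw [per_eq hv0, cat_apply_lt hk, List.getD_eq_getElem _ _ hk] at h0
      exact h0
    rw [← this, List.cons_getElem_drop_succ, List.take_append_drop]
  have e2 : p = cat (v.take k ++ [true]) (shift (k + 1) p) := by
    have e3 : v.take k = subword p 0 k := by
      rw [← subword_cat hk.le (per v), ← per_eq hv0]
      exact subword_eq_of_agree (by simpa using hag)
    rw [e3, cat_append, ← h1, ← subword_one]
    conv_lhs => rw [eq_cat_prefix p k]
    rw [cat_subword]
  refine ⟨StrongLyndon.raise (q := v.drop (k + 1)) (by rw [← e1]; exact hv), ?_, e2⟩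
  refine per_le_per_of_wordLT hv0 (by simp) ?_
  conv_lhs => rw [e1]
  have := (wordLT_snoc (v.take k)).append_left (v.drop (k + 1))
  simpa using this

/-- If `v` itself is not `β`-Lyndon, cut it at the first difference from `u^∞` and raise the digit
there. Thus the hull is a minimum over words no longer than `v`, a finite set. -/
theorem exists_short_betaLyndon (hβ : 1 < β) (hβ2 : β ≤ 2) {v u : List Bool} (hv : StrongLyndon v)
    (hv0 : v ≠ []) (hu : IsBetaLyndon β u) (hvu : per v ≼ per u) :
    ∃ w, IsBetaLyndon β w ∧ w.length ≤ v.length ∧ per v ≼ per w ∧ per w ≼ per u := by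
  by_cases hadm : Admissible β (per v)
  · exact ⟨v, (isBetaLyndon_iff hβ hβ2).2 ⟨hv.isLyndon hv0, hadm⟩, le_rfl, le_rfl, hvu⟩
  obtain ⟨hul, hua⟩ := (isBetaLyndon_iff hβ hβ2).1 hu
  have hlt : per v ≺ per u := lt_of_le_of_ne hvu fun h => by
    rw [toLex.injective h] at hadm
    exact hadm hua
  obtain ⟨k, hag, h0, h1⟩ := slt_iff.1 hlt
  -- If `u^∞` began with `v`, then `v^∞ ≼ u^∞ ≼ σ^|v| u^∞` would bound each shift of `v^∞` by one of
  -- `u^∞` and make `v^∞` admissible.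
  have hk : k < v.length := by
    by_contra! hk
    apply hadm
    intro i
    have e1 : per u = cat v (shift v.length (per u)) := by
      conv_lhs => rw [eq_cat_prefix (per u) v.length]
      congr 1
      conv_rhs => rw [← subword_cat_length v (per v), ← per_eq hv0]
      refine subword_eq_of_agree fun i hi => ?_
      rw [zero_add, hag i (hi.trans_le hk)]
    refine lt_of_le_of_lt ?_ (hua (i % v.length))
    rw [shift_per_cat hv0, e1, shift_cat (Nat.mod_lt _ (List.length_pos_iff.2 hv0)).le]
    exact (cat_le_cat _).2 (hvu.trans (hul.per_le_shift _))
  obtain ⟨r1, r2, r4⟩ := exists_raised hv hk hag h0 h1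
  have r3 : per (v.take k ++ [true]) ≼ per u :=
    per_le_of_cat_le (by simp) (sle_of_eq r4.symm) (hul.per_le_shift _)
  refine ⟨v.take k ++ [true], (isBetaLyndon_iff hβ hβ2).2 ⟨r1.isLyndon (by simp), fun i => ?_⟩,
    by simp; omega, r2.le, r3⟩
  refine lt_of_le_of_lt ?_ (hua (i % (v.take k ++ [true]).length))
  rw [shift_per_cat (by simp), r4, shift_cat (Nat.mod_lt _ (by simp)).le]
  exact (cat_le_cat _).2 (r3.trans (hul.per_le_shift _))

theorem isBetaLyndonHull_betaLyndonHull (hβ : 1 < β) (hβ2 : β ≤ 2) {v u : List Bool}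
    (hv : StrongLyndon v) (hv0 : v ≠ []) (hu : IsBetaLyndon β u) (hvu : per v ≼ per u) :
    IsBetaLyndonHull β v (betaLyndonHull β v) := by
  apply Classical.epsilon_spec (p := IsBetaLyndonHull β v)
  let s : Set (List Bool) := {w | w.length ≤ v.length} ∩ {w | IsBetaLyndon β w ∧ per v ≼ per w}
  have hs : s.Finite := (List.finite_length_le Bool v.length).inter_of_left _
  have hex : ∀ u, IsBetaLyndon β u → per v ≼ per u → ∃ w ∈ s, per w ≼ per u := by
    intro u hu hvu
    obtain ⟨w, h1, h2, h3, h4⟩ := exists_short_betaLyndon hβ hβ2 hv hv0 hu hvu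
    exact ⟨w, ⟨h2, h1, h3⟩, h4⟩
  obtain ⟨w0, hw0, -⟩ := hex u hu hvu
  obtain ⟨w, hw, hmin⟩ := Set.exists_min_image s (fun w => toLex (per w)) hs ⟨w0, hw0⟩
  refine ⟨w, hw.2, fun x hx hvx => ?_⟩
  obtain ⟨y, hy, hyx⟩ := hex x hx hvx
  exact (hmin y hy).trans hyx

/-! ### Endpoints and inclusions of the intervals, and the windows -/

namespace BaseData

variable (H : BaseData β S)

include H

theorem isBetaLyndon : IsBetaLyndon β S :=
  (isBetaLyndon_iff H.one_lt H.lt_two.le).2 ⟨H.lyndon.isLyndon H.ne_nil, fun i =>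
    lt_of_le_of_lt (shift_per_le_maxRot H.ne_nil i) H.lower⟩

section

variable {j n : ℕ} (hj : IsPosition (baseSeq β) S j) (hn : IsNextLength (baseSeq β) j n)

include hj hn

theorem word_facts : StrongLyndon (subword (baseSeq β) j n) ∧ subword (baseSeq β) j n ≠ [] ∧
    2 ≤ n ∧ subword (baseSeq β) j n = subword (baseSeq β) j (n - 1) ++ [true] ∧
    per (subword (baseSeq β) j n) ≼ per S := by
  obtain ⟨p1, p2, p3, p4, p5⟩ := H.position_facts hj
  obtain ⟨f1, f2, f3, f4, f5⟩ := hn.facts p3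
  have h0 : subword (baseSeq β) j n ≠ [] := by
    rw [ne_eq, ← List.length_eq_zero_iff, length_subword]; omega
  refine ⟨f3, h0, f1, subword_eq_snoc (by omega) f2, ?_⟩
  apply per_le_of_cat_le h0 (y := shift (j + n) (baseSeq β))
  · rw [cat_subword]
    exact p4.trans H.shift_base_lt.le
  · exact (H.lyndon.isLyndon H.ne_nil).per_le_shift _

theorem hull_spec : IsBetaLyndonHull β (subword (baseSeq β) j n)
    (betaLyndonHull β (subword (baseSeq β) j n)) := by
  obtain ⟨h1, h2, h3, h4, h5⟩ := H.word_facts hj hn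
  exact isBetaLyndonHull_betaLyndonHull H.one_lt H.lt_two.le h1 h2 H.isBetaLyndon h5

theorem admissible_hull : Admissible β (per (betaLyndonHull β (subword (baseSeq β) j n))) :=
  ((isBetaLyndon_iff H.one_lt H.lt_two.le).1 (H.hull_spec hj hn).1.1).2

theorem upperEnd_eq : upperEnd β (subword (baseSeq β) j n) =
    val β (per (betaLyndonHull β (subword (baseSeq β) j n))) :=
  (H.admissible_hull hj hn).pointOf_eq H.one_lt H.lt_two.le

theorem admissible_lower : Admissible β (cat (subword (baseSeq β) j (n - 1) ++ [false])
    (per (subword (baseSeq β) 0 (j - 1) ++ [false]))) := by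
  obtain ⟨h1, h2⟩ := H.suffixBelow hj hn
  rw [List.append_assoc (_ ++ [true])] at h2
  rw [per_eq (by simp), ← cat_append]
  exact h2.of_append.admissible_cat (h1.admissible_per (by simp))

theorem lowerEnd_eq : lowerEnd β j (subword (baseSeq β) j n) =
    val β (cat (subword (baseSeq β) j (n - 1) ++ [false])
      (per (subword (baseSeq β) 0 (j - 1) ++ [false]))) := by
  obtain ⟨p1, p2, p3, p4, p5⟩ := H.position_facts hj
  obtain ⟨f1, f2, f3, f4, f5⟩ := hn.facts p3
  have hm := H.two_le
  have e1 : subword (alpha β) 0 (j - 1) = subword (baseSeq β) 0 (j - 1) := by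
    refine subword_eq_of_agree fun i hi => ?_
    rw [zero_add]
    rcases baseSeq_cases H.one_lt H.lt_two with ⟨-, q, q1, q2, q3, q4, -⟩ | h
    · refine (q1 i ?_).symm
      by_contra! hq
      rw [q4 _ (by omega)] at f2
      cases f2
    · rw [h]
  rw [lowerEnd, minus_subword (by omega), minus_subword (by omega), e1]
  exact (H.admissible_lower hj hn).pointOf_eq H.one_lt H.lt_two.le

theorem lower_lt_upper : cat (subword (baseSeq β) j (n - 1) ++ [false])
    (per (subword (baseSeq β) 0 (j - 1) ++ [false])) ≺
      per (betaLyndonHull β (subword (baseSeq β) j n)) := by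
  obtain ⟨h1, h2, h3, h4, h5⟩ := H.word_facts hj hn
  refine lt_of_lt_of_le ?_ (H.hull_spec hj hn).1.2
  rw [h4, per_eq (w := _ ++ [true]) (by simp)]
  exact wordLT_snoc _ _ _

theorem mem_interval {d : ℕ → Bool} (hd : Admissible β d)
    (h1 : cat (subword (baseSeq β) j (n - 1) ++ [false])
      (per (subword (baseSeq β) 0 (j - 1) ++ [false])) ≼ d)
    (h2 : d ≺ per (betaLyndonHull β (subword (baseSeq β) j n))) :
    val β d ∈ interval β j (subword (baseSeq β) j n) := by
  have hmem : val β d ∈ Set.Ico (lowerEnd β j (subword (baseSeq β) j n))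
      (upperEnd β (subword (baseSeq β) j n)) := by
    rw [H.lowerEnd_eq hj hn, H.upperEnd_eq hj hn]
    exact ⟨(H.admissible_lower hj hn).val_le_val H.one_lt H.lt_two.le h1,
      hd.val_lt_val H.one_lt H.lt_two.le h2⟩
  rw [interval]
  split_ifs
  · exact Set.Ico_subset_Icc_self hmem
  · exact hmem

omit H hn hj in
theorem lowerEnd_le_of_mem_interval {v : List Bool} {t : ℝ} (h : t ∈ interval β j v) :
    lowerEnd β j v ≤ t := by
  rw [interval] at h
  split_ifs at h <;> exact h.1

end

/-- A larger tail gives a larger `v^∞`, hence a larger hull and right endpoint, so only the left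
endpoints need a hypothesis. A common right endpoint in a closed interval forces the two words to
have the same periodic sequence, and then the other interval is closed too. -/
theorem interval_subset {j n j' n' : ℕ} (hj : IsPosition (baseSeq β) S j)
    (hn : IsNextLength (baseSeq β) j n) (hj' : IsPosition (baseSeq β) S j')
    (hn' : IsNextLength (baseSeq β) j' n')
    (hjj : shift j (baseSeq β) ≼ shift j' (baseSeq β))
    (hlow : cat (subword (baseSeq β) j' (n' - 1) ++ [false])
        (per (subword (baseSeq β) 0 (j' - 1) ++ [false])) ≼
      cat (subword (baseSeq β) j (n - 1) ++ [false])
        (per (subword (baseSeq β) 0 (j - 1) ++ [false]))) :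
    interval β j (subword (baseSeq β) j n) ⊆ interval β j' (subword (baseSeq β) j' n') := by
  have hβ := H.one_lt
  have hβ2 := H.lt_two.le
  obtain ⟨h1, h2, h3, h4, h5⟩ := H.word_facts hj hn
  obtain ⟨h1', h2', h3', h4', h5'⟩ := H.word_facts hj' hn'
  have hf := hn'.facts (H.position_facts hj').2.2.1
  have hvv : per (subword (baseSeq β) j n) ≼ per (subword (baseSeq β) j' n') := by
    apply per_le_of_cat_le h2 (y := shift (j + n) (baseSeq β))
    · rw [cat_subword]
      exact hjj.trans hf.2.2.2.1
    · exact (h1'.isLyndon h2').per_le_shift _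
  have hl : lowerEnd β j' (subword (baseSeq β) j' n') ≤ lowerEnd β j (subword (baseSeq β) j n) := by
    rw [H.lowerEnd_eq hj hn, H.lowerEnd_eq hj' hn']
    exact (H.admissible_lower hj' hn').val_le_val hβ hβ2 hlow
  have hhull := (H.hull_spec hj hn).2 _ (H.hull_spec hj' hn').1.1
    (hvv.trans (H.hull_spec hj' hn').1.2)
  have hu : upperEnd β (subword (baseSeq β) j n) ≤ upperEnd β (subword (baseSeq β) j' n') := by
    rw [H.upperEnd_eq hj hn, H.upperEnd_eq hj' hn']
    exact (H.admissible_hull hj hn).val_le_val hβ hβ2 hhull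
  intro t ht
  have hlt := hl.trans (lowerEnd_le_of_mem_interval ht)
  by_cases hclosed : t < upperEnd β (subword (baseSeq β) j' n')
  · rw [interval]
    split_ifs
    · exact ⟨hlt, hclosed.le⟩
    · exact ⟨hlt, hclosed⟩
  rw [interval] at ht
  split_ifs at ht with hc
  · have htu : t = upperEnd β (subword (baseSeq β) j' n') :=
      le_antisymm (ht.2.trans hu) (not_lt.1 hclosed)
    have huu : upperEnd β (subword (baseSeq β) j' n') ≤ upperEnd β (subword (baseSeq β) j n) := by
      rw [← htu]; exact ht.2
    rw [H.upperEnd_eq hj hn, H.upperEnd_eq hj' hn'] at huu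
    have huu' := (H.admissible_hull hj hn).le_of_val_le_val hβ hβ2 huu
    have hvv' : per (subword (baseSeq β) j' n') ≼ per (subword (baseSeq β) j n) :=
      (H.hull_spec hj' hn').1.2.trans (huu'.trans ((H.hull_spec hj hn).2 _ hc.1 le_rfl))
    have hper := sle_antisymm hvv' hvv
    have hadm := ((isBetaLyndon_iff hβ hβ2).1 hc.1).2
    have hbl : IsBetaLyndon β (subword (baseSeq β) j' n') :=
      (isBetaLyndon_iff hβ hβ2).2 ⟨h1'.isLyndon h2', hper ▸ hadm⟩
    have hsh : shift j' (alpha β) = per (subword (baseSeq β) j' n') := by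
      rcases baseSeq_cases hβ H.lt_two with ⟨-, q, -, -, -, -, hq⟩ | h
      -- For periodic `α(β)` some shift of `σ^j (α(β)) = v^∞` is `α(β)` itself, so `v^∞` is not
      -- admissible.
      · exfalso
        have hqk : ∀ k, shift (k * (q + 1)) (alpha β) = alpha β := by
          intro k
          induction k with
          | zero => simp
          | succ k ih => rw [add_mul, one_mul, ← shift_shift, ih, hq]
        have hjq : j ≤ j * (q + 1) := Nat.le_mul_of_pos_right _ (by omega)
        have := hadm (j * (q + 1) - j)
        rw [← hc.2.2, shift_shift, Nat.add_sub_cancel' hjq, hqk] at this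
        exact lt_irrefl _ this
      · refine sle_antisymm ?_ ?_
        · have := hf.2.2.2.1
          rwa [h] at this ⊢
        · rw [hper, ← hc.2.2]
          rwa [h] at hjj
    rw [interval, if_pos ⟨hbl, by simpa using h3', hsh⟩]
    exact ⟨hlt, htu.le⟩
  · exact absurd (lt_of_lt_of_le ht.2 hu) hclosed

/-- The dimension of the bifurcation set inside a non-transitivity window. -/
theorem dimH_window_pos {I : Set ℝ} (hI : IsWindow β S I) : 0 < dimH (bifurcationSet β ∩ I) := by
  have hβ := H.one_lt
  have hβ2 := H.lt_two.le
  obtain ⟨⟨j, n, hj, hn, rfl⟩, hmax⟩ := hI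
  have hlow : ∀ j' n', IsPosition (baseSeq β) S j' → IsNextLength (baseSeq β) j' n' → j' < j →
      shift j (baseSeq β) ≼ shift j' (baseSeq β) →
      cat (subword (baseSeq β) j (n - 1) ++ [false])
        (per (subword (baseSeq β) 0 (j - 1) ++ [false])) ≼
      cat (subword (baseSeq β) j' (n' - 1) ++ [false])
        (per (subword (baseSeq β) 0 (j' - 1) ++ [false])) := by
    intro j' n' hj' hn' _ hjj
    by_contra hcon
    have hlt := not_sle.1 hcon
    have hsub := H.interval_subset hj hn hj' hn' hjj hlt.le
    -- Maximality makes the two intervals equal, but the left endpoint of the one at `j'` is smaller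
    -- than that of the one at `j`.
    have hmem := hmax ⟨j', n', hj', hn', rfl⟩ hsub
      (H.mem_interval hj' hn' (H.admissible_lower hj' hn') le_rfl (H.lower_lt_upper hj' hn'))
    have := lowerEnd_le_of_mem_interval hmem
    rw [H.lowerEnd_eq hj hn] at this
    exact absurd ((H.admissible_lower hj' hn').val_lt_val hβ hβ2 hlt) (not_lt.2 this)
  have hB := H.blockData hj hn hlow
  obtain ⟨h1, h2, h3, h4, h5⟩ := H.word_facts hj hn
  obtain ⟨N, hN⟩ := hB.eventually_le_shift.exists
  refine (hB.dimH_pos hβ hβ2 N).trans_le (dimH_mono ?_)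
  rintro _ ⟨ω, rfl⟩
  have hadm := hB.admissible_familySeq N ω
  refine ⟨val_mem_bifurcationSet hβ hβ2 hadm (hN ω), H.mem_interval hj hn hadm
    (BlockData.limit_le_familySeq N ω) (lt_of_lt_of_le ?_ (H.hull_spec hj hn).1.2)⟩
  rw [h4, per_eq (w := _ ++ [true]) (by simp), familySeq, cat_append]
  exact wordLT_snoc _ _ _

end BaseData

end

section

/-! ### Comparison of survivor sets -/

open scoped NNReal ENNReal

variable {β : ℝ} {S : List Bool}

theorem abs_val_sub_le (hβ : 1 < β) (d e : ℕ → Bool) : |val β d - val β e| ≤ valBound β := by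
  have h1 := val_nonneg hβ d
  have h2 := val_nonneg hβ e
  have h3 := val_le_valBound hβ d
  have h4 := val_le_valBound hβ e
  rw [abs_le]
  constructor <;> linarith

theorem length_flatMap_mono {g f : ℕ → List Bool} (h : ∀ k, (g k).length ≤ (f k).length) (k : ℕ) :
    ((List.range k).flatMap g).length ≤ ((List.range k).flatMap f).length := by
  induction k with
  | zero => simp
  | succ k ih =>
    rw [flatMap_range_succ_right, flatMap_range_succ_right, List.length_append, List.length_append]
    exact add_le_add ih (h k)

/-- Longer blocks, even if they depend on the next symbol, give a set of smaller dimension. -/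
theorem dimH_range_flat_le (hβ : 1 < β) {g : Bool → List Bool} (hg : ∀ b, g b ≠ [])
    {t : Bool → Bool → List Bool} (hlen : ∀ b e, (g b).length ≤ (t b e).length) {c : ℝ}
    (hc0 : 0 < c) (hc : ∀ ω ω' : ℕ → Bool, ω 0 = false → ω' 0 = true →
      c ≤ |val β (flat fun k => g (ω k)) - val β (flat fun k => g (ω' k))|) (p : List Bool) :
    dimH (Set.range fun ω : ℕ → Bool => val β (cat p (flat fun k => t (ω k) (ω (k + 1))))) ≤
      dimH (Set.range fun ω : ℕ → Bool => val β (flat fun k => g (ω k))) := by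
  have hβ0 : 0 < β := one_pos.trans hβ
  have ht : ∀ b e, t b e ≠ [] := fun b e h => by
    have := hlen b e
    rw [h, List.length_nil, Nat.le_zero, List.length_eq_zero_iff] at this
    exact hg b this
  set M := (g true).length + (g false).length with hM
  have hB := valBound_nonneg hβ
  have h := dimH_range_le (r := 1) one_pos (C := ⟨valBound β * β ^ M / c, by positivity⟩)
    (U := fun ω : ℕ → Bool => val β (flat fun k => g (ω k)))
    (V := fun ω : ℕ → Bool => val β (cat p (flat fun k => t (ω k) (ω (k + 1))))) ?_
  · simpa using h
  intro ω ω'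
  rw [NNReal.coe_one, Real.rpow_one]
  change _ ≤ valBound β * β ^ M / c * _
  by_cases hω : ω = ω'
  · simp [hω]
  obtain ⟨k, hag, hne⟩ := exists_first_diff hω
  -- Since a block depends on the next symbol too, only `k - 1` blocks are sure to agree. The lost
  -- block accounts for the factor `β^M`.
  have e1 : |val β (cat p (flat fun k => t (ω k) (ω (k + 1)))) -
      val β (cat p (flat fun k => t (ω' k) (ω' (k + 1))))| ≤
      valBound β / β ^ ((List.range (k - 1)).flatMap fun i => t (ω i) (ω (i + 1))).length := by
    rw [val_cat_sub hβ, abs_div, abs_of_pos (pow_pos hβ0 _)]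
    refine (div_le_self (abs_nonneg _) (one_le_pow₀ hβ.le)).trans ?_
    rw [flat_eq_cat (f := fun k => t (ω k) (ω (k + 1))) (fun k => ht _ _) (k - 1),
      flat_eq_cat (f := fun k => t (ω' k) (ω' (k + 1))) (fun k => ht _ _) (k - 1)]
    have : ((List.range (k - 1)).flatMap fun i => t (ω' i) (ω' (i + 1))) =
        (List.range (k - 1)).flatMap fun i => t (ω i) (ω (i + 1)) := by
      rw [List.flatMap_def, List.flatMap_def]
      congr 1
      refine List.map_congr_left fun i hi => ?_
      have hi' := List.mem_range.1 hi
      rw [hag i (by omega), hag (i + 1) (by omega)]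
    rw [this, val_cat_sub hβ, abs_div, abs_of_pos (pow_pos hβ0 _)]
    gcongr
    exact abs_val_sub_le hβ _ _
  have e2 : ((List.range k).flatMap fun i => g (ω i)).length ≤
      ((List.range (k - 1)).flatMap fun i => t (ω i) (ω (i + 1))).length + M := by
    rcases k with _ | k
    · simp
    · rw [flatMap_range_succ_right, List.length_append]
      refine add_le_add (length_flatMap_mono (fun i => hlen _ _) _) ?_
      cases ω k <;> omega
  have e3 := flat_gap hβ hg hc hag hne
  refine e1.trans (le_trans ?_ (mul_le_mul_of_nonneg_left e3 (by positivity)))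
  have e4 := pow_le_pow_right₀ hβ.le e2
  rw [pow_add] at e4
  rw [div_mul_div_comm, div_le_div_iff₀ (by positivity) (by positivity)]
  have : 0 ≤ valBound β * c := by positivity
  nlinarith [mul_le_mul_of_nonneg_left e4 this]

/-- Iterating a step that can always be continued. -/
theorem exists_seq_of_step {X : Type*} {P : Bool → X → Prop} {R : Bool → X → Bool → X → Prop}
    (h : ∀ b y, P b y → ∃ b' y', R b y b' y' ∧ P b' y') {b₀ : Bool} {y₀ : X} (h0 : P b₀ y₀) :
    ∃ (ω : ℕ → Bool) (y : ℕ → X), y 0 = y₀ ∧ ∀ k, R (ω k) (y k) (ω (k + 1)) (y (k + 1)) := by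
  choose fb fy hR hP using h
  let s : ℕ → {q : Bool × X // P q.1 q.2} := fun k =>
    Nat.rec ⟨(b₀, y₀), h0⟩ (fun _ q => ⟨(fb _ _ q.2, fy _ _ q.2), hP _ _ q.2⟩) k
  exact ⟨fun k => (s k).1.1, fun k => (s k).1.2, rfl, fun k => hR _ _ (s k).2⟩

/-! ### Coding words and automaton at the first position -/

namespace BaseData

variable (H : BaseData β S)

include H

/-- Inside `S⁻` the lowered suffix of `S` is below the corresponding shift of `S^∞`; beyond it the
shift is one of `𝕃(S)^∞`. -/
theorem shift_cat_minus_le (l : ℕ) :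
    shift l (cat (minus S) (per (maxRot S))) ≼ per (maxRot S) := by
  obtain ⟨T, hT⟩ := H.lyndon.exists_snoc H.two_le
  have hlen : (minus S).length = S.length := by rw [hT, minus_snoc]; simp
  rcases lt_or_ge l S.length with hl | hl
  · rw [shift_cat (by omega), hT, minus_snoc, List.drop_append_of_le_length (by simp [hT] at hl; omega)]
    refine le_trans (LT.lt.le ?_) (shift_per_le_maxRot (by simp) l)
    rw [per_eq (w := T ++ [true]) (by simp), shift_cat (by rw [← hT]; omega),
      List.drop_append_of_le_length (by simp [hT] at hl; omega)]
    exact wordLT_snoc _ _ _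
  · obtain ⟨i, rfl⟩ := Nat.exists_eq_add_of_le hl
    rw [← hlen, shift_cat_add]
    obtain ⟨k, hk⟩ := exists_shift_eq_per_maxRot H.ne_nil
    conv_lhs => rw [hk, shift_shift]
    exact shift_per_le_maxRot H.ne_nil _

/-- A Lyndon word `w` that is a prefix of `S⁻ 𝕃(S)^∞` and no longer than the first word `v` of the
construction. -/
theorem exists_prefix_word {n : ℕ} (hn : IsNextLength (baseSeq β) S.length n) :
    ∃ w h, StrongLyndon w ∧ w ≠ [] ∧ w.length ≤ n ∧
      cat (minus S) (per (maxRot S)) = cat w h ∧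
      per (subword (baseSeq β) S.length n) ≼ per w := by
  obtain ⟨h1, h2, h3, h4, h5⟩ := H.word_facts .first hn
  obtain ⟨k, hag, k0, k1⟩ := slt_iff.1 H.upper
  set v := subword (baseSeq β) S.length n with hv
  have hvn : v.length = n := length_subword _ _ _
  have hx : ∀ i < n, per v i = shift S.length (baseSeq β) i := by
    intro i hi
    rw [per_eq h2, cat_apply_lt (by omega), hv, getD_subword hi, shift_apply]
  -- `k` is the first place where `σ^|S| a` falls below `S⁻𝕃(S)^∞`. If it lies inside `v`, raise
  -- that digit and cut; otherwise `v` itself is a prefix.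
  rcases lt_or_ge k n with hk | hk
  · obtain ⟨r1, r2, r3⟩ := exists_raised (p := cat (minus S) (per (maxRot S))) h1 (by omega)
      (fun i hi => (hx i (by omega)).trans (hag i hi)) ((hx k hk).trans k0) k1
    exact ⟨_, _, r1, by simp, by simp; omega, r3, r2.le⟩
  · refine ⟨v, shift n (cat (minus S) (per (maxRot S))), h1, h2, hvn.le, ?_, le_rfl⟩
    conv_lhs => rw [eq_cat_prefix (cat (minus S) (per (maxRot S))) n]
    congr 1
    have e : v = subword (shift S.length (baseSeq β)) 0 n := by simp [hv, subword, shift]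
    rw [e]
    refine subword_eq_of_agree fun i hi => ?_
    rw [zero_add, ← hag i (by omega)]

end BaseData

/-- The code words `S` and `w`. -/
def prefixCode (S w : List Bool) : Bool → List Bool
  | false => S
  | true => w

namespace BaseData

variable (H : BaseData β S)

include H

section PrefixCode

variable {w : List Bool} {h : ℕ → Bool} (hw : StrongLyndon w) (hw0 : w ≠ [])
  (hη : cat (minus S) (per (maxRot S)) = cat w h)

theorem prefixCode_ne_nil (hw0 : w ≠ []) (b : Bool) : prefixCode S w b ≠ [] := by
  cases b
  · exact H.ne_nil
  · exact hw0

include hw0 hη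

/-- If `w` is shorter than `S`, then `S = w t` with a proper suffix `t > S`; otherwise `w` starts
with `S⁻`. -/
theorem cat_prefix_lt (z : ℕ → Bool) : cat w (per S) ≺ cat S z := by
  obtain ⟨T, hT⟩ := H.lyndon.exists_snoc H.two_le
  have hlen : (minus S).length = S.length := by rw [hT, minus_snoc]; simp
  have hpre := congrArg (subword · 0 w.length) hη
  simp only [subword_cat_length] at hpre
  rcases lt_or_ge w.length S.length with hl | hl
  · have e1 : w = S.take w.length := by
      rw [subword_cat (by omega), hT, minus_snoc,
        List.take_append_of_le_length (by simp [hT] at hl; omega)] at hpre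
      conv_rhs => rw [hT]
      rw [List.take_append_of_le_length (by simp [hT] at hl; omega), hpre]
    have e2 : S = w ++ S.drop w.length := by
      conv_lhs => rw [← List.take_append_drop w.length S, ← e1]
    conv_rhs => rw [e2, cat_append]
    refine (cat_lt_cat _).2 ?_
    rw [per_eq H.ne_nil]
    exact H.lyndon _ _ e2 hw0 (by rw [← List.length_pos_iff, List.length_drop]; omega) _ _
  · obtain ⟨l, hl'⟩ := Nat.exists_eq_add_of_le hl
    rw [hl', ← hlen, subword_add, subword_cat_length] at hpre
    rw [← hpre]
    exact (H.lyndon.minus_lt H.two_le).append_left _ _ _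

theorem cat_prefix_le : cat w (per S) ≼ per S := by
  conv_rhs => rw [per_eq H.ne_nil]
  exact (H.cat_prefix_lt hw0 hη _).le

theorem per_prefix_le : per w ≼ per S := per_le hw0 (H.cat_prefix_le hw0 hη)

theorem flat_prefixCode_le (ω : ℕ → Bool) : flat (fun k => prefixCode S w (ω k)) ≼ per S := by
  refine flat_le (fun k => H.prefixCode_ne_nil hw0 _) fun k => ?_
  cases ω k
  · exact sle_of_eq (per_eq H.ne_nil).symm
  · exact H.cat_prefix_le hw0 hη

theorem per_le_flat_prefixCode (ω : ℕ → Bool) :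
    per w ≼ flat (fun k => prefixCode S w (ω k)) := by
  refine le_flat (fun k => H.prefixCode_ne_nil hw0 _) fun k => ?_
  cases ω k
  · conv_lhs => rw [per_eq hw0]
    exact ((cat_le_cat w).2 (H.per_prefix_le hw0 hη)).trans (H.cat_prefix_lt hw0 hη _).le
  · exact sle_of_eq (per_eq hw0)

/-- A tail is at most a suffix of `S` or `w` followed by `S^∞`. For `w` this uses that it is a
prefix of `S⁻𝕃(S)^∞`: a suffix of `w` that is a prefix of `𝕃(S)^∞` is followed there by a shift of
`𝕃(S)^∞`, which is at least `S^∞`. -/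
theorem shift_flat_prefixCode_le (ω : ℕ → Bool) (i : ℕ) :
    shift i (flat fun k => prefixCode S w (ω k)) ≼ per (maxRot S) := by
  obtain ⟨k, l, hl, e⟩ := shift_flat (fun k => H.prefixCode_ne_nil hw0 (ω k)) i
  rw [e]
  refine le_trans ((cat_le_cat _).2 (H.flat_prefixCode_le hw0 hη fun e => ω (e + (k + 1)))) ?_
  cases hω : ω k <;> rw [hω] at hl
  · change cat (S.drop l) (per S) ≼ _
    rw [← shift_cat (show l ≤ S.length from le_of_lt hl), ← per_eq H.ne_nil]
    exact shift_per_le_maxRot H.ne_nil _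
  · change cat (w.drop l) (per S) ≼ _
    have h1 := H.shift_cat_minus_le l
    rw [hη, shift_cat (show l ≤ w.length from le_of_lt hl), eq_cat_prefix (per (maxRot S)) (w.drop l).length] at h1
    conv_rhs => rw [eq_cat_prefix (per (maxRot S)) (w.drop l).length]
    rcases eq_or_wordLT (by simp) h1 with h2 | h2
    · rw [← h2]
      exact (cat_le_cat _).2 (H.per_le_shift _)
    · exact (h2 _ _).le

theorem admissible_flat_prefixCode (ω : ℕ → Bool) :
    Admissible β (flat fun k => prefixCode S w (ω k)) := fun i =>
  lt_of_le_of_lt (H.shift_flat_prefixCode_le hw0 hη ω i) H.lower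

include hw in
theorem per_le_shift_flat_prefixCode (ω : ℕ → Bool) (i : ℕ) :
    per w ≼ shift i (flat fun k => prefixCode S w (ω k)) := by
  obtain ⟨k, l, hl, e⟩ := shift_flat (fun k => H.prefixCode_ne_nil hw0 (ω k)) i
  have hle := H.per_le_flat_prefixCode hw0 hη
  rcases Nat.eq_zero_or_pos l with rfl | hl0
  · have e' := flat_eq (f := fun e => prefixCode S w (ω (e + k))) fun e => H.prefixCode_ne_nil hw0 _
    simp only [zero_add] at e'
    rw [e, List.drop_zero]
    convert hle fun e => ω (e + k) using 2
    rw [e']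
    simp only [add_assoc, add_comm 1 k]
  · rw [e]
    cases hω : ω k <;> rw [hω] at hl
    · refine (H.per_prefix_le hw0 hη).trans (LT.lt.le ?_)
      refine H.lyndon.per_lt_cat (x := S.take l) (List.take_append_drop _ _).symm ?_ ?_ _
      · rw [← List.length_pos_iff, List.length_take]; exact lt_min hl0 (by change l < S.length at hl; omega)
      · rw [← List.length_pos_iff, List.length_drop]; change l < S.length at hl; omega
    · refine LT.lt.le ?_
      refine hw.per_lt_cat (x := w.take l) (List.take_append_drop _ _).symm ?_ ?_ _
      · rw [← List.length_pos_iff, List.length_take]; exact lt_min hl0 (by change l < w.length at hl; omega)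
      · rw [← List.length_pos_iff, List.length_drop]; change l < w.length at hl; omega

theorem exists_prefixCode_gap : ∃ c, 0 < c ∧ ∀ ω ω' : ℕ → Bool, ω 0 = false → ω' 0 = true →
    c ≤ |val β (flat fun k => prefixCode S w (ω k)) - val β (flat fun k => prefixCode S w (ω' k))| := by
  have hβ := H.one_lt
  have hβ2 := H.lt_two.le
  have hne := H.prefixCode_ne_nil hw0
  have hadm := H.admissible_flat_prefixCode hw0 hη
  have e0 : cat S (per w) = flat fun k => prefixCode S w (decide (k ≠ 0)) := by
    rw [flat_eq fun k => hne _, per_eq_flat hw0]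
    simp [prefixCode]
  have e1 : cat w (per S) = flat fun k => prefixCode S w (decide (k = 0)) := by
    rw [flat_eq fun k => hne _, per_eq_flat H.ne_nil]
    simp [prefixCode]
  have a0 : Admissible β (cat S (per w)) := e0 ▸ hadm _
  have a1 : Admissible β (cat w (per S)) := e1 ▸ hadm _
  refine ⟨val β (cat S (per w)) - val β (cat w (per S)),
    sub_pos.2 (a1.val_lt_val hβ hβ2 (H.cat_prefix_lt hw0 hη _)), fun ω ω' h0 h1 => ?_⟩
  refine le_trans (sub_le_sub (a0.val_le_val hβ hβ2 ?_) ((hadm ω').val_le_val hβ hβ2 ?_))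
    (le_abs_self _)
  · rw [flat_eq fun k => hne _, h0]
    exact (cat_le_cat S).2 (H.per_le_flat_prefixCode hw0 hη _)
  · rw [flat_eq fun k => hne _, h1]
    exact (cat_le_cat w).2 (H.flat_prefixCode_le hw0 hη _)

end PrefixCode

/-- The words read off a sequence whose shifts are bounded below by the left endpoint, once it falls
below `v^∞`. The first digit is the current state, the second one the next state. -/
noncomputable def stateBlock (β : ℝ) (m n : ℕ) : Bool → Bool → List Bool
  | false, false => subword (baseSeq β) 0 (m - 1) ++ [false]
  | false, true => subword (baseSeq β) 0 (m - 1) ++ [true]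
  | true, false => subword (baseSeq β) m (n - 1) ++ [false]
  | true, true => subword (baseSeq β) m (n - 1) ++ [true]

/-- In state `0` the tail lies between `A^∞` and `A₀1 σ^|S| a`, in state `1` between `V A^∞` and
`v^∞`. The two bounds share all but the last digit of the next block, and each choice of that digit
yields the bound of the corresponding next state. -/
theorem exists_eq_flat_stateBlock {n : ℕ} (hn : IsNextLength (baseSeq β) S.length n)
    {y : ℕ → Bool} (hy : Admissible β y)
    (hlow : ∀ i, cat (subword (baseSeq β) S.length (n - 1) ++ [false])
      (per (subword (baseSeq β) 0 (S.length - 1) ++ [false])) ≼ shift i y)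
    (hyv : y ≼ per (subword (baseSeq β) S.length n)) :
    ∃ ω : ℕ → Bool, y = flat fun k => stateBlock β S.length n (ω k) (ω (k + 1)) := by
  obtain ⟨h1, h2, h3, h4, h5⟩ := H.word_facts .first hn
  have hf := (hn.facts (H.position_facts .first).2.2.1).2.2.2.1
  have hA := H.subword_start
  have hplus : plus (maxRot S) = subword (baseSeq β) 0 (S.length - 1) ++ [true] := by
    rw [← hA.1, plus_snoc]
  have hm := H.two_le
  rw [h4] at hyv hf
  set a := baseSeq β with ha
  set V := subword a S.length (n - 1) with hV
  set A := subword a 0 (S.length - 1) with hA'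
  let P : Bool → (ℕ → Bool) → Prop := fun b y => (Admissible β y ∧
    ∀ i, cat (V ++ [false]) (per (A ++ [false])) ≼ shift i y) ∧
      cond b (y ≼ per (V ++ [true])) (per (A ++ [false]) ≼ y)
  have hstep : ∀ b y, P b y → ∃ b' y', y = cat (stateBlock β S.length n b b') y' ∧ P b' y' := by
    intro b y hP
    obtain ⟨⟨p1, p2⟩, p3⟩ := hP
    have hsh : ∀ l, Admissible β (shift l y) ∧
        ∀ i, cat (V ++ [false]) (per (A ++ [false])) ≼ shift i (shift l y) := fun l =>
      ⟨p1.shift l, fun i => by rw [shift_shift]; exact p2 _⟩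
    cases b
    · have q1 : y ≺ cat (A ++ [true]) (shift S.length a) := by
        refine lt_of_lt_of_le (shift_zero y ▸ p1 0) ((alpha_le_baseSeq H.one_lt H.lt_two).trans ?_)
        conv_lhs => rw [← ha, eq_cat_prefix a S.length, hA.2, hplus]
      change per (A ++ [false]) ≼ y at p3
      have p3' := p3
      rw [per_eq (by simp)] at p3'
      rcases adjacent p3' q1.le with e | e
      · refine ⟨false, _, e, hsh _, ?_⟩
        rw [e] at p3'
        exact (cat_le_cat _).1 p3'
      · refine ⟨true, _, e, hsh _, ?_⟩
        rw [e] at q1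
        exact ((cat_lt_cat _).1 q1).le.trans hf
    · change y ≼ per (V ++ [true]) at p3
      have q1 := p2 0
      rw [shift_zero] at q1
      rw [per_eq (by simp)] at p3
      rcases adjacent q1 p3 with e | e
      · refine ⟨false, _, e, hsh _, ?_⟩
        rw [e] at q1
        exact (cat_le_cat _).1 q1
      · refine ⟨true, _, e, hsh _, ?_⟩
        rw [e] at p3
        exact (cat_le_cat _).1 p3
  obtain ⟨ω, s, hs0, hs⟩ := exists_seq_of_step
    (R := fun b y b' y' => y = cat (stateBlock β S.length n b b') y') hstep
    (b₀ := true) (y₀ := y) ⟨⟨hy, hlow⟩, hyv⟩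
  refine ⟨ω, hs0 ▸ eq_flat (fun k => ?_) hs⟩
  cases ω k <;> cases ω (k + 1) <;> simp [stateBlock]

/-- The survivor set of a point whose expansion starts like the left endpoint is not larger, in
dimension, than that of a point below `v^∞`. -/
theorem dimH_survivor_le {n : ℕ} (hn : IsNextLength (baseSeq β) S.length n) {d d' : ℕ → Bool}
    (hd' : Admissible β d') (hdv : d' ≺ per (subword (baseSeq β) S.length n))
    (hlow : cat (subword (baseSeq β) S.length (n - 1) ++ [false])
      (per (subword (baseSeq β) 0 (S.length - 1) ++ [false])) ≼ d) :
    dimH (survivor β (val β d)) ≤ dimH (survivor β (val β d')) := by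
  have hβ := H.one_lt
  have hβ2 := H.lt_two.le
  obtain ⟨h1, h2, h3, h4, h5⟩ := H.word_facts .first hn
  obtain ⟨w, h, hw, hw0, hwn, hη, hvw⟩ := H.exists_prefix_word hn
  obtain ⟨c, hc0, hc⟩ := H.exists_prefixCode_gap hw0 hη
  have hm := H.two_le
  -- A survivor for `d` either has all shifts at least `v^∞`, or is coded by the automaton after
  -- some finite prefix `p`; there are only countably many prefixes.
  have hsub : survivor β (val β d) ⊆ survivor β (val β d') ∪ ⋃ p : List Bool,
      Set.range fun ω : ℕ → Bool =>
        val β (cat p (flat fun k => stateBlock β S.length n (ω k) (ω (k + 1)))) := by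
    intro x hx
    obtain ⟨z, hz, rfl, hzd⟩ := exists_of_mem_survivor hβ hβ2 hx
    by_cases hall : ∀ i, per (subword (baseSeq β) S.length n) ≼ shift i z
    · exact Or.inl (val_mem_survivor hβ hβ2 hz hd' fun i => hdv.le.trans (hall i))
    · push Not at hall
      obtain ⟨i, hi⟩ := hall
      obtain ⟨ω, hω⟩ := H.exists_eq_flat_stateBlock hn (hz.shift i)
        (fun l => by rw [shift_shift]; exact hlow.trans (hzd _)) hi.le
      refine Or.inr (Set.mem_iUnion.2 ⟨subword z 0 i, ω, ?_⟩)
      change val β (cat _ (flat _)) = _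
      rw [← hω, ← eq_cat_prefix]
  refine (dimH_mono hsub).trans ?_
  rw [dimH_union, dimH_iUnion]
  refine max_le le_rfl (iSup_le fun p => ?_)
  refine (dimH_range_flat_le hβ (H.prefixCode_ne_nil hw0) (fun b e => ?_) hc0 hc p).trans
    (dimH_mono ?_)
  · cases b <;> cases e <;> simp [stateBlock, prefixCode] <;> omega
  · rintro _ ⟨ω, rfl⟩
    exact val_mem_survivor hβ hβ2 (H.admissible_flat_prefixCode hw0 hη ω) hd' fun i =>
      hdv.le.trans (hvw.trans (H.per_le_shift_flat_prefixCode hw hw0 hη ω i))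

/-- A nonempty collection contains the interval at the first position. A member of the family there
with exponent `N + 1` lies below one with exponent `N`, and the survivor set does not lose dimension
between them. -/
theorem dimH_sdiff_pos (hne : (intervals β S).Nonempty) :
    0 < dimH (bifurcationSet β \ dimBifurcationSet β) := by
  have hβ := H.one_lt
  have hβ2 := H.lt_two.le
  obtain ⟨n, hn⟩ : ∃ n, IsNextLength (baseSeq β) S.length n := by
    obtain ⟨_, j, n, hj, hn, -⟩ := hne
    induction hj generalizing n with
    | first => exact ⟨n, hn⟩
    | next _ hn0 ih => exact ih _ hn0
  obtain ⟨h1, h2, h3, h4, h5⟩ := H.word_facts .first hn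
  have hB := H.blockData .first hn fun j' n' hj' _ hlt _ =>
    absurd (H.position_facts hj').1 (not_le.2 hlt)
  obtain ⟨N, hN⟩ := Filter.eventually_atTop.1 hB.eventually_le_shift
  refine (hB.dimH_pos hβ hβ2 (N + 1)).trans_le (dimH_mono ?_)
  rintro _ ⟨ω, rfl⟩
  have hadm := hB.admissible_familySeq
  refine ⟨val_mem_bifurcationSet hβ hβ2 (hadm _ ω) (hN (N + 1) (by omega) ω), fun hdim => ?_⟩
  set d' := familySeq (subword (baseSeq β) 0 (S.length - 1))
    (subword (baseSeq β) S.length (n - 1) ++ [false]) N fun _ => false with hd'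
  have hlt : familySeq (subword (baseSeq β) 0 (S.length - 1))
      (subword (baseSeq β) S.length (n - 1) ++ [false]) (N + 1) ω ≺ d' := by
    rw [hd', familySeq, familySeq, List.replicate_succ', List.flatten_append, cat_append _ _ (tailSeq _ _ ω)]
    refine (cat_lt_cat _).2 ((cat_lt_cat _).2 ?_)
    -- After the common part `V A^(N+1)` the left side continues with `A`, the right side with `D`,
    -- and `A < D`.
    rw [tailSeq, tailSeq, flat_eq (f := fun k => block _ _ false) fun k => block_ne_nil _ _ _]
    simpa using wordLT_block _ _ _ _ _
  refine absurd (hdim.2 _ ((hadm _ ω).val_lt_val hβ hβ2 hlt)) (not_lt.2 ?_)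
  refine H.dimH_survivor_le hn (hadm _ _) ?_ (BlockData.limit_le_familySeq _ _)
  rw [h4, per_eq (w := _ ++ [true]) (by simp), hd', familySeq, cat_append]
  exact wordLT_snoc _ _ _

end BaseData

end

end BetaBifurcation

theorem theorem9p6 (S : List Bool) (hS : BetaBifurcation.IsLambda S) (bl br β : ℝ)
    (hI : BetaBifurcation.IsBasicInterval S bl br) (hβ : β ∈ Set.Ioo bl br) :
    (∀ I : Set ℝ, BetaBifurcation.IsWindow β S I →
      0 < dimH (BetaBifurcation.bifurcationSet β ∩ I)) ∧
    ((BetaBifurcation.intervals β S).Nonempty →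
      0 < dimH (BetaBifurcation.bifurcationSet β \ BetaBifurcation.dimBifurcationSet β)) := by
  have H := BetaBifurcation.baseData_of_mem hS.strongLyndon.1 hS.strongLyndon.2 hI hβ
  exact ⟨fun I hI => H.dimH_window_pos hI, H.dimH_sdiff_pos⟩
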